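/- A \emph{mixed state} of dimension $d$ is a positive semidefinite matrix $\rho\in\mathbb{C}^{d\times d}$ with $\mathrm{Tr}\,\rho=1$, and $\|\cdot\|_1$ is the trace norm (the sum of the singular values). A \emph{POVM} is a finite family $\{M_z\}$ of positive semidefinite matrices with $\sum_z M_z=I_d$; measuring $\rho$ with it gives the outcome $z$ with probability $\mathrm{Tr}(\rho M_z)$. An \emph{algorithm that uses $n$ incoherent (possibly adaptive) measurements} measures $n$ copies of an unknown state one at a time, each with a POVM that may depend on the outcomes of the earlier measurements, and then outputs an answer determined by the sequence of the $n$ outcomes. It \emph{tests mixedness to error $\varepsilon$} if it answers "mixed" with probability at least $2/3$ when $\rho=\frac1d I_d$, and answers "far" with probability at least $2/3$ for every mixed state $\rho$ with $\|\rho-\frac1d I_d\|_1>\varepsilon$. \textbf{Theorem.} There are absolute constants $c,C>0$ and $d_0\in\mathbb{N}$ such that for all $d\ge d_0$ and all $0<\varepsilon\le 1/12$: (1) every algorithm that uses $n$ incoherent, possibly adaptive, measurements and tests mixedness to error $\varepsilon$ has $n\ge c\,d^{3/2}/\varepsilon^2$; (2) there are an $n\le C\,d^{3/2}/\varepsilon^2$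 and an algorithm that uses $n$ incoherent measurements and tests mixedness to error $\varepsilon$. Thus the copy complexity of mixedness testing with incoherent measurements is $\Theta(d^{3/2}/\varepsilon^2)$. -/

import Mathlib

namespace MixednessTesting

open scoped ComplexOrder

/-- A `d`-dimensional mixed state: a positive semidefinite complex matrix of trace one. -/
structure IsState {d : ℕ} (ρ : Matrix (Fin d) (Fin d) ℂ) : Prop where
  posSemidef : ρ.PosSemidef
  trace_eq_one : ρ.trace = 1

/-- The maximally mixed state `I / d`. -/
noncomputable def maximallyMixed (d : ℕ) : Matrix (Fin d) (Fin d) ℂ :=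
  ((d : ℂ)⁻¹) • (1 : Matrix (Fin d) (Fin d) ℂ)

/-- The trace norm `‖A‖₁ = Tr √(Aᴴ A)`: the sum of the singular values of `A`, which are the
square roots of the eigenvalues of `Aᴴ A`. -/
noncomputable def traceNorm {d : ℕ} (A : Matrix (Fin d) (Fin d) ℂ) : ℝ :=
  ∑ i, √((Matrix.isHermitian_conjTranspose_mul_self A).eigenvalues i)

/-- A positive operator valued measurement on `ℂ^d` with outcomes `0, …, k - 1`. -/
structure POVM (d k : ℕ) where
  /-- The positive semidefinite matrix of each outcome. -/
  effect : Fin k → Matrix (Fin d) (Fin d) ℂ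
  posSemidef : ∀ z, (effect z).PosSemidef
  sum_eq_one : ∑ z, effect z = 1

/-- The probability `Tr (ρ M_z)` of the outcome `z` when `ρ` is measured with `M`. -/
noncomputable def POVM.prob {d k : ℕ} (M : POVM d k) (ρ : Matrix (Fin d) (Fin d) ℂ)
    (z : Fin k) : ℝ :=
  (ρ * M.effect z).trace.re

/-- The two possible answers of a mixedness tester. -/
inductive Answer : Type
  | mixed
  | far
deriving DecidableEq

/-- A decision algorithm that uses exactly `n` incoherent, possibly adaptive, measurements, as a
rooted tree of depth `n`. Each inner node carries the POVM that is applied to the next copy of the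
unknown state and has one child for each outcome, so the later measurements may depend on all the
outcomes seen so far; each leaf carries the answer given after that sequence of outcomes. -/
inductive IncoherentAlgorithm (d : ℕ) : ℕ → Type
  | output (a : Answer) : IncoherentAlgorithm d 0
  | measure {n k : ℕ} (M : POVM d k) (next : Fin k → IncoherentAlgorithm d n) :
      IncoherentAlgorithm d (n + 1)

/-- The probability that the algorithm answers `a` when it is run on `n` copies of `ρ`, that is,
the total probability of the leaves with answer `a`, where the probability of a leaf is the product
of the probabilities `Tr (ρ M_z)` of the outcomes along the path from the root. -/
noncomputable def IncoherentAlgorithm.answerProb {d : ℕ} (ρ : Matrix (Fin d) (Fin d) ℂ)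
    (a : Answer) : {n : ℕ} → IncoherentAlgorithm d n → ℝ
  | _, .output b => if b = a then 1 else 0
  | _, .measure M next => ∑ z, M.prob ρ z * (next z).answerProb ρ a

/-- The algorithm distinguishes between `ρ = I / d` and `‖ρ - I / d‖₁ > ε` with probability at
least `2 / 3`: in either case it gives the right answer with at least this probability. -/
def IncoherentAlgorithm.TestsMixedness {d n : ℕ} (A : IncoherentAlgorithm d n) (ε : ℝ) : Prop :=
  2 / 3 ≤ A.answerProb (maximallyMixed d) .mixed ∧
    ∀ ρ : Matrix (Fin d) (Fin d) ℂ, IsState ρ → ε < traceNorm (ρ - maximallyMixed d) →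
      2 / 3 ≤ A.answerProb ρ .far

end MixednessTesting

/-!
The lower bound is Le Cam's method. Perturb `I / d` by a Hermitian matrix whose only nonzero blocks
are a random sign matrix, scaled to move the state by `Θ(ε)` in trace norm. The likelihood ratio
of a sequence of outcomes is a product of factors `1 + w ⬝ᵥ y`, where `w` is the vector of signs
and `y` depends on the outcome. Its mean over `w` is bounded from below by the Gibbs variational
principle, with signs biased along the sum of the observed vectors as the trial distribution. What
remains are a few statistics of the observed vectors whose moments under `I / d` stay small until
`n` reaches `d ^ (3 / 2) / ε ^ 2`, whichever measurements are chosen adaptively, because every POVM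
yields a centred random vector `y` with covariance `O(ε ^ 2 / d ^ 2)`.

For the upper bound, measure in a random basis. By the Paley–Zygmund inequality, with constant
probability over the basis the outcomes of a far state are at `ℓ²` distance `Ω(ε / d)` from
uniform. For two samples of `N` outcomes with law `p`, the number of collisions between them has
mean `N ^ 2 / d + N ^ 2 * ‖p - u‖ ^ 2`, where `u` is the uniform law, and the excess stands out from
the fluctuations once `N` is of order `d ^ (3 / 2) / ε ^ 2`. Boundedly many repetitions amplify the
difference between the acceptance probabilities.
-/

namespace MixednessTesting

open Matrix
open scoped ComplexOrder ComplexConjugate BigOperators InnerProductSpace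

/-! ### Product measures -/

section ProductMeans

variable {ι α : Type*} [Fintype ι] [DecidableEq ι] [Fintype α]

/-- The expectation of `f` when the coordinates are independent and the coordinate `i` has the
law `p i`. It serves both for random signs and for samples of measurement outcomes. -/
noncomputable def prodMean (p : ι → α → ℝ) (f : (ι → α) → ℝ) : ℝ :=
  ∑ w, (∏ i, p i (w i)) * f w

lemma prodMean_add (p : ι → α → ℝ) (f g : (ι → α) → ℝ) :
    prodMean p (fun w => f w + g w) = prodMean p f + prodMean p g := by
  simp only [prodMean, mul_add, Finset.sum_add_distrib]

lemma prodMean_sub (p : ι → α → ℝ) (f g : (ι → α) → ℝ) :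
    prodMean p (fun w => f w - g w) = prodMean p f - prodMean p g := by
  simp only [prodMean, mul_sub, Finset.sum_sub_distrib]

lemma prodMean_const_mul (p : ι → α → ℝ) (c : ℝ) (f : (ι → α) → ℝ) :
    prodMean p (fun w => c * f w) = c * prodMean p f := by
  simp only [prodMean, Finset.mul_sum, mul_left_comm c]

lemma prodMean_sum {κ : Type*} (s : Finset κ) (p : ι → α → ℝ) (f : κ → (ι → α) → ℝ) :
    prodMean p (fun w => ∑ k ∈ s, f k w) = ∑ k ∈ s, prodMean p (f k) := by
  simp only [prodMean, Finset.mul_sum]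
  exact Finset.sum_comm

lemma prodMean_const {p : ι → α → ℝ} (hp : ∀ i, ∑ x, p i x = 1) (c : ℝ) :
    prodMean p (fun _ => c) = c := by
  have h := Finset.prod_univ_sum (fun _ : ι => (Finset.univ : Finset α)) p
  rw [Fintype.piFinset_univ] at h
  simp only [prodMean, ← Finset.sum_mul, ← h, hp, Finset.prod_const_one, one_mul]

lemma prodMean_prod (p g : ι → α → ℝ) :
    prodMean p (fun w => ∏ i, g i (w i)) = ∏ i, ∑ x, p i x * g i x := by
  rw [Finset.prod_univ_sum, Fintype.piFinset_univ]
  simp only [prodMean, Finset.prod_mul_distrib]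

lemma prodMean_apply_eq_sum {p : ι → α → ℝ} {a : ι} (hpa : ∑ x, p a x = 1)
    {F : α → (ι → α) → ℝ} (hF : ∀ x y w, F x (Function.update w a y) = F x w) :
    prodMean p (fun w => F (w a) w) = ∑ x, p a x * prodMean p (F x) := by
  have swap : Function.Involutive fun v : α × (ι → α) => (v.2 a, Function.update v.2 a v.1) :=
    fun v => by simp
  have weight_update (x : α) (w : ι → α) :
      p a (w a) * ∏ i, p i (Function.update w a x i) = p a x * ∏ i, p i (w i) := by
    have prod_erase : ∏ i ∈ Finset.univ.erase a, p i (Function.update w a x i) =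
        ∏ i ∈ Finset.univ.erase a, p i (w i) :=
      Finset.prod_congr rfl fun i hi => by rw [Function.update_of_ne (Finset.ne_of_mem_erase hi)]
    rw [← Finset.mul_prod_erase _ _ (Finset.mem_univ a), prod_erase,
      ← Finset.mul_prod_erase _ (fun i => p i (w i)) (Finset.mem_univ a), Function.update_self]
    ring
  calc prodMean p (fun w => F (w a) w)
      = ∑ v : α × (ι → α), p a v.1 * ((∏ i, p i (v.2 i)) * F (v.2 a) v.2) := by
        rw [Fintype.sum_prod_type, ← one_mul (prodMean p _), ← hpa, Finset.sum_mul]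
        simp only [prodMean, Finset.mul_sum]
    _ = ∑ v : α × (ι → α), p a v.1 * ((∏ i, p i (v.2 i)) * F v.1 v.2) := by
        rw [← Equiv.sum_comp (swap.toPerm _)]
        refine Finset.sum_congr rfl fun v _ => ?_
        simp only [Function.Involutive.coe_toPerm, Function.update_self, hF]
        rw [← mul_assoc, weight_update, mul_assoc]
    _ = ∑ x, p a x * prodMean p (F x) := by
        simp only [Fintype.sum_prod_type, prodMean, Finset.mul_sum]

lemma prodMean_apply {p : ι → α → ℝ} (hp : ∀ i, ∑ x, p i x = 1) (a : ι) (g : α → ℝ) :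
    prodMean p (fun w => g (w a)) = ∑ x, p a x * g x := by
  rw [prodMean_apply_eq_sum (hp a) (F := fun x _ => g x) fun _ _ _ => rfl]
  simp only [prodMean_const hp]

lemma prodMean_mono {p : ι → α → ℝ} (hp : ∀ i x, 0 ≤ p i x) {f g : (ι → α) → ℝ}
    (h : ∀ w, f w ≤ g w) : prodMean p f ≤ prodMean p g :=
  Finset.sum_le_sum fun w _ =>
    mul_le_mul_of_nonneg_left (h w) (Finset.prod_nonneg fun i _ => hp i (w i))

lemma prodMean_nonneg {p : ι → α → ℝ} (hp : ∀ i x, 0 ≤ p i x) {f : (ι → α) → ℝ}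
    (h : ∀ w, 0 ≤ f w) : 0 ≤ prodMean p f :=
  Finset.sum_nonneg fun w _ => mul_nonneg (Finset.prod_nonneg fun i _ => hp i (w i)) (h w)

lemma sq_prodMean_mul_le {p : ι → α → ℝ} (hp : ∀ i x, 0 ≤ p i x) (f g : (ι → α) → ℝ) :
    prodMean p (fun w => f w * g w) ^ 2 ≤
      prodMean p (fun w => f w ^ 2) * prodMean p (fun w => g w ^ 2) :=
  have weight_nonneg (w : ι → α) : 0 ≤ ∏ i, p i (w i) :=
    Finset.prod_nonneg fun i _ => hp i (w i)
  Finset.sum_sq_le_sum_mul_sum_of_sq_le_mul _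
    (fun w _ => mul_nonneg (weight_nonneg w) (sq_nonneg _))
    (fun w _ => mul_nonneg (weight_nonneg w) (sq_nonneg _)) fun _ _ => le_of_eq (by ring)

lemma exp_prodMean_le {p : ι → α → ℝ} (hp : ∀ i, p i ∈ stdSimplex ℝ α) (f : (ι → α) → ℝ) :
    Real.exp (prodMean p f) ≤ prodMean p (fun w => Real.exp (f w)) := by
  have total : ∑ w : ι → α, ∏ i, p i (w i) = 1 := by
    simpa [prodMean] using prodMean_const (fun i => (hp i).2) 1
  simpa only [smul_eq_mul, prodMean] using convexOn_exp.map_sum_le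
    (fun w _ => Finset.prod_nonneg fun i _ => (hp i).1 (w i)) total fun w _ => Set.mem_univ (f w)

lemma prodMean_indicator_lt_le {p : ι → α → ℝ} (hp : ∀ i x, 0 ≤ p i x) {f : (ι → α) → ℝ}
    (hf : ∀ w, 0 ≤ f w) {t : ℝ} (ht : 0 < t) :
    prodMean p ({w | t < f w}.indicator 1) ≤ prodMean p f / t := by
  rw [le_div_iff₀ ht, mul_comm, ← prodMean_const_mul]
  refine prodMean_mono hp fun w => ?_
  by_cases hw : t < f w
  · simpa [Set.indicator, hw] using hw.le
  · simpa [Set.indicator, hw] using hf w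

end ProductMeans

lemma sum_update_of_notMem {ι α M : Type*} [DecidableEq ι] [AddCommMonoid M] {s : Finset ι} {a : ι}
    (ha : a ∉ s) (v : ι → α → M) (w : ι → α) (x : α) :
    ∑ i ∈ s, v i (Function.update w a x i) = ∑ i ∈ s, v i (w i) :=
  Finset.sum_congr rfl fun i hi => by rw [Function.update_of_ne (ne_of_mem_of_not_mem hi ha)]

section Moments

variable {ι α E : Type*} [Fintype ι] [DecidableEq ι] [Fintype α]
  [NormedAddCommGroup E] [InnerProductSpace ℝ E]
  {p : ι → α → ℝ} {v : ι → α → E}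

lemma prodMean_inner_sum_eq_zero (hp : ∀ i, ∑ x, p i x = 1) (hv : ∀ i, ∑ x, p i x • v i x = 0)
    (s : Finset ι) (y : E) : prodMean p (fun w => ⟪y, ∑ i ∈ s, v i (w i)⟫_ℝ) = 0 := by
  simp only [inner_sum, prodMean_sum]
  refine Finset.sum_eq_zero fun i _ => ?_
  rw [prodMean_apply hp i fun x => ⟪y, v i x⟫_ℝ]
  simp only [← inner_smul_right, ← inner_sum, hv, inner_zero_right]

lemma prodMean_norm_sum_sq (hp : ∀ i, ∑ x, p i x = 1) (hv : ∀ i, ∑ x, p i x • v i x = 0)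
    (s : Finset ι) :
    prodMean p (fun w => ‖∑ i ∈ s, v i (w i)‖ ^ 2) = ∑ i ∈ s, ∑ x, p i x * ‖v i x‖ ^ 2 := by
  induction s using Finset.induction with
  | empty => simp [prodMean_const hp]
  | insert a s ha ih =>
    simp only [Finset.sum_insert ha]
    rw [prodMean_apply_eq_sum (hp a) (F := fun x w => ‖v a x + ∑ i ∈ s, v i (w i)‖ ^ 2)
      fun x y w => by rw [sum_update_of_notMem ha]]
    simp only [norm_add_sq_real, prodMean_add, prodMean_const hp, prodMean_const_mul,
      prodMean_inner_sum_eq_zero hp hv, ih, mul_zero, add_zero, mul_add, Finset.sum_add_distrib,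
      ← Finset.sum_mul, hp, one_mul]

lemma prodMean_norm_add_sum_pow_four_le (hp : ∀ i, p i ∈ stdSimplex ℝ α)
    (hv : ∀ i, ∑ x, p i x • v i x = 0) (s : Finset ι) (y : E) :
    prodMean p (fun w => ‖y + ∑ i ∈ s, v i (w i)‖ ^ 4) ≤
      prodMean p (fun w => 4 * (‖∑ i ∈ s, v i (w i)‖ ^ 2 * ⟪y, ∑ i ∈ s, v i (w i)⟫_ℝ)) +
        (‖y‖ ^ 4 + 6 * ‖y‖ ^ 2 * prodMean p (fun w => ‖∑ i ∈ s, v i (w i)‖ ^ 2) +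
          prodMean p (fun w => ‖∑ i ∈ s, v i (w i)‖ ^ 4)) := by
  have hp1 i := (hp i).2
  have expand (S : E) : ‖y + S‖ ^ 4 ≤ 4 * (‖S‖ ^ 2 * ⟪y, S⟫_ℝ) + (4 * ‖y‖ ^ 2 * ⟪y, S⟫_ℝ +
      (‖y‖ ^ 4 + (6 * ‖y‖ ^ 2 * ‖S‖ ^ 2 + ‖S‖ ^ 4))) := by
    have cauchy_schwarz : ⟪y, S⟫_ℝ ^ 2 ≤ ‖y‖ ^ 2 * ‖S‖ ^ 2 := by
      rw [← mul_pow]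
      exact sq_le_sq' (neg_le_of_abs_le (abs_real_inner_le_norm y S)) (real_inner_le_norm y S)
    rw [show ‖y + S‖ ^ 4 = (‖y + S‖ ^ 2) ^ 2 by ring, norm_add_sq_real]
    linarith
  refine (prodMean_mono (fun i => (hp i).1) fun w => expand _).trans_eq ?_
  simp only [prodMean_add, prodMean_const hp1, prodMean_const_mul,
    prodMean_inner_sum_eq_zero hp1 hv]
  ring

lemma prodMean_norm_sum_pow_four_le (hp : ∀ i, p i ∈ stdSimplex ℝ α)
    (hv : ∀ i, ∑ x, p i x • v i x = 0) {σ : ι → ℝ}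
    (h2 : ∀ i, ∑ x, p i x * ‖v i x‖ ^ 2 ≤ σ i ^ 2)
    (h4 : ∀ i, ∑ x, p i x * ‖v i x‖ ^ 4 ≤ 3 * σ i ^ 4) (s : Finset ι) :
    prodMean p (fun w => ‖∑ i ∈ s, v i (w i)‖ ^ 4) ≤ 3 * (∑ i ∈ s, σ i ^ 2) ^ 2 := by
  have hp1 i := (hp i).2
  induction s using Finset.induction with
  | empty => simp [prodMean_const hp1]
  | insert a s ha ih =>
    simp only [Finset.sum_insert ha]
    set S : (ι → α) → E := fun w => ∑ i ∈ s, v i (w i)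
    have cubic_eq_zero : ∑ x, p a x * prodMean p (fun w => 4 * (‖S w‖ ^ 2 * ⟪v a x, S w⟫_ℝ)) =
        0 := by
      have h (w : ι → α) : ∑ x, p a x * (4 * (‖S w‖ ^ 2 * ⟪v a x, S w⟫_ℝ)) =
          4 * (‖S w‖ ^ 2 * ⟪∑ x, p a x • v a x, S w⟫_ℝ) := by
        simp only [sum_inner, inner_smul_left, Finset.mul_sum, RCLike.conj_to_real]
        exact Finset.sum_congr rfl fun x _ => by ring
      simp only [← prodMean_const_mul, ← prodMean_sum] at h ⊢
      simp only [h, hv, inner_zero_left, mul_zero, prodMean_const hp1]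
    have second_moment_le :
        prodMean p (fun w => ‖S w‖ ^ 2) ≤ ∑ i ∈ s, σ i ^ 2 :=
      (prodMean_norm_sum_sq hp1 hv s).trans_le (Finset.sum_le_sum fun i _ => h2 i)
    calc prodMean p (fun w => ‖v a (w a) + S w‖ ^ 4)
        = ∑ x, p a x * prodMean p (fun w => ‖v a x + S w‖ ^ 4) :=
          prodMean_apply_eq_sum (hp1 a) (F := fun x w => ‖v a x + S w‖ ^ 4)
            fun x y w => by simp only [S, sum_update_of_notMem ha]
      _ ≤ ∑ x, p a x * (prodMean p (fun w => 4 * (‖S w‖ ^ 2 * ⟪v a x, S w⟫_ℝ)) +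
            (‖v a x‖ ^ 4 + 6 * ‖v a x‖ ^ 2 * prodMean p (fun w => ‖S w‖ ^ 2) +
              prodMean p (fun w => ‖S w‖ ^ 4))) :=
          Finset.sum_le_sum fun x _ => mul_le_mul_of_nonneg_left
            (prodMean_norm_add_sum_pow_four_le hp hv s (v a x)) ((hp a).1 x)
      _ = ∑ x, p a x * ‖v a x‖ ^ 4 +
            6 * ((∑ x, p a x * ‖v a x‖ ^ 2) * prodMean p (fun w => ‖S w‖ ^ 2)) +
              prodMean p (fun w => ‖S w‖ ^ 4) := by
          simp only [mul_add, Finset.sum_add_distrib, cubic_eq_zero,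
            ← Finset.sum_mul _ _ (prodMean _ _), hp1, one_mul, zero_add, ← add_assoc]
          congr 2
          simp only [Finset.mul_sum, Finset.sum_mul]
          exact Finset.sum_congr rfl fun x _ => by ring
      _ ≤ 3 * σ a ^ 4 + 6 * (σ a ^ 2 * ∑ i ∈ s, σ i ^ 2) + 3 * (∑ i ∈ s, σ i ^ 2) ^ 2 := by
          gcongr
          · exact h4 a
          · exact prodMean_nonneg (fun i => (hp i).1) fun w => by positivity
          · exact h2 a
      _ = 3 * (σ a ^ 2 + ∑ i ∈ s, σ i ^ 2) ^ 2 := by ring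

end Moments

/-! ### Random signs -/

section Signs

variable {ι : Type*}

/-- The vector of signs `±1` encoded by a vector of Booleans. -/
def signs (w : ι → Bool) (a : ι) : ℝ := if w a then 1 else -1

lemma signs_sq (w : ι → Bool) (a : ι) : signs w a ^ 2 = 1 := by
  unfold signs
  split_ifs <;> norm_num

lemma signs_flip [DecidableEq ι] (w : ι → Bool) (a b : ι) :
    signs (Function.update w a (!w a)) b = if b = a then -signs w b else signs w b := by
  rcases eq_or_ne b a with rfl | h
  · cases hb : w b <;> simp [signs, hb]
  · simp [signs, h]

/-- The law of a random sign with mean `θ a`, for each coordinate `a`; `signLaw 0` is uniform. -/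
noncomputable def signLaw (θ : ι → ℝ) (a : ι) (b : Bool) : ℝ :=
  (1 + θ a * if b then 1 else -1) / 2

lemma signLaw_mem_stdSimplex {θ : ι → ℝ} (hθ : ∀ a, |θ a| ≤ 1) (a : ι) :
    signLaw θ a ∈ stdSimplex ℝ Bool := by
  obtain ⟨lower, upper⟩ := abs_le.1 (hθ a)
  refine ⟨fun b => ?_, ?_⟩
  · cases b <;> simp [signLaw] <;> linarith
  · simp [signLaw]
    ring

lemma signLaw_zero_mem_stdSimplex (a : ι) : signLaw (0 : ι → ℝ) a ∈ stdSimplex ℝ Bool :=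
  signLaw_mem_stdSimplex (by simp) a

lemma sum_signLaw (θ : ι → ℝ) (a : ι) : ∑ b, signLaw θ a b = 1 := by
  simp [signLaw]
  ring

lemma sum_signLaw_mul (θ : ι → ℝ) (a : ι) (g : Bool → ℝ) :
    ∑ b, signLaw θ a b * g b = (1 + θ a) / 2 * g true + (1 - θ a) / 2 * g false := by
  simp [signLaw, sub_eq_add_neg]

lemma centered_sign_mean_eq_zero (θ y : ι → ℝ) (a : ι) :
    ∑ b, signLaw θ a b • (y a * ((if b then 1 else -1) - θ a)) = 0 := by
  simp [signLaw]
  ring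

lemma centered_sign_second_moment_le (θ y : ι → ℝ) (a : ι) :
    ∑ b, signLaw θ a b * ‖y a * ((if b then 1 else -1) - θ a)‖ ^ 2 ≤ y a ^ 2 := by
  simp only [sum_signLaw_mul, if_true, Bool.false_eq_true, if_false, Real.norm_eq_abs, sq_abs]
  nlinarith [mul_nonneg (sq_nonneg (y a)) (sq_nonneg (θ a))]

lemma centered_sign_fourth_moment_le {θ : ι → ℝ} (hθ : ∀ a, |θ a| ≤ 1) (y : ι → ℝ) (a : ι) :
    ∑ b, signLaw θ a b * ‖y a * ((if b then 1 else -1) - θ a)‖ ^ 4 ≤ 3 * y a ^ 4 := by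
  have sq_le_one : θ a ^ 2 ≤ 1 := (sq_le_one_iff_abs_le_one _).2 (hθ a)
  have kurtosis_le : (1 - θ a ^ 2) * (1 + 3 * θ a ^ 2) ≤ 3 := by nlinarith [sq_nonneg (θ a)]
  calc ∑ b, signLaw θ a b * ‖y a * ((if b then 1 else -1) - θ a)‖ ^ 4
      = y a ^ 4 * ((1 - θ a ^ 2) * (1 + 3 * θ a ^ 2)) := by
        simp only [sum_signLaw_mul, if_true, Bool.false_eq_true, if_false, Real.norm_eq_abs,
          Even.pow_abs (by decide : Even 4)]
        ring
    _ ≤ y a ^ 4 * 3 := by gcongr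
    _ = 3 * y a ^ 4 := mul_comm _ _

variable [Fintype ι]

lemma dotProduct_signs_eq_centered (θ y : ι → ℝ) (w : ι → Bool) :
    y ⬝ᵥ signs w = y ⬝ᵥ θ + ∑ a, y a * ((if w a then 1 else -1) - θ a) := by
  simp only [dotProduct, signs, ← Finset.sum_add_distrib, mul_sub, add_sub_cancel]

variable [DecidableEq ι]

lemma prodMean_signLaw_zero (f : (ι → Bool) → ℝ) :
    prodMean (signLaw 0) f = (2 ^ Fintype.card ι)⁻¹ * ∑ w, f w := by
  simp [prodMean, signLaw, Finset.mul_sum]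

lemma prodMean_signLaw_eq_zero_of_flip (a : ι) {f : (ι → Bool) → ℝ}
    (h : ∀ w, f (Function.update w a (!w a)) = -f w) : prodMean (signLaw 0) f = 0 := by
  have flip : Function.Involutive fun w : ι → Bool => Function.update w a (!w a) :=
    fun w => by simp
  have sum_neg := Equiv.sum_comp (flip.toPerm _) f
  simp only [Function.Involutive.coe_toPerm, h, Finset.sum_neg_distrib] at sum_neg
  rw [prodMean_signLaw_zero, show ∑ w, f w = 0 by linarith, mul_zero]

lemma prodMean_signLaw_eq_tilt (θ : ι → ℝ) (f : (ι → Bool) → ℝ) :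
    prodMean (signLaw θ) f = prodMean (signLaw 0) fun w => (∏ a, (1 + θ a * signs w a)) * f w := by
  rw [prodMean_signLaw_zero, prodMean, Finset.mul_sum]
  refine Finset.sum_congr rfl fun w _ => ?_
  simp only [signLaw, signs, Finset.prod_div_distrib, Finset.prod_const, Finset.card_univ]
  ring

lemma prodMean_dotProduct_signs (θ y : ι → ℝ) :
    prodMean (signLaw θ) (fun w => y ⬝ᵥ signs w) = y ⬝ᵥ θ := by
  simp only [dotProduct, signs, prodMean_sum, prodMean_const_mul]
  refine Finset.sum_congr rfl fun a _ => ?_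
  rw [prodMean_apply (sum_signLaw θ) a fun b => if b then 1 else -1, sum_signLaw_mul]
  simp only [if_true, Bool.false_eq_true, if_false]
  ring

lemma prodMean_dotProduct_signs_sq_le (θ y : ι → ℝ) :
    prodMean (signLaw θ) (fun w => (y ⬝ᵥ signs w) ^ 2) ≤ y ⬝ᵥ y + (y ⬝ᵥ θ) ^ 2 := by
  have mean := prodMean_inner_sum_eq_zero (sum_signLaw θ) (centered_sign_mean_eq_zero θ y)
    Finset.univ (1 : ℝ)
  have second := prodMean_norm_sum_sq (sum_signLaw θ) (centered_sign_mean_eq_zero θ y) Finset.univ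
  simp only [Real.norm_eq_abs, sq_abs, RCLike.inner_apply, map_one, mul_one] at mean second
  simp only [dotProduct_signs_eq_centered θ y, add_sq, mul_assoc, prodMean_add, prodMean_const_mul,
    prodMean_const (sum_signLaw θ), mean, second]
  have := Finset.sum_le_sum fun a (_ : a ∈ Finset.univ) => centered_sign_second_moment_le θ y a
  simp only [Real.norm_eq_abs, sq_abs] at this
  simp only [dotProduct, ← sq] at this ⊢
  linarith

lemma prodMean_dotProduct_signs_pow_four_le {θ : ι → ℝ} (hθ : ∀ a, |θ a| ≤ 1) (y : ι → ℝ) :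
    prodMean (signLaw θ) (fun w => (y ⬝ᵥ signs w) ^ 4) ≤
      8 * (3 * (y ⬝ᵥ y) ^ 2 + (y ⬝ᵥ θ) ^ 4) := by
  have fourth := prodMean_norm_sum_pow_four_le (signLaw_mem_stdSimplex hθ)
    (centered_sign_mean_eq_zero θ y) (centered_sign_second_moment_le θ y)
    (centered_sign_fourth_moment_le hθ y) Finset.univ
  simp only [Real.norm_eq_abs, Even.pow_abs (by decide : Even 4)] at fourth
  have power_mean (x z : ℝ) : (x + z) ^ 4 ≤ 8 * (x ^ 4 + z ^ 4) := by
    have h := Even.add_pow_le (a := x) (b := z) (by decide : Even 4)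
    norm_num at h ⊢
    exact h
  refine (prodMean_mono (fun a => (signLaw_mem_stdSimplex hθ a).1) fun w => ?_).trans
    (b := prodMean (signLaw θ) fun w =>
      8 * ((y ⬝ᵥ θ) ^ 4 + (∑ a, y a * ((if w a then 1 else -1) - θ a)) ^ 4)) ?_
  · rw [dotProduct_signs_eq_centered θ y]
    exact power_mean _ _
  · rw [prodMean_const_mul, prodMean_add, prodMean_const (sum_signLaw θ)]
    simp only [dotProduct, ← sq] at fourth ⊢
    linarith

lemma prodMean_exp_dotProduct_signs_le (y : ι → ℝ) :
    prodMean (signLaw 0) (fun w => Real.exp (y ⬝ᵥ signs w)) ≤ Real.exp (y ⬝ᵥ y / 2) := by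
  simp only [dotProduct, signs, Real.exp_sum, Finset.sum_div]
  rw [prodMean_prod (signLaw 0) fun a b => Real.exp (y a * if b then 1 else -1)]
  refine Finset.prod_le_prod (fun a _ => Finset.sum_nonneg fun b _ =>
    mul_nonneg ((signLaw_zero_mem_stdSimplex a).1 b) (Real.exp_pos _).le) fun a _ => ?_
  refine (Eq.trans_le ?_ (Real.cosh_le_exp_half_sq (y a))).trans_eq (by rw [sq])
  rw [sum_signLaw_mul, Real.cosh_eq]
  simp
  ring

lemma prodMean_indicator_lt_dotProduct_signs_le {x : ι → ℝ} (hx : x ⬝ᵥ x ≤ 1) {t : ℝ}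
    (ht : 0 < t) :
    prodMean (signLaw 0) ({w | t < x ⬝ᵥ signs w}.indicator 1) ≤ Real.exp (-(t ^ 2 / 2)) := by
  have nonneg a := (signLaw_zero_mem_stdSimplex (ι := ι) a).1
  calc prodMean (signLaw 0) ({w | t < x ⬝ᵥ signs w}.indicator 1)
      ≤ prodMean (signLaw 0)
          ({w | Real.exp (t * t) < Real.exp ((t • x) ⬝ᵥ signs w)}.indicator 1) := by
        refine prodMean_mono nonneg fun w => Set.indicator_le_indicator_of_subset
          (fun w hw => ?_) (fun _ => zero_le_one) w
        simpa [smul_dotProduct, ht] using hw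
    _ ≤ prodMean (signLaw 0) (fun w => Real.exp ((t • x) ⬝ᵥ signs w)) / Real.exp (t * t) :=
        prodMean_indicator_lt_le nonneg (fun w => (Real.exp_pos _).le) (Real.exp_pos _)
    _ ≤ Real.exp ((t • x) ⬝ᵥ (t • x) / 2) / Real.exp (t * t) := by
        gcongr
        exact prodMean_exp_dotProduct_signs_le (t • x)
    _ ≤ Real.exp (-(t ^ 2 / 2)) := by
        rw [← Real.exp_sub, Real.exp_le_exp, smul_dotProduct, dotProduct_smul, smul_eq_mul,
          smul_eq_mul]
        nlinarith [mul_le_mul_of_nonneg_left hx (sq_nonneg t)]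

end Signs

/-! ### Averaged products -/

section ListStatistics

variable {ι : Type*} [Fintype ι]

/-- The sum of the inner products of the pairs of entries of a list of vectors. -/
noncomputable def pairSum : List (ι → ℝ) → ℝ
  | [] => 0
  | y :: l => pairSum l + y ⬝ᵥ l.sum

/-- The sum of the squared inner products of the entries of a list of vectors with their sum. -/
noncomputable def alignSum (l : List (ι → ℝ)) : ℝ := (l.map fun y => (y ⬝ᵥ l.sum) ^ 2).sum

/-- The sum of the fourth powers of the coordinates of the sum of a list of vectors. -/
noncomputable def quarticSum (l : List (ι → ℝ)) : ℝ := ∑ a, l.sum a ^ 4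

lemma alignSum_nonneg (l : List (ι → ℝ)) : 0 ≤ alignSum l :=
  List.sum_nonneg fun x hx => by
    obtain ⟨y, -, rfl⟩ := List.mem_map.1 hx
    positivity

lemma quarticSum_nonneg (l : List (ι → ℝ)) : 0 ≤ quarticSum l :=
  Finset.sum_nonneg fun _ _ => by positivity

lemma dotProduct_self_nonneg_real (x : ι → ℝ) : 0 ≤ x ⬝ᵥ x := by
  simpa using dotProduct_star_self_nonneg x

lemma sq_dotProduct_le (x y : ι → ℝ) : (x ⬝ᵥ y) ^ 2 ≤ (x ⬝ᵥ x) * (y ⬝ᵥ y) := by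
  simpa only [dotProduct, sq] using Finset.sum_mul_sq_le_sq_mul_sq Finset.univ x y

lemma list_sum_dotProduct (l : List (ι → ℝ)) (x : ι → ℝ) :
    l.sum ⬝ᵥ x = (l.map fun y => y ⬝ᵥ x).sum := by
  induction l with
  | nil => simp
  | cons y l ih => simp [add_dotProduct, ih]

lemma sum_dotProduct_sum (l : List (ι → ℝ)) :
    l.sum ⬝ᵥ l.sum = (l.map fun y => y ⬝ᵥ y).sum + 2 * pairSum l := by
  induction l with
  | nil => simp [pairSum]
  | cons y l ih =>
    simp only [List.sum_cons, add_dotProduct, dotProduct_add, ih, List.map_cons, pairSum,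
      dotProduct_comm l.sum y]
    ring

end ListStatistics

section Logarithm

/-- A quartic polynomial below `log (1 + x)` for `|x| ≤ 11 / 12`. The parameter `δ` trades the
cubic Taylor term, whose expectation is not controlled, for the two even terms. -/
noncomputable def logMinorant (δ x : ℝ) : ℝ := x - x ^ 2 / 2 - (6 * δ * x ^ 2 + 6 / δ * x ^ 4)

/-- The relative entropy of a sign of mean `t` with respect to a uniform sign. -/
noncomputable def signEntropy (t : ℝ) : ℝ :=
  (1 + t) / 2 * Real.log (1 + t) + (1 - t) / 2 * Real.log (1 - t)

lemma logMinorant_le_self {δ : ℝ} (hδ : 0 ≤ δ) (x : ℝ) : logMinorant δ x ≤ x := by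
  have : 0 ≤ x ^ 2 / 2 + (6 * δ * x ^ 2 + 6 / δ * x ^ 4) := by positivity
  unfold logMinorant
  linarith

lemma logMinorant_le_log_one_add {x δ : ℝ} (hx : |x| ≤ 11 / 12) (hδ : 0 < δ) :
    logMinorant δ x ≤ Real.log (1 + x) := by
  have taylor := Real.abs_log_sub_add_sum_range_le (x := -x) (by rw [abs_neg]; linarith) 2
  simp only [Finset.sum_range_succ, Finset.sum_range_zero, abs_neg, sub_neg_eq_add] at taylor
  have remainder_le : |x| ^ 3 / (1 - |x|) ≤ 12 * |x| ^ 3 := by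
    rw [div_le_iff₀ (by linarith)]
    nlinarith [pow_nonneg (abs_nonneg x) 3]
  have cubic_le : 12 * |x| ^ 3 ≤ 6 * δ * x ^ 2 + 6 / δ * x ^ 4 := by
    have square : 6 * δ * |x| ^ 2 + 6 / δ * |x| ^ 4 - 12 * |x| ^ 3 =
        6 / δ * (|x| * (δ - |x|)) ^ 2 := by
      field_simp
      ring
    have : 0 ≤ 6 / δ * (|x| * (δ - |x|)) ^ 2 := by positivity
    rw [← sq_abs x, ← Even.pow_abs (by decide : Even 4) x]
    linarith
  have lower := (abs_le.1 (taylor.trans remainder_le)).1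
  norm_num at lower
  unfold logMinorant
  linarith

lemma log_one_add_le_quartic {t : ℝ} (ht : |t| ≤ 1 / 2) :
    Real.log (1 + t) ≤ t - t ^ 2 / 2 + t ^ 3 / 3 + 2 * t ^ 4 := by
  have taylor := Real.abs_log_sub_add_sum_range_le (x := -t) (by rw [abs_neg]; linarith) 3
  simp only [Finset.sum_range_succ, Finset.sum_range_zero, abs_neg, sub_neg_eq_add] at taylor
  have remainder_le : |t| ^ 4 / (1 - |t|) ≤ 2 * |t| ^ 4 := by
    rw [div_le_iff₀ (by linarith)]
    nlinarith [pow_nonneg (abs_nonneg t) 4]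
  have upper := (abs_le.1 (taylor.trans remainder_le)).2
  norm_num at upper
  rw [← Even.pow_abs (by decide : Even 4) t]
  linarith [(by ring : (-t) ^ 3 = -t ^ 3)]

lemma signEntropy_le {t : ℝ} (ht : |t| ≤ 1 / 2) : signEntropy t ≤ t ^ 2 / 2 + 3 * t ^ 4 := by
  obtain ⟨lower, upper⟩ := abs_le.1 ht
  have log_le := log_one_add_le_quartic ht
  have log_neg_le := log_one_add_le_quartic (t := -t) (by rwa [abs_neg])
  rw [← sub_eq_add_neg] at log_neg_le
  calc signEntropy t
      ≤ (1 + t) / 2 * (t - t ^ 2 / 2 + t ^ 3 / 3 + 2 * t ^ 4) +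
          (1 - t) / 2 * (-t - (-t) ^ 2 / 2 + (-t) ^ 3 / 3 + 2 * (-t) ^ 4) :=
        add_le_add (mul_le_mul_of_nonneg_left log_le (by linarith))
          (mul_le_mul_of_nonneg_left log_neg_le (by linarith))
    _ ≤ t ^ 2 / 2 + 3 * t ^ 4 := by nlinarith [sq_nonneg (t ^ 2)]

end Logarithm

section AveragedProduct

variable {ι : Type*} [Fintype ι]

lemma exp_sum_logMinorant_le_prod {l : List (ι → ℝ)} {δ : ℝ} (hδ : 0 < δ) {w : ι → Bool}
    (hw : ∀ u ∈ l, |u ⬝ᵥ signs w| ≤ 11 / 12) :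
    Real.exp (l.map fun u => logMinorant δ (u ⬝ᵥ signs w)).sum ≤
      (l.map fun u => 1 + u ⬝ᵥ signs w).prod := by
  induction l with
  | nil => simp
  | cons u l ih =>
    rw [List.forall_mem_cons] at hw
    simp only [List.map_cons, List.sum_cons, List.prod_cons, Real.exp_add]
    have pos : 0 < 1 + u ⬝ᵥ signs w := by linarith [(abs_le.1 hw.1).1]
    refine mul_le_mul ?_ (ih hw.2) (Real.exp_pos _).le pos.le
    rw [← Real.le_log_iff_exp_le pos]
    exact logMinorant_le_log_one_add hw.1 hδ

variable [DecidableEq ι]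

lemma prodMean_list_sum {α κ : Type*} [Fintype α] {p : ι → α → ℝ} (hp : ∀ i, ∑ x, p i x = 1)
    (f : κ → (ι → α) → ℝ) (l : List κ) :
    prodMean p (fun w => (l.map fun k => f k w).sum) = (l.map fun k => prodMean p (f k)).sum := by
  induction l with
  | nil => simp [prodMean_const hp]
  | cons k l ih => simp [prodMean_add, ih]

/-- The Gibbs variational principle, with the law of independent signs of means `θ a` as the
trial measure. -/
lemma exp_prodMean_sub_signEntropy_le {θ : ι → ℝ} (hθ : ∀ a, |θ a| < 1)
    (f : (ι → Bool) → ℝ) :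
    Real.exp (prodMean (signLaw θ) f - ∑ a, signEntropy (θ a)) ≤
      prodMean (signLaw 0) fun w => Real.exp (f w) := by
  have factor_pos (w : ι → Bool) (a : ι) : 0 < 1 + θ a * signs w a := by
    obtain ⟨lower, upper⟩ := abs_lt.1 (hθ a)
    unfold signs
    split_ifs <;> linarith
  have mean_log : prodMean (signLaw θ) (fun w => ∑ a, Real.log (1 + θ a * signs w a)) =
      ∑ a, signEntropy (θ a) := by
    rw [prodMean_sum]
    refine Finset.sum_congr rfl fun a _ => ?_
    simp only [signs]
    rw [prodMean_apply (sum_signLaw θ) a fun b => Real.log (1 + θ a * if b then 1 else -1),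
      sum_signLaw_mul]
    simp [signEntropy, sub_eq_add_neg]
  rw [← mean_log, ← prodMean_sub]
  refine (exp_prodMean_le (signLaw_mem_stdSimplex fun a => (hθ a).le) _).trans_eq ?_
  rw [prodMean_signLaw_eq_tilt]
  congr 1 with w
  rw [← Real.log_prod fun a _ => (factor_pos w a).ne', Real.exp_sub,
    Real.exp_log (Finset.prod_pos fun a _ => factor_pos w a),
    mul_div_cancel₀ _ (Finset.prod_pos fun a _ => factor_pos w a).ne']

lemma le_prodMean_logMinorant {δ r : ℝ} (hδ : 0 < δ) {u X : ι → ℝ} (hX : ∀ a, |X a| ≤ 1)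
    (hu : u ⬝ᵥ u ≤ r) :
    u ⬝ᵥ X - u ⬝ᵥ u / 2 - (u ⬝ᵥ X) ^ 2 / 2 - 6 * δ * (r + (u ⬝ᵥ X) ^ 2) -
        48 / δ * (3 * r ^ 2 + r * (X ⬝ᵥ X) * (u ⬝ᵥ X) ^ 2) ≤
      prodMean (signLaw X) fun w => logMinorant δ (u ⬝ᵥ signs w) := by
  have second := mul_le_mul_of_nonneg_left (prodMean_dotProduct_signs_sq_le X u)
    (by positivity : 0 ≤ 1 / 2 + 6 * δ)
  have fourth_dotProduct_le : (u ⬝ᵥ X) ^ 4 ≤ r * (X ⬝ᵥ X) * (u ⬝ᵥ X) ^ 2 := by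
    rw [show (u ⬝ᵥ X) ^ 4 = (u ⬝ᵥ X) ^ 2 * (u ⬝ᵥ X) ^ 2 by ring]
    gcongr
    exact (sq_dotProduct_le u X).trans
      (mul_le_mul_of_nonneg_right hu (dotProduct_self_nonneg_real X))
  have fourth : 6 / δ * prodMean (signLaw X) (fun w => (u ⬝ᵥ signs w) ^ 4) ≤
      48 / δ * (3 * r ^ 2 + r * (X ⬝ᵥ X) * (u ⬝ᵥ X) ^ 2) := by
    rw [show 48 / δ = 6 / δ * 8 by ring, mul_assoc]
    gcongr
    refine (prodMean_dotProduct_signs_pow_four_le hX u).trans ?_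
    gcongr
    exact dotProduct_self_nonneg_real u
  have mean_eq : prodMean (signLaw X) (fun w => logMinorant δ (u ⬝ᵥ signs w)) =
      u ⬝ᵥ X - (1 / 2 + 6 * δ) * prodMean (signLaw X) (fun w => (u ⬝ᵥ signs w) ^ 2) -
        6 / δ * prodMean (signLaw X) fun w => (u ⬝ᵥ signs w) ^ 4 := by
    rw [← prodMean_dotProduct_signs, ← prodMean_const_mul, ← prodMean_const_mul, ← prodMean_sub,
      ← prodMean_sub]
    congr 1 with w
    unfold logMinorant
    ring
  rw [mean_eq]
  linarith [mul_le_mul_of_nonneg_left hu hδ.le]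

lemma le_prodMean_sum_logMinorant {l : List (ι → ℝ)} {δ r : ℝ} (hδ : 0 < δ)
    (hl : ∀ u ∈ l, u ⬝ᵥ u ≤ r) (hX : ∀ a, |l.sum a| ≤ 1) :
    l.sum ⬝ᵥ l.sum / 2 + pairSum l - alignSum l / 2 - 6 * δ * (r * l.length + alignSum l) -
        48 / δ * (3 * r ^ 2 * l.length + r * (l.sum ⬝ᵥ l.sum) * alignSum l) ≤
      prodMean (signLaw l.sum) fun w => (l.map fun u => logMinorant δ (u ⬝ᵥ signs w)).sum := by
  rw [prodMean_list_sum (sum_signLaw _) fun u w => logMinorant δ (u ⬝ᵥ signs w)]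
  refine le_trans (le_of_eq ?_)
    (List.sum_le_sum fun u hu => le_prodMean_logMinorant hδ hX (hl u hu))
  have sum_eq (X : ι → ℝ) (l : List (ι → ℝ)) : (l.map fun u => u ⬝ᵥ X - u ⬝ᵥ u / 2 -
        (u ⬝ᵥ X) ^ 2 / 2 - 6 * δ * (r + (u ⬝ᵥ X) ^ 2) -
        48 / δ * (3 * r ^ 2 + r * (X ⬝ᵥ X) * (u ⬝ᵥ X) ^ 2)).sum =
      (l.map fun u => u ⬝ᵥ X).sum - (l.map fun u => u ⬝ᵥ u).sum / 2 -
        (l.map fun u => (u ⬝ᵥ X) ^ 2).sum / 2 -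
        6 * δ * (r * l.length + (l.map fun u => (u ⬝ᵥ X) ^ 2).sum) -
        48 / δ * (3 * r ^ 2 * l.length +
          r * (X ⬝ᵥ X) * (l.map fun u => (u ⬝ᵥ X) ^ 2).sum) := by
    induction l with
    | nil => simp
    | cons u l ih =>
      simp only [List.map_cons, List.sum_cons, ih, List.length_cons, Nat.cast_add, Nat.cast_one]
      ring
  rw [sum_eq, ← list_sum_dotProduct, alignSum]
  linarith [sum_dotProduct_sum l]

lemma prodMean_indicator_mul_exp_le {G : Set (ι → Bool)} {b : ℝ} (hb : 0 ≤ b)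
    (hG : prodMean (signLaw 0) (Gᶜ.indicator 1) ≤ b ^ 2) (X : ι → ℝ) :
    prodMean (signLaw 0) (Gᶜ.indicator fun w => Real.exp (X ⬝ᵥ signs w)) ≤
      b * Real.exp (X ⬝ᵥ X) := by
  have nonneg a := (signLaw_zero_mem_stdSimplex (ι := ι) a).1
  have indicator_eq : Gᶜ.indicator (fun w => Real.exp (X ⬝ᵥ signs w)) =
      fun w => Gᶜ.indicator 1 w * Real.exp (X ⬝ᵥ signs w) := by
    ext w
    by_cases hw : w ∈ G <;> simp [hw]
  have indicator_sq : (fun w => Gᶜ.indicator (1 : (ι → Bool) → ℝ) w ^ 2) = Gᶜ.indicator 1 := by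
    ext w
    by_cases hw : w ∈ G <;> simp [hw]
  have second_moment : prodMean (signLaw 0) (fun w => Real.exp (X ⬝ᵥ signs w) ^ 2) ≤
      Real.exp (X ⬝ᵥ X) ^ 2 := by
    have mgf := prodMean_exp_dotProduct_signs_le ((2 : ℝ) • X)
    simp only [smul_dotProduct, dotProduct_smul, smul_eq_mul] at mgf
    simp only [← Real.exp_nat_mul, Nat.cast_ofNat]
    exact mgf.trans_eq (congrArg _ (by ring))
  rw [indicator_eq]
  refine (abs_le_of_sq_le_sq' ?_ (by positivity)).2
  calc _ ≤ _ := sq_prodMean_mul_le nonneg _ _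
    _ ≤ b ^ 2 * Real.exp (X ⬝ᵥ X) ^ 2 := by
      rw [indicator_sq]
      exact mul_le_mul hG second_moment (prodMean_nonneg nonneg fun w => by positivity)
        (sq_nonneg b)
    _ = _ := (mul_pow _ _ _).symm

lemma exp_sub_le_prodMean_indicator_prod {l : List (ι → ℝ)} {δ r b : ℝ} (hδ : 0 < δ) (hb : 0 ≤ b)
    (hl : ∀ u ∈ l, u ⬝ᵥ u ≤ r) (hX : ∀ a, |l.sum a| ≤ 1 / 2) {G : Set (ι → Bool)}
    (hgood : ∀ w ∈ G, ∀ u ∈ l, |u ⬝ᵥ signs w| ≤ 11 / 12)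
    (hbad : prodMean (signLaw 0) (Gᶜ.indicator 1) ≤ b ^ 2) :
    Real.exp (pairSum l - 3 * quarticSum l - alignSum l / 2 -
        6 * δ * (r * l.length + alignSum l) -
        48 / δ * (3 * r ^ 2 * l.length + r * (l.sum ⬝ᵥ l.sum) * alignSum l)) -
      b * Real.exp (l.sum ⬝ᵥ l.sum) ≤
    prodMean (signLaw 0) (G.indicator fun w => (l.map fun u => 1 + u ⬝ᵥ signs w).prod) := by
  set minorant : (ι → Bool) → ℝ := fun w => (l.map fun u => logMinorant δ (u ⬝ᵥ signs w)).sum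
  have nonneg a := (signLaw_zero_mem_stdSimplex (ι := ι) a).1
  have minorant_le_linear (w : ι → Bool) : minorant w ≤ l.sum ⬝ᵥ signs w :=
    (List.sum_le_sum fun u _ => logMinorant_le_self hδ.le _).trans_eq
      (list_sum_dotProduct l (signs w)).symm
  have entropy_le : ∑ a, signEntropy (l.sum a) ≤ l.sum ⬝ᵥ l.sum / 2 + 3 * quarticSum l := by
    refine (Finset.sum_le_sum fun a _ => signEntropy_le (hX a)).trans_eq ?_
    simp only [Finset.sum_add_distrib, ← Finset.sum_div, ← Finset.mul_sum, quarticSum,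
      dotProduct, sq]
  have mean_ge := le_prodMean_sum_logMinorant hδ hl fun a => (hX a).trans (by norm_num)
  have gibbs := exp_prodMean_sub_signEntropy_le
    (fun a => (hX a).trans_lt (by norm_num)) minorant
  have split : prodMean (signLaw 0) (fun w => Real.exp (minorant w)) ≤
      prodMean (signLaw 0) (G.indicator fun w => (l.map fun u => 1 + u ⬝ᵥ signs w).prod) +
        prodMean (signLaw 0) (Gᶜ.indicator fun w => Real.exp (l.sum ⬝ᵥ signs w)) := by
    rw [← prodMean_add]
    refine prodMean_mono nonneg fun w => ?_
    by_cases hw : w ∈ G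
    · simpa [hw] using exp_sum_logMinorant_le_prod hδ (hgood w hw)
    · simpa [hw] using minorant_le_linear w
  have bad_le := prodMean_indicator_mul_exp_le hb hbad l.sum
  have exponent_le := Real.exp_le_exp.2 (sub_le_sub mean_ge entropy_le)
  refine sub_le_iff_le_add.2 ((Real.exp_le_exp.2 ?_).trans (exponent_le.trans (gibbs.trans
    (split.trans (add_le_add_right bad_le _)))))
  linarith

end AveragedProduct

/-! ### Isotropic steps -/

section IsotropicSteps

variable {ι Ω : Type*} [Fintype ι] [Fintype Ω]

/-- A centred random vector of squared norm at most `r`, with covariance at most `κ`, that takes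
the value `y z` with probability `p z`. -/
structure IsIsotropicStep (κ r : ℝ) (p : Ω → ℝ) (y : Ω → ι → ℝ) : Prop where
  mem_stdSimplex : p ∈ stdSimplex ℝ Ω
  norm_le : ∀ z, y z ⬝ᵥ y z ≤ r
  mean_eq_zero : ∀ v, ∑ z, p z * (y z ⬝ᵥ v) = 0
  cov_le : ∀ v, ∑ z, p z * (y z ⬝ᵥ v) ^ 2 ≤ κ * (v ⬝ᵥ v)

namespace IsIsotropicStep

variable {κ r : ℝ} {p : Ω → ℝ} {y : Ω → ι → ℝ}

lemma mean_le_of_le (h : IsIsotropicStep κ r p y) {f : Ω → ℝ} {c : ℝ} (hf : ∀ z, f z ≤ c) :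
    ∑ z, p z * f z ≤ c :=
  calc ∑ z, p z * f z ≤ ∑ z, p z * c :=
        Finset.sum_le_sum fun z _ => mul_le_mul_of_nonneg_left (hf z) (h.mem_stdSimplex.1 z)
    _ = c := by rw [← Finset.sum_mul, h.mem_stdSimplex.2, one_mul]

lemma mean_affine (h : IsIsotropicStep κ r p y) (a b : ℝ) (v : ι → ℝ) :
    ∑ z, p z * (a + b * (y z ⬝ᵥ v)) = a := by
  simp only [mul_add, mul_left_comm _ b, Finset.sum_add_distrib, ← Finset.sum_mul,
    ← Finset.mul_sum, h.mem_stdSimplex.2, h.mean_eq_zero, one_mul, mul_zero, add_zero]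

lemma mean_affine_sq_le (h : IsIsotropicStep κ r p y) (a : ℝ) (v : ι → ℝ) :
    ∑ z, p z * (a + y z ⬝ᵥ v) ^ 2 ≤ a ^ 2 + κ * (v ⬝ᵥ v) := by
  have expand (z : Ω) : p z * (a + y z ⬝ᵥ v) ^ 2 =
      p z * (a ^ 2 + (2 * a) * (y z ⬝ᵥ v)) + p z * (y z ⬝ᵥ v) ^ 2 := by ring
  simp only [expand, Finset.sum_add_distrib, h.mean_affine]
  linarith [h.cov_le v]

lemma mean_coord_sq_le (h : IsIsotropicStep κ r p y) (a : ι) : ∑ z, p z * y z a ^ 2 ≤ κ := by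
  classical simpa using h.cov_le (Pi.single a 1)

lemma mean_coord_eq_zero (h : IsIsotropicStep κ r p y) (a : ι) : ∑ z, p z * y z a = 0 := by
  classical simpa using h.mean_eq_zero (Pi.single a 1)

lemma mean_norm_add_sq_le (h : IsIsotropicStep κ r p y) (x : ι → ℝ) :
    ∑ z, p z * ((y z + x) ⬝ᵥ (y z + x)) ≤ x ⬝ᵥ x + r := by
  have expand (z : Ω) : p z * ((y z + x) ⬝ᵥ (y z + x)) =
      p z * (x ⬝ᵥ x + 2 * (y z ⬝ᵥ x)) + p z * (y z ⬝ᵥ y z) := by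
    simp only [add_dotProduct, dotProduct_add, dotProduct_comm x (y z)]
    ring
  simp only [expand, Finset.sum_add_distrib, h.mean_affine]
  linarith [h.mean_le_of_le h.norm_le]

lemma mean_sum_sq_dotProduct_add_le (h : IsIsotropicStep κ r p y) (hκ : 0 ≤ κ)
    {l : List (ι → ℝ)} (hl : ∀ v ∈ l, v ⬝ᵥ v ≤ r) (x : ι → ℝ) :
    ∑ z, p z * (l.map fun v => (v ⬝ᵥ (y z + x)) ^ 2).sum ≤
      (l.map fun v => (v ⬝ᵥ x) ^ 2).sum + κ * r * l.length := by
  induction l with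
  | nil => simp
  | cons v l ih =>
    rw [List.forall_mem_cons] at hl
    have ih := ih hl.2
    have head := h.mean_affine_sq_le (x ⬝ᵥ v) v
    simp only [List.map_cons, List.sum_cons, mul_add, Finset.sum_add_distrib, dotProduct_add,
      List.length_cons, Nat.cast_add, Nat.cast_one, dotProduct_comm v] at ih ⊢
    simp only [add_comm (_ ⬝ᵥ v) (x ⬝ᵥ v)] at ih ⊢
    linarith [mul_le_mul_of_nonneg_left hl.1 hκ]

lemma mean_sq_dotProduct_self_add_le (h : IsIsotropicStep κ r p y) (x : ι → ℝ) :
    ∑ z, p z * (y z ⬝ᵥ (y z + x)) ^ 2 ≤ 2 * κ * (x ⬝ᵥ x) + 2 * r ^ 2 := by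
  have pointwise (z : Ω) : (y z ⬝ᵥ (y z + x)) ^ 2 ≤ 2 * (y z ⬝ᵥ x) ^ 2 + 2 * r ^ 2 := by
    have sq_norm_le : (y z ⬝ᵥ y z) ^ 2 ≤ r ^ 2 :=
      pow_le_pow_left₀ (dotProduct_self_nonneg_real _) (h.norm_le z) 2
    rw [dotProduct_add]
    linarith [add_sq_le (a := y z ⬝ᵥ y z) (b := y z ⬝ᵥ x)]
  calc ∑ z, p z * (y z ⬝ᵥ (y z + x)) ^ 2
      ≤ ∑ z, p z * (2 * (y z ⬝ᵥ x) ^ 2 + 2 * r ^ 2) := Finset.sum_le_sum fun z _ =>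
        mul_le_mul_of_nonneg_left (pointwise z) (h.mem_stdSimplex.1 z)
    _ = 2 * (∑ z, p z * (y z ⬝ᵥ x) ^ 2) + 2 * r ^ 2 := by
        simp only [mul_add, mul_left_comm (p _), Finset.sum_add_distrib, ← Finset.mul_sum,
          ← Finset.sum_mul, h.mem_stdSimplex.2, one_mul]
    _ ≤ 2 * κ * (x ⬝ᵥ x) + 2 * r ^ 2 := by linarith [h.cov_le x]

lemma mean_alignSum_le (h : IsIsotropicStep κ r p y) (hκ : 0 ≤ κ) {l : List (ι → ℝ)}
    (hl : ∀ v ∈ l, v ⬝ᵥ v ≤ r) :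
    ∑ z, p z * alignSum (y z :: l) ≤
      alignSum l + κ * r * l.length + 2 * κ * (l.sum ⬝ᵥ l.sum) + 2 * r ^ 2 := by
  simp only [alignSum, List.sum_cons, List.map_cons, mul_add, Finset.sum_add_distrib]
  linarith [h.mean_sum_sq_dotProduct_add_le hκ hl l.sum, h.mean_sq_dotProduct_self_add_le l.sum]

lemma sum_pow_four_le (h : IsIsotropicStep κ r p y) (z : Ω) : ∑ a, y z a ^ 4 ≤ r ^ 2 :=
  calc ∑ a, y z a ^ 4 = ∑ a, (y z a ^ 2) ^ 2 := by simp only [← pow_mul]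
    _ ≤ (∑ a, y z a ^ 2) ^ 2 := Finset.sum_sq_le_sq_sum_of_nonneg fun _ _ => sq_nonneg _
    _ = (y z ⬝ᵥ y z) ^ 2 := by simp only [dotProduct, sq]
    _ ≤ r ^ 2 := pow_le_pow_left₀ (dotProduct_self_nonneg_real _) (h.norm_le z) 2

lemma mean_quarticSum_le (h : IsIsotropicStep κ r p y) (l : List (ι → ℝ)) :
    ∑ z, p z * quarticSum (y z :: l) ≤
      quarticSum l + 8 * κ * (l.sum ⬝ᵥ l.sum) + 3 * r ^ 2 := by
  set x := l.sum
  have pow_four_add_le (s t : ℝ) :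
      (t + s) ^ 4 ≤ s ^ 4 + 4 * s ^ 3 * t + 8 * s ^ 2 * t ^ 2 + 3 * t ^ 4 := by
    nlinarith [mul_nonneg (sq_nonneg t) (sq_nonneg (s - t))]
  have pointwise (z : Ω) : quarticSum (y z :: l) ≤
      ∑ a, (x a ^ 4 + 4 * x a ^ 3 * y z a + 8 * x a ^ 2 * y z a ^ 2) + 3 * r ^ 2 := by
    refine (Finset.sum_le_sum fun a _ => pow_four_add_le (x a) (y z a)).trans ?_
    rw [Finset.sum_add_distrib, ← Finset.mul_sum]
    linarith [h.sum_pow_four_le z]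
  calc ∑ z, p z * quarticSum (y z :: l)
      ≤ ∑ z, p z * (∑ a, (x a ^ 4 + 4 * x a ^ 3 * y z a + 8 * x a ^ 2 * y z a ^ 2) +
          3 * r ^ 2) := Finset.sum_le_sum fun z _ =>
        mul_le_mul_of_nonneg_left (pointwise z) (h.mem_stdSimplex.1 z)
    _ = ∑ a, (x a ^ 4 + 4 * x a ^ 3 * (∑ z, p z * y z a) +
          8 * x a ^ 2 * ∑ z, p z * y z a ^ 2) + 3 * r ^ 2 := by
        simp only [mul_add, Finset.sum_add_distrib, Finset.mul_sum]
        iterate 3 rw [Finset.sum_comm (s := (Finset.univ : Finset Ω))]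
        simp only [mul_left_comm (p _), ← Finset.mul_sum, ← Finset.sum_mul, h.mem_stdSimplex.2,
          one_mul]
    _ ≤ ∑ a, (x a ^ 4 + 8 * κ * (x a * x a)) + 3 * r ^ 2 := by
        refine add_le_add_left (Finset.sum_le_sum fun a _ => ?_) _
        rw [h.mean_coord_eq_zero]
        linarith [mul_le_mul_of_nonneg_left (h.mean_coord_sq_le a) (sq_nonneg (x a))]
    _ = quarticSum l + 8 * κ * (x ⬝ᵥ x) + 3 * r ^ 2 := by
        rw [Finset.sum_add_distrib, ← Finset.mul_sum]
        rfl

end IsIsotropicStep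

/-- The statistic of a list of vectors that controls the likelihood ratio. -/
noncomputable def potential (l : List (ι → ℝ)) : ℝ :=
  pairSum l ^ 2 + alignSum l + quarticSum l

lemma potential_nonneg (l : List (ι → ℝ)) : 0 ≤ potential l :=
  add_nonneg (add_nonneg (sq_nonneg _) (alignSum_nonneg l)) (quarticSum_nonneg l)

lemma potential_nil : potential ([] : List (ι → ℝ)) = 0 := by
  simp [potential, pairSum, alignSum, quarticSum]

lemma IsIsotropicStep.mean_potential_le {κ r : ℝ} {p : Ω → ℝ} {y : Ω → ι → ℝ}
    (h : IsIsotropicStep κ r p y) (hκ : 0 ≤ κ) {l : List (ι → ℝ)} (hl : ∀ v ∈ l, v ⬝ᵥ v ≤ r) :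
    ∑ z, p z * potential (y z :: l) ≤
      potential l + 11 * κ * (l.sum ⬝ᵥ l.sum) + κ * r * l.length + 5 * r ^ 2 := by
  have pairSum_le := h.mean_affine_sq_le (pairSum l) l.sum
  have alignSum_le := h.mean_alignSum_le hκ hl
  have quarticSum_le := h.mean_quarticSum_le l
  simp only [potential, pairSum, mul_add, Finset.sum_add_distrib] at *
  linarith

end IsotropicSteps

/-! ### Random sign matrices -/

section OuterProducts

variable {ι κ : Type*}

/-- The outer product of two vectors, as a vector of matrix entries; the bilinear form
`∑ i j, u i * W i j * v j` of a matrix of entries `W` is then `outer u v ⬝ᵥ W`. -/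
def outer (u : ι → ℝ) (v : κ → ℝ) (a : ι × κ) : ℝ := u a.1 * v a.2

lemma outer_add_left (u u' : ι → ℝ) (v : κ → ℝ) : outer (u + u') v = outer u v + outer u' v :=
  funext fun _ => add_mul _ _ _

lemma outer_add_right (u : ι → ℝ) (v v' : κ → ℝ) : outer u (v + v') = outer u v + outer u v' :=
  funext fun _ => mul_add _ _ _

lemma outer_smul_left (c : ℝ) (u : ι → ℝ) (v : κ → ℝ) : outer (c • u) v = c • outer u v :=
  funext fun _ => mul_assoc _ _ _

lemma outer_smul_right (c : ℝ) (u : ι → ℝ) (v : κ → ℝ) : outer u (c • v) = c • outer u v :=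
  funext fun _ => mul_left_comm _ _ _

variable [Fintype ι] [Fintype κ]

lemma outer_dotProduct_outer (u u' : ι → ℝ) (v v' : κ → ℝ) :
    outer u v ⬝ᵥ outer u' v' = (u ⬝ᵥ u') * (v ⬝ᵥ v') := by
  simp only [dotProduct, outer, Fintype.sum_prod_type, Finset.sum_mul_sum, mul_mul_mul_comm]

lemma outer_norm_le_one {u : ι → ℝ} {v : κ → ℝ} (hu : u ⬝ᵥ u ≤ 1) (hv : v ⬝ᵥ v ≤ 1) :
    outer u v ⬝ᵥ outer u v ≤ 1 := by
  rw [outer_dotProduct_outer]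
  exact mul_le_one₀ hu (dotProduct_self_nonneg_real v) hv

end OuterProducts

section UnitBallNet

variable {m : ℕ}

/-- The integer points of the ball of radius `10 √m` in dimension `m`. -/
noncomputable def latticeBall (m : ℕ) : Finset (Fin m → ℤ) :=
  {k ∈ Fintype.piFinset fun _ => Finset.Icc (-(10 * m : ℤ)) (10 * m) | ∑ i, k i ^ 2 ≤ 100 * m}

lemma mem_latticeBall {k : Fin m → ℤ} : k ∈ latticeBall m ↔ ∑ i, k i ^ 2 ≤ 100 * m := by
  simp only [latticeBall, Finset.mem_filter, Fintype.mem_piFinset, Finset.mem_Icc,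
    and_iff_right_iff_imp]
  intro sum_sq_le i
  have one_le : (1 : ℤ) ≤ m := by exact_mod_cast i.pos
  have sq_le : k i ^ 2 ≤ 100 * m := (Finset.single_le_sum (f := fun i => k i ^ 2)
    (fun _ _ => sq_nonneg _) (Finset.mem_univ i)).trans sum_sq_le
  exact abs_le.1 (abs_le_of_sq_le_sq (by nlinarith) (by positivity))

lemma sum_Icc_pow_natAbs_le {q : ℝ} (hq : 0 ≤ q) (hq1 : q < 1) (B : ℕ) :
    ∑ j ∈ Finset.Icc (-(B : ℤ)) B, q ^ j.natAbs ≤ 2 / (1 - q) := by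
  have geom_sum_le : ∑ n ∈ Finset.range (B + 1), q ^ n ≤ (1 - q)⁻¹ := by
    rw [← tsum_geometric_of_lt_one hq hq1]
    exact (summable_geometric_of_lt_one hq hq1).sum_le_tsum _ fun _ _ => pow_nonneg hq _
  have subset : Finset.Icc (-(B : ℤ)) B ⊆
      (Finset.range (B + 1)).image (fun n : ℕ => (n : ℤ)) ∪
        (Finset.range (B + 1)).image (fun n : ℕ => -(n : ℤ)) := by
    intro j hj
    simp only [Finset.mem_Icc, Finset.mem_union, Finset.mem_image, Finset.mem_range] at hj ⊢
    rcases le_total 0 j with h | h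
    · exact Or.inl ⟨j.natAbs, by omega, by omega⟩
    · exact Or.inr ⟨j.natAbs, by omega, by omega⟩
  have nonneg (j : ℤ) : 0 ≤ q ^ j.natAbs := pow_nonneg hq _
  refine (Finset.sum_le_sum_of_subset_of_nonneg subset fun j _ _ => nonneg j).trans ?_
  refine (le_add_of_nonneg_right (Finset.sum_nonneg fun j _ => nonneg j)).trans
    (Finset.sum_union_inter (f := fun j : ℤ => q ^ j.natAbs)).le |>.trans ?_
  rw [Finset.sum_image fun a _ b _ => by simp, Finset.sum_image fun a _ b _ => by simp]
  simp only [Int.natAbs_neg, Int.natAbs_natCast]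
  rw [div_eq_mul_inv]
  linarith

lemma sum_natAbs_le_of_mem_latticeBall {k : Fin m → ℤ} (hk : k ∈ latticeBall m) :
    ∑ i, (k i).natAbs ≤ 10 * m := by
  have cauchy_schwarz := sq_sum_le_card_mul_sum_sq (s := Finset.univ) (f := fun i => |k i|)
  simp only [sq_abs, Finset.card_univ, Fintype.card_fin] at cauchy_schwarz
  have sum_abs_le : ∑ i, |k i| ≤ 10 * m := by
    refine (abs_le_of_sq_le_sq' (cauchy_schwarz.trans ?_) (by positivity)).2
    nlinarith [mem_latticeBall.1 hk]
  zify
  exact sum_abs_le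

-- Weighting the lattice by `(9 / 10) ^ ∑ |k i|` turns the count into a product of geometric sums.
lemma card_latticeBall_le (m : ℕ) : ((latticeBall m).card : ℝ) ≤ 58 ^ m := by
  have one_le : ∀ k ∈ latticeBall m,
      (1 : ℝ) ≤ (10 / 9) ^ (10 * m) * ∏ i, (9 / 10 : ℝ) ^ (k i).natAbs := by
    intro k hk
    rw [Finset.prod_pow_eq_pow_sum]
    calc (1 : ℝ) = (10 / 9) ^ (10 * m) * (9 / 10) ^ (10 * m) := by rw [← mul_pow]; norm_num
      _ ≤ (10 / 9) ^ (10 * m) * (9 / 10) ^ ∑ i, (k i).natAbs := by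
          gcongr ?_ * ?_
          exact pow_le_pow_of_le_one (by norm_num) (by norm_num)
            (sum_natAbs_le_of_mem_latticeBall hk)
  have geom := sum_Icc_pow_natAbs_le (q := 9 / 10) (by norm_num) (by norm_num) (10 * m)
  push_cast at geom
  calc ((latticeBall m).card : ℝ) = ∑ _k ∈ latticeBall m, (1 : ℝ) := by simp
    _ ≤ ∑ k ∈ latticeBall m, (10 / 9) ^ (10 * m) * ∏ i, (9 / 10 : ℝ) ^ (k i).natAbs :=
        Finset.sum_le_sum one_le
    _ ≤ ∑ k ∈ Fintype.piFinset fun _ : Fin m => Finset.Icc (-(10 * m : ℤ)) (10 * m),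
          (10 / 9) ^ (10 * m) * ∏ i, (9 / 10 : ℝ) ^ (k i).natAbs :=
        Finset.sum_le_sum_of_subset_of_nonneg (Finset.filter_subset _ _) fun _ _ _ => by positivity
    _ = (10 / 9) ^ (10 * m) *
          (∑ j ∈ Finset.Icc (-(10 * m : ℤ)) (10 * m), (9 / 10 : ℝ) ^ j.natAbs) ^ m := by
        rw [← Finset.mul_sum, ← Finset.prod_univ_sum _ fun (_ : Fin m) (j : ℤ) =>
          (9 / 10 : ℝ) ^ j.natAbs, Finset.prod_const, Finset.card_univ, Fintype.card_fin]
    _ ≤ (10 / 9) ^ (10 * m) * (2 / (1 - 9 / 10)) ^ m := by gcongr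
    _ = ((10 / 9) ^ 10 * (2 / (1 - 9 / 10))) ^ m := by rw [pow_mul, mul_pow]
    _ ≤ 58 ^ m := pow_le_pow_left₀ (by norm_num) (by norm_num) m

/-- The point of the net of the unit ball with the integer coordinates `k`. -/
noncomputable def netPoint (k : Fin m → ℤ) (i : Fin m) : ℝ := k i / (10 * √m)

lemma netPoint_norm_le_one {k : Fin m → ℤ} (hk : k ∈ latticeBall m) :
    netPoint k ⬝ᵥ netPoint k ≤ 1 := by
  have sum_sq_le : ∑ i, (k i : ℝ) ^ 2 ≤ 100 * m := by exact_mod_cast mem_latticeBall.1 hk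
  have norm_eq : netPoint k ⬝ᵥ netPoint k = (∑ i, (k i : ℝ) ^ 2) / (100 * m) := by
    simp only [dotProduct, netPoint, ← sq, div_pow, mul_pow, Real.sq_sqrt m.cast_nonneg,
      Finset.sum_div]
    norm_num
  rw [norm_eq]
  exact div_le_one_of_le₀ sum_sq_le (by positivity)

lemma exists_int_abs_le (x : ℝ) : ∃ k : ℤ, |(k : ℝ)| ≤ |x| ∧ |x - k| ≤ 1 := by
  rcases le_total 0 x with h | h
  · have floor_nonneg : (0 : ℝ) ≤ ⌊x⌋ := by exact_mod_cast Int.floor_nonneg.2 h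
    refine ⟨⌊x⌋, ?_, abs_le.2 ⟨?_, ?_⟩⟩
    · simpa only [abs_of_nonneg h, abs_of_nonneg floor_nonneg] using Int.floor_le x
    all_goals linarith [Int.floor_le x, Int.lt_floor_add_one x]
  · have ceil_nonpos : (⌈x⌉ : ℝ) ≤ 0 := by exact_mod_cast Int.ceil_nonpos.2 h
    refine ⟨⌈x⌉, ?_, abs_le.2 ⟨?_, ?_⟩⟩
    · simpa only [abs_of_nonpos h, abs_of_nonpos ceil_nonpos, neg_le_neg_iff] using Int.le_ceil x
    all_goals linarith [Int.le_ceil x, Int.ceil_lt_add_one x]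

lemma exists_netPoint_near (hm : 0 < m) {u : Fin m → ℝ} (hu : u ⬝ᵥ u ≤ 1) :
    ∃ k ∈ latticeBall m, ∃ r : Fin m → ℝ, r ⬝ᵥ r ≤ 1 ∧ u = netPoint k + (1 / 10 : ℝ) • r := by
  have hm' : (0 : ℝ) < m := by exact_mod_cast hm
  have sq_sqrt_m := Real.sq_sqrt hm'.le
  choose k abs_le_abs abs_sub_le using fun i => exists_int_abs_le (10 * √m * u i)
  refine ⟨k, ?_, fun i => (10 * √m * u i - k i) / √m, ?_, ?_⟩
  · rw [mem_latticeBall]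
    have coord_sq_le (i : Fin m) : (k i : ℝ) ^ 2 ≤ 100 * m * (u i * u i) := by
      calc (k i : ℝ) ^ 2 ≤ (10 * √m * u i) ^ 2 := sq_le_sq.2 (abs_le_abs i)
        _ = 100 * m * (u i * u i) := by rw [mul_pow, mul_pow, sq_sqrt_m]; ring
    have sum_sq_le : ∑ i, (k i : ℝ) ^ 2 ≤ 100 * m :=
      calc ∑ i, (k i : ℝ) ^ 2 ≤ ∑ i, 100 * m * (u i * u i) :=
            Finset.sum_le_sum fun i _ => coord_sq_le i
        _ = 100 * m * (u ⬝ᵥ u) := (Finset.mul_sum ..).symm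
        _ ≤ 100 * m := mul_le_of_le_one_right (by positivity) hu
    exact_mod_cast sum_sq_le
  · have coord_sq_le (i : Fin m) :
        (10 * √m * u i - k i) / √m * ((10 * √m * u i - k i) / √m) ≤ (m : ℝ)⁻¹ := by
      rw [← sq, div_pow, sq_sqrt_m, ← one_div]
      gcongr
      exact (sq_le_one_iff_abs_le_one _).2 (abs_sub_le i)
    refine (Finset.sum_le_sum fun i _ => coord_sq_le i).trans_eq ?_
    simp [hm'.ne']
  · ext i
    simp only [netPoint, Pi.add_apply, Pi.smul_apply, smul_eq_mul]
    field_simp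
    ring

end UnitBallNet

section RandomSignMatrix

variable {m : ℕ}

/-- The `m × m` sign matrix with entries `signs w` has operator norm at most `11/2 √m`. -/
def OpBounded (w : Fin m × Fin m → Bool) : Prop :=
  ∀ u v : Fin m → ℝ, u ⬝ᵥ u ≤ 1 → v ⬝ᵥ v ≤ 1 → outer u v ⬝ᵥ signs w ≤ 11 / 2 * √m

lemma outer_dotProduct_signs_le_card {u v : Fin m → ℝ} (hu : u ⬝ᵥ u ≤ 1) (hv : v ⬝ᵥ v ≤ 1)
    (w : Fin m × Fin m → Bool) : outer u v ⬝ᵥ signs w ≤ m := by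
  have signs_norm : signs w ⬝ᵥ signs w = (m : ℝ) ^ 2 := by
    simp [dotProduct, ← sq, signs_sq]
  refine (abs_le_of_sq_le_sq' ((sq_dotProduct_le _ _).trans ?_) m.cast_nonneg).2
  rw [signs_norm]
  exact mul_le_of_le_one_left (sq_nonneg _) (outer_norm_le_one hu hv)

-- The supremum `S` of the bilinear form over the unit balls satisfies `S ≤ 22/5 √m + S / 5`.
lemma opBounded_of_net (hm : 0 < m) {w : Fin m × Fin m → Bool}
    (h : ∀ k ∈ latticeBall m, ∀ k' ∈ latticeBall m,
      outer (netPoint k) (netPoint k') ⬝ᵥ signs w ≤ 22 / 5 * √m) : OpBounded w := by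
  set S : Set ℝ :=
    {x | ∃ u v : Fin m → ℝ, u ⬝ᵥ u ≤ 1 ∧ v ⬝ᵥ v ≤ 1 ∧ x = outer u v ⬝ᵥ signs w}
  have nonempty : S.Nonempty := ⟨_, 0, 0, by simp, by simp, rfl⟩
  have bddAbove : BddAbove S := by
    refine ⟨m, ?_⟩
    rintro _ ⟨u, v, hu, hv, rfl⟩
    exact outer_dotProduct_signs_le_card hu hv w
  have le_sSup (u v : Fin m → ℝ) (hu : u ⬝ᵥ u ≤ 1) (hv : v ⬝ᵥ v ≤ 1) :
      outer u v ⬝ᵥ signs w ≤ sSup S := le_csSup bddAbove ⟨u, v, hu, hv, rfl⟩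
  have sSup_le : sSup S ≤ 22 / 5 * √m + sSup S / 5 := by
    refine csSup_le nonempty ?_
    rintro _ ⟨u, v, hu, hv, rfl⟩
    obtain ⟨k, hk, r, hr, u_eq⟩ := exists_netPoint_near hm hu
    obtain ⟨k', hk', r', hr', v_eq⟩ := exists_netPoint_near hm hv
    have split : outer u v = outer (netPoint k) (netPoint k') +
        (1 / 10 : ℝ) • outer (netPoint k) r' + (1 / 10 : ℝ) • outer r v := by
      rw [← outer_smul_right, ← outer_add_right, ← v_eq, ← outer_smul_left, ← outer_add_left,
        ← u_eq]
    rw [split, add_dotProduct, add_dotProduct, smul_dotProduct, smul_dotProduct, smul_eq_mul,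
      smul_eq_mul]
    linarith [le_sSup r v hr hv, le_sSup (netPoint k) r' (netPoint_norm_le_one hk) hr',
      h k hk k' hk']
  intro u v hu hv
  linarith [le_sSup u v hu hv]

lemma prodMean_indicator_not_opBounded_le_card (hm : 0 < m) :
    prodMean (signLaw 0) ({w : Fin m × Fin m → Bool | OpBounded w}ᶜ.indicator 1) ≤
      ((latticeBall m).card : ℝ) ^ 2 * Real.exp (-((22 / 5 * √m) ^ 2 / 2)) := by
  let exceeds (k k' : Fin m → ℤ) : (Fin m × Fin m → Bool) → ℝ :=
    {w | 22 / 5 * √m < outer (netPoint k) (netPoint k') ⬝ᵥ signs w}.indicator 1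
  have exceeds_nonneg k k' w : 0 ≤ exceeds k k' w :=
    Set.indicator_nonneg (fun _ _ => zero_le_one) w
  have union_bound (w : Fin m × Fin m → Bool) :
      ({w : Fin m × Fin m → Bool | OpBounded w}ᶜ.indicator 1 w : ℝ) ≤
        ∑ k ∈ latticeBall m, ∑ k' ∈ latticeBall m, exceeds k k' w := by
    refine Set.indicator_apply_le' (fun hw => ?_) fun _ =>
      Finset.sum_nonneg fun k _ => Finset.sum_nonneg fun k' _ => exceeds_nonneg k k' w
    obtain ⟨k, hk, k', hk', lt⟩ : ∃ k ∈ latticeBall m, ∃ k' ∈ latticeBall m,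
        22 / 5 * √m < outer (netPoint k) (netPoint k') ⬝ᵥ signs w := by
      by_contra! le
      exact hw (opBounded_of_net hm le)
    calc (1 : ℝ) = exceeds k k' w := by simp [exceeds, lt]
      _ ≤ ∑ k' ∈ latticeBall m, exceeds k k' w :=
          Finset.single_le_sum (fun k' _ => exceeds_nonneg k k' w) hk'
      _ ≤ ∑ k ∈ latticeBall m, ∑ k' ∈ latticeBall m, exceeds k k' w :=
          Finset.single_le_sum (f := fun k => ∑ k' ∈ latticeBall m, exceeds k k' w)
            (fun k _ => Finset.sum_nonneg fun k' _ => exceeds_nonneg k k' w) hk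
  refine (prodMean_mono (fun i => (signLaw_zero_mem_stdSimplex i).1) union_bound).trans ?_
  simp only [prodMean_sum]
  calc ∑ k ∈ latticeBall m, ∑ k' ∈ latticeBall m, prodMean (signLaw 0) (exceeds k k')
      ≤ ∑ k ∈ latticeBall m, ∑ k' ∈ latticeBall m, Real.exp (-((22 / 5 * √m) ^ 2 / 2)) :=
        Finset.sum_le_sum fun k hk => Finset.sum_le_sum fun k' hk' =>
          prodMean_indicator_lt_dotProduct_signs_le
            (outer_norm_le_one (netPoint_norm_le_one hk) (netPoint_norm_le_one hk'))
            (by positivity)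
    _ = ((latticeBall m).card : ℝ) ^ 2 * Real.exp (-((22 / 5 * √m) ^ 2 / 2)) := by
        simp only [Finset.sum_const, nsmul_eq_mul]
        ring

lemma sq_mul_exp_le_exp_neg_one : (58 : ℝ) ^ 2 * Real.exp (-(242 / 25)) ≤ Real.exp (-1) := by
  have sq_le : (58 : ℝ) ^ 2 ≤ Real.exp (217 / 25) :=
    calc (58 : ℝ) ^ 2 ≤ 2.7 ^ 8 * (17 / 25 + 1) := by norm_num
      _ ≤ Real.exp 1 ^ 8 * Real.exp (17 / 25) := by
          gcongr
          · linarith [Real.exp_one_gt_d9]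
          · exact Real.add_one_le_exp _
      _ = Real.exp (217 / 25) := by rw [← Real.exp_nat_mul, ← Real.exp_add]; norm_num
  calc (58 : ℝ) ^ 2 * Real.exp (-(242 / 25)) ≤ Real.exp (217 / 25) * Real.exp (-(242 / 25)) := by
        gcongr
    _ = Real.exp (-1) := by rw [← Real.exp_add]; norm_num

lemma prodMean_indicator_not_opBounded_le (hm : 0 < m) :
    prodMean (signLaw 0) ({w : Fin m × Fin m → Bool | OpBounded w}ᶜ.indicator 1) ≤
      Real.exp (-(m / 2)) ^ 2 :=
  calc prodMean (signLaw 0) ({w : Fin m × Fin m → Bool | OpBounded w}ᶜ.indicator 1)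
      ≤ (58 ^ m) ^ 2 * Real.exp (-((22 / 5 * √m) ^ 2 / 2)) := by
        refine (prodMean_indicator_not_opBounded_le_card hm).trans ?_
        gcongr
        exact card_latticeBall_le m
    _ = (58 ^ 2 * Real.exp (-(242 / 25))) ^ m := by
        rw [mul_pow (58 ^ 2 : ℝ), ← Real.exp_nat_mul, mul_pow, Real.sq_sqrt m.cast_nonneg]
        ring_nf
        rw [pow_mul', show (58 : ℝ) ^ 2 = 3364 by norm_num]
    _ ≤ Real.exp (-1) ^ m := by
        gcongr
        exact sq_mul_exp_le_exp_neg_one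
    _ = Real.exp (-(m / 2)) ^ 2 := by
        rw [← Real.exp_nat_mul, ← Real.exp_nat_mul]
        congr 1
        push_cast
        ring

/-- `Tr ((V Vᵀ)²)`, the fourth moment of the singular values of the matrix with entries `V`. -/
def quarticTrace (V : Fin m × Fin m → ℝ) : ℝ :=
  ∑ i, ∑ k, (∑ j, V (i, j) * V (k, j)) ^ 2

lemma prodMean_row_inner_sq {i k : Fin m} (hik : i ≠ k) :
    prodMean (signLaw 0) (fun w : Fin m × Fin m → Bool =>
      (∑ j, signs w (i, j) * signs w (k, j)) ^ 2) = m := by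
  have pair_mean (j j' : Fin m) : prodMean (signLaw 0) (fun w : Fin m × Fin m → Bool =>
      signs w (i, j) * signs w (k, j) * (signs w (i, j') * signs w (k, j'))) =
      if j = j' then 1 else 0 := by
    split_ifs with hj
    · subst hj
      simp only [← sq, mul_pow, signs_sq, one_pow]
      exact prodMean_const (sum_signLaw (0 : Fin m × Fin m → ℝ)) 1
    · apply prodMean_signLaw_eq_zero_of_flip (i, j)
      intro w
      simp [signs_flip, hik.symm, Ne.symm hj]
  simp only [sq, Finset.sum_mul_sum, prodMean_sum, pair_mean]
  simp

lemma quarticTrace_signs_eq_add (w : Fin m × Fin m → Bool) :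
    quarticTrace (signs w) = (m : ℝ) ^ 3 +
      ∑ i, ∑ k, if i = k then 0 else (∑ j, signs w (i, j) * signs w (k, j)) ^ 2 := by
  have split (i k : Fin m) : (∑ j, signs w (i, j) * signs w (k, j)) ^ 2 =
      (if i = k then (m : ℝ) ^ 2 else 0) +
        if i = k then 0 else (∑ j, signs w (i, j) * signs w (k, j)) ^ 2 := by
    split_ifs with h
    · simp [h, ← sq, signs_sq]
    · rw [zero_add]
  rw [quarticTrace, Finset.sum_congr rfl fun i _ => Finset.sum_congr rfl fun k _ => split i k]
  simp only [Finset.sum_add_distrib, Finset.sum_ite_eq, Finset.mem_univ, if_true,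
    Finset.sum_const, Finset.card_univ, Fintype.card_fin, nsmul_eq_mul]
  ring

lemma prodMean_indicator_lt_quarticTrace_le (hm : 0 < m) :
    prodMean (signLaw 0) ({w : Fin m × Fin m → Bool | 39 / 10 * (m : ℝ) ^ 3 <
      quarticTrace (signs w)}.indicator 1) ≤ 10 / 29 := by
  let offDiag (w : Fin m × Fin m → Bool) : ℝ :=
    ∑ i, ∑ k, if i = k then 0 else (∑ j, signs w (i, j) * signs w (k, j)) ^ 2
  have offDiag_nonneg (w : Fin m × Fin m → Bool) : 0 ≤ offDiag w :=
    Finset.sum_nonneg fun i _ => Finset.sum_nonneg fun k _ => by split_ifs <;> positivity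
  have mean_offDiag_le : prodMean (signLaw 0) offDiag ≤ (m : ℝ) ^ 3 := by
    calc prodMean (signLaw 0) offDiag ≤ ∑ _i : Fin m, ∑ _k : Fin m, (m : ℝ) := by
          simp only [offDiag, prodMean_sum]
          refine Finset.sum_le_sum fun i _ => Finset.sum_le_sum fun k _ => ?_
          split_ifs with h
          · rw [prodMean_const (sum_signLaw 0)]
            positivity
          · rw [prodMean_row_inner_sq h]
      _ = (m : ℝ) ^ 3 := by
          simp only [Finset.sum_const, Finset.card_univ, Fintype.card_fin, nsmul_eq_mul]
          ring
  have event_eq : {w : Fin m × Fin m → Bool | 39 / 10 * (m : ℝ) ^ 3 < quarticTrace (signs w)} =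
      {w | 29 / 10 * (m : ℝ) ^ 3 < offDiag w} := by
    ext w
    rw [Set.mem_ofPred_eq, Set.mem_ofPred_eq, quarticTrace_signs_eq_add w]
    constructor <;> intro h <;> linarith
  rw [event_eq]
  refine (prodMean_indicator_lt_le (fun i => (signLaw_zero_mem_stdSimplex i).1) offDiag_nonneg
    (by positivity)).trans ?_
  rw [div_le_iff₀ (by positivity)]
  linarith

end RandomSignMatrix

/-! ### Matrices and the trace norm -/

section PositiveSemidefinite

variable {n : Type*} {M : Matrix n n ℂ}

lemma re_diag_nonneg (hM : M.PosSemidef) (a : n) : 0 ≤ (M a a).re :=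
  (Complex.nonneg_iff.1 (hM.diag_nonneg (i := a))).1

lemma re_apply_sq_le (hM : M.PosSemidef) (a b : n) :
    (M a b).re ^ 2 ≤ (M a a).re * (M b b).re := by
  have minor_nonneg := (Complex.nonneg_iff.1 (hM.submatrix ![a, b]).det_nonneg).1
  have symm : M b a = star (M a b) := (hM.1.apply b a).symm
  have im_eq_zero : (M a a).im = 0 := (Complex.nonneg_iff.1 (hM.diag_nonneg (i := a))).2.symm
  simp only [det_fin_two, submatrix_apply, cons_val_zero, cons_val_one, symm, RCLike.star_def,
    Complex.mul_conj, Complex.sub_re, Complex.mul_re, im_eq_zero, zero_mul, sub_zero,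
    Complex.ofReal_re, Complex.normSq_apply] at minor_nonneg
  nlinarith [mul_self_nonneg (M a b).im]

variable [Fintype n]

lemma re_trace_nonneg (hM : M.PosSemidef) : 0 ≤ M.trace.re :=
  (Complex.nonneg_iff.1 hM.trace_nonneg).1

lemma ofReal_re_trace (hM : M.PosSemidef) : (M.trace.re : ℂ) = M.trace :=
  Complex.ext rfl (Complex.nonneg_iff.1 hM.trace_nonneg).2

lemma re_trace_conj_nonneg (hM : M.PosSemidef) (X : Matrix n n ℂ) :
    0 ≤ (Xᴴ * M * X).trace.re :=
  re_trace_nonneg (hM.conjTranspose_mul_mul_same X)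

lemma eq_zero_of_re_trace_eq_zero (hM : M.PosSemidef) (h : M.trace.re = 0) : M = 0 :=
  hM.trace_eq_zero_iff.1 (by rw [← ofReal_re_trace hM, h, Complex.ofReal_zero])

open scoped MatrixOrder in
lemma re_trace_mul_nonneg {A : Matrix n n ℂ} (hA : A.PosSemidef) (hM : M.PosSemidef) :
    0 ≤ (A * M).trace.re := by
  classical
  obtain ⟨C, rfl⟩ := CStarAlgebra.nonneg_iff_eq_star_mul_self.mp hA.nonneg
  have conj_nonneg := re_trace_conj_nonneg hM Cᴴ
  rwa [conjTranspose_conjTranspose, trace_mul_comm, ← mul_assoc] at conj_nonneg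

-- Cauchy–Schwarz for the semi-inner product `Re Tr (Xᴴ M Y)`.
lemma re_trace_mul_sq_le (hM : M.PosSemidef) (V : Matrix n n ℂ) :
    (M * V).trace.re ^ 2 ≤ M.trace.re * (Vᴴ * M * V).trace.re := by
  classical
  have quadratic_nonneg (t : ℝ) : 0 ≤ M.trace.re * (t * t) + (-2 * (M * V).trace.re) * t +
      (Vᴴ * M * V).trace.re := by
    have expand : ((t : ℂ) • (1 : Matrix n n ℂ) - V)ᴴ * M * ((t : ℂ) • 1 - V) =
        (t : ℂ) • (t : ℂ) • M - (t : ℂ) • (M * V) - (t : ℂ) • (M * V)ᴴ + Vᴴ * M * V := by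
      rw [conjTranspose_mul, hM.1.eq]
      simp only [conjTranspose_sub, conjTranspose_smul, conjTranspose_one, sub_mul, mul_sub,
        smul_mul_assoc, mul_smul_comm, one_mul, mul_one, RCLike.star_def, Complex.conj_ofReal,
        smul_sub]
      abel
    have conj_nonneg := re_trace_conj_nonneg hM ((t : ℂ) • 1 - V)
    rw [expand] at conj_nonneg
    simp only [trace_add, trace_sub, trace_smul, trace_conjTranspose, Complex.add_re,
      Complex.sub_re, smul_eq_mul, Complex.re_ofReal_mul, RCLike.star_def,
      Complex.conj_re] at conj_nonneg
    linarith
  have discrim_nonpos := discrim_le_zero quadratic_nonneg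
  rw [discrim] at discrim_nonpos
  nlinarith

end PositiveSemidefinite

section TraceNorm

variable {d : ℕ}

lemma re_trace_eq_sum_eigenvalues {H : Matrix (Fin d) (Fin d) ℂ} (hH : H.IsHermitian) :
    H.trace.re = ∑ i, hH.eigenvalues i := by
  rw [hH.trace_eq_sum_eigenvalues, Complex.re_sum]
  rfl

lemma re_trace_mul_self_eq_sum_eigenvalues {H : Matrix (Fin d) (Fin d) ℂ} (hH : H.IsHermitian) :
    (H * H).trace.re = ∑ i, hH.eigenvalues i ^ 2 := by
  set D : Matrix (Fin d) (Fin d) ℂ := diagonal (RCLike.ofReal ∘ hH.eigenvalues)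
  have mul_self_eq : H * H = Unitary.conjStarAlgAut ℂ _ hH.eigenvectorUnitary (D * D) := by
    rw [map_mul, ← hH.spectral_theorem]
  rw [mul_self_eq, Unitary.conjStarAlgAut_apply, trace_mul_comm, ← mul_assoc]
  simp [D, sq]

lemma traceNorm_sq_le (A : Matrix (Fin d) (Fin d) ℂ) :
    traceNorm A ^ 2 ≤ d * (Aᴴ * A).trace.re := by
  have cauchy_schwarz := sq_sum_le_card_mul_sum_sq (s := Finset.univ)
    (f := fun i => √((isHermitian_conjTranspose_mul_self A).eigenvalues i))
  simpa only [traceNorm, re_trace_eq_sum_eigenvalues (isHermitian_conjTranspose_mul_self A),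
    Real.sq_sqrt ((posSemidef_conjTranspose_mul_self A).eigenvalues_nonneg _), Finset.card_univ,
    Fintype.card_fin] using cauchy_schwarz

-- The polynomial `3 u ^ 2 / (2 v) - u ^ 4 / (2 v ^ 3)` touches `u` from below at `u = v`.
lemma le_traceNorm (A : Matrix (Fin d) (Fin d) ℂ) {v : ℝ} (hv : 0 < v) :
    3 / (2 * v) * (Aᴴ * A).trace.re - 1 / (2 * v ^ 3) * (Aᴴ * A * (Aᴴ * A)).trace.re ≤
      traceNorm A := by
  have hH := isHermitian_conjTranspose_mul_self A
  have tangent_le {u : ℝ} (hu : 0 ≤ u) :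
      3 / (2 * v) * u ^ 2 - 1 / (2 * v ^ 3) * (u ^ 2) ^ 2 ≤ u := by
    have gap_eq : u - (3 / (2 * v) * u ^ 2 - 1 / (2 * v ^ 3) * (u ^ 2) ^ 2) =
        u * ((u - v) ^ 2 * (u + 2 * v)) / (2 * v ^ 3) := by
      field_simp
      ring
    have gap_nonneg : 0 ≤ u * ((u - v) ^ 2 * (u + 2 * v)) / (2 * v ^ 3) := by positivity
    linarith
  rw [re_trace_mul_self_eq_sum_eigenvalues hH, re_trace_eq_sum_eigenvalues hH, traceNorm,
    Finset.mul_sum, Finset.mul_sum, ← Finset.sum_sub_distrib]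
  refine Finset.sum_le_sum fun i _ => ?_
  have eigenvalue_nonneg := (posSemidef_conjTranspose_mul_self A).eigenvalues_nonneg i
  simpa only [Real.sq_sqrt eigenvalue_nonneg] using
    tangent_le (Real.sqrt_nonneg (hH.eigenvalues i))

end TraceNorm

section ZeroExtend

variable {κ n R : Type*} [Fintype κ] [DecidableEq n] [CommRing R] [StarRing R]

/-- The square matrix whose rows and columns in the range of `e` are those of `B`, and whose other
entries vanish. -/
def zeroExtend (e : κ ↪ n) (B : Matrix κ κ R) : Matrix n n R :=
  (1 : Matrix n n R).submatrix id e * B * ((1 : Matrix n n R).submatrix id e)ᴴ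

lemma conjTranspose_zeroExtend (e : κ ↪ n) (B : Matrix κ κ R) :
    (zeroExtend e B)ᴴ = zeroExtend e Bᴴ := by
  simp only [zeroExtend, conjTranspose_mul, conjTranspose_conjTranspose, Matrix.mul_assoc]

variable [Fintype n]

lemma trace_mul_zeroExtend (e : κ ↪ n) (M : Matrix n n R) (B : Matrix κ κ R) :
    (M * zeroExtend e B).trace = (M.submatrix e e * B).trace := by
  have compress : ((1 : Matrix n n R).submatrix id e)ᴴ * (M * (1 : Matrix n n R).submatrix id e) =
      M.submatrix e e := by
    ext i j
    simp [mul_apply, one_apply]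
  rw [zeroExtend, ← Matrix.mul_assoc, ← Matrix.mul_assoc, trace_mul_comm, ← Matrix.mul_assoc,
    compress]

lemma zeroExtend_mul (e : κ ↪ n) (B C : Matrix κ κ R) :
    zeroExtend e B * zeroExtend e C = zeroExtend e (B * C) := by
  classical
  have isometry : ((1 : Matrix n n R).submatrix id e)ᴴ * (1 : Matrix n n R).submatrix id e = 1 := by
    ext i j
    simp [mul_apply, one_apply]
  have regroup (J : Matrix n κ R) : J * B * Jᴴ * (J * C * Jᴴ) = J * (B * (Jᴴ * J) * C) * Jᴴ := by
    simp only [Matrix.mul_assoc]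
  rw [zeroExtend, zeroExtend, zeroExtend, regroup, isometry, Matrix.mul_one]

lemma trace_zeroExtend (e : κ ↪ n) (B : Matrix κ κ R) :
    (zeroExtend e B).trace = B.trace := by
  classical
  rw [← one_mul (zeroExtend e B), trace_mul_zeroExtend, submatrix_one_embedding, one_mul]

end ZeroExtend

/-! ### Hard states -/

section BlockPerturbation

lemma trace_fromBlocks {ι κ R : Type*} [Fintype ι] [Fintype κ] [AddCommMonoid R]
    (A : Matrix ι ι R) (B : Matrix ι κ R) (C : Matrix κ ι R) (D : Matrix κ κ R) :
    (fromBlocks A B C D).trace = A.trace + D.trace := by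
  simp only [trace, Fintype.sum_sum_type, diag_apply, fromBlocks_apply₁₁, fromBlocks_apply₂₂]

variable {ι κ n : Type*} [Fintype ι] [Fintype κ] [DecidableEq n]

/-- The Hermitian matrix that has the real array `v` as the block with rows `e (inl i)` and columns
`e (inr j)`, its transpose as the opposite block, and no other nonzero entries. -/
noncomputable def blockPerturbation (e : ι ⊕ κ ↪ n) (v : ι × κ → ℝ) : Matrix n n ℂ :=
  zeroExtend e (fromBlocks 0 (.of fun i j => (v (i, j) : ℂ)) (.of fun j i => (v (i, j) : ℂ)) 0)

lemma blockPerturbation_isHermitian (e : ι ⊕ κ ↪ n) (v : ι × κ → ℝ) :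
    (blockPerturbation e v).IsHermitian := by
  rw [IsHermitian, blockPerturbation, conjTranspose_zeroExtend, fromBlocks_conjTranspose]
  congr 2 <;> ext <;> simp

variable [Fintype n]

lemma re_trace_mul_blockPerturbation (e : ι ⊕ κ ↪ n) (v : ι × κ → ℝ) {M : Matrix n n ℂ}
    (hM : M.IsHermitian) :
    (M * blockPerturbation e v).trace.re =
      2 * ∑ i, ∑ j, v (i, j) * (M (e (.inl i)) (e (.inr j))).re := by
  have re_symm (a b : n) : (M b a).re = (M a b).re := by
    rw [← hM.apply a b, RCLike.star_def, Complex.conj_re]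
  rw [blockPerturbation, trace_mul_zeroExtend, two_mul]
  nth_rewrite 2 [Finset.sum_comm]
  simp only [trace, diag_apply, mul_apply, Fintype.sum_sum_type, submatrix_apply,
    fromBlocks_apply₁₁, fromBlocks_apply₁₂, fromBlocks_apply₂₁, fromBlocks_apply₂₂, of_apply,
    Matrix.zero_apply, mul_zero, Finset.sum_const_zero, zero_add, add_zero, Complex.add_re,
    Complex.re_sum, Complex.re_mul_ofReal, re_symm (e (.inl _)), mul_comm (v _)]

lemma trace_blockPerturbation (e : ι ⊕ κ ↪ n) (v : ι × κ → ℝ) :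
    (blockPerturbation e v).trace = 0 := by
  simp [blockPerturbation, trace_zeroExtend, trace_fromBlocks]

lemma blockPerturbation_mul_self (e : ι ⊕ κ ↪ n) (v : ι × κ → ℝ) :
    blockPerturbation e v * blockPerturbation e v =
      zeroExtend e (fromBlocks
        (.of fun i k => ((∑ j, v (i, j) * v (k, j) : ℝ) : ℂ)) 0 0
        (.of fun j l => ((∑ i, v (i, j) * v (i, l) : ℝ) : ℂ))) := by
  rw [blockPerturbation, zeroExtend_mul, fromBlocks_multiply]
  congr 2 <;> ext <;> simp [mul_apply]

lemma re_trace_blockPerturbation_sq (e : ι ⊕ κ ↪ n) (v : ι × κ → ℝ) :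
    (blockPerturbation e v * blockPerturbation e v).trace.re = 2 * (v ⬝ᵥ v) := by
  rw [blockPerturbation_mul_self, trace_zeroExtend, trace_fromBlocks, Complex.add_re, two_mul,
    dotProduct, Fintype.sum_prod_type]
  simp only [trace, diag_apply, of_apply, ← Complex.ofReal_sum, Complex.ofReal_re]
  rw [Finset.sum_comm (f := fun (j : κ) (i : ι) => v (i, j) * v (i, j))]

end BlockPerturbation

section HardStates

variable {d m : ℕ} (e : Fin m ⊕ Fin m ↪ Fin d)

lemma re_trace_blockPerturbation_pow_four (v : Fin m × Fin m → ℝ) :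
    (blockPerturbation e v * blockPerturbation e v *
      (blockPerturbation e v * blockPerturbation e v)).trace.re = 2 * quarticTrace v := by
  have gram_transpose : ∑ j, ∑ l, (∑ i, v (i, j) * v (i, l)) ^ 2 = quarticTrace v := by
    simp only [quarticTrace, sq, Finset.sum_mul_sum]
    rw [Finset.sum_comm_cycle]
    refine Finset.sum_congr rfl fun i _ => ?_
    rw [Finset.sum_comm_cycle]
    congr! 3
    ring
  rw [blockPerturbation_mul_self, zeroExtend_mul, trace_zeroExtend, fromBlocks_multiply,
    trace_fromBlocks, Complex.add_re, two_mul]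
  nth_rewrite 2 [← gram_transpose]
  simp only [trace, diag_apply, mul_apply, mul_zero, add_zero, zero_add, of_apply,
    ← Complex.ofReal_mul, ← Complex.ofReal_sum, Complex.ofReal_re, quarticTrace, sq]
  congr! 5 <;> exact mul_comm _ _

/-- The normalized off-diagonal block of a positive semidefinite matrix. -/
noncomputable def blockVec (M : Matrix (Fin d) (Fin d) ℂ) (a : Fin m × Fin m) : ℝ :=
  (M (e (.inl a.1)) (e (.inr a.2))).re / M.trace.re

lemma re_trace_mul_blockVec_dotProduct {M : Matrix (Fin d) (Fin d) ℂ} (hM : M.PosSemidef)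
    (v : Fin m × Fin m → ℝ) :
    (M * blockPerturbation e v).trace.re = 2 * (M.trace.re * (blockVec e M ⬝ᵥ v)) := by
  rw [re_trace_mul_blockPerturbation e v hM.1, dotProduct, Fintype.sum_prod_type]
  rcases eq_or_ne M.trace.re 0 with trace_eq | trace_ne
  · simp [eq_zero_of_re_trace_eq_zero hM trace_eq]
  · simp only [blockVec, Finset.mul_sum]
    refine Finset.sum_congr rfl fun i _ => Finset.sum_congr rfl fun j _ => ?_
    field_simp

lemma sum_comp_embedding_le {α β : Type*} [Fintype α] [Fintype β] (g : α ↪ β) {f : β → ℝ}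
    (hf : ∀ b, 0 ≤ f b) : ∑ a, f (g a) ≤ ∑ b, f b := by
  rw [← Finset.sum_map Finset.univ g f]
  exact Finset.sum_le_univ_sum_of_nonneg hf

lemma blockVec_norm_le_one {M : Matrix (Fin d) (Fin d) ℂ} (hM : M.PosSemidef) :
    blockVec e M ⬝ᵥ blockVec e M ≤ 1 := by
  have norm_eq : blockVec e M ⬝ᵥ blockVec e M =
      (∑ i, ∑ j, (M (e (.inl i)) (e (.inr j))).re ^ 2) / M.trace.re ^ 2 := by
    simp only [dotProduct, Fintype.sum_prod_type, blockVec, ← sq, div_pow, Finset.sum_div]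
  have diag_sum_le (g : Fin m ↪ Fin d) : ∑ i, (M (g i) (g i)).re ≤ M.trace.re := by
    rw [trace, Complex.re_sum]
    exact sum_comp_embedding_le g (re_diag_nonneg hM)
  rw [norm_eq]
  refine div_le_one_of_le₀ ?_ (sq_nonneg _)
  calc ∑ i, ∑ j, (M (e (.inl i)) (e (.inr j))).re ^ 2
      ≤ ∑ i, ∑ j, (M (e (.inl i)) (e (.inl i))).re * (M (e (.inr j)) (e (.inr j))).re :=
        Finset.sum_le_sum fun i _ => Finset.sum_le_sum fun j _ => re_apply_sq_le hM _ _
    _ = (∑ i, (M (e (.inl i)) (e (.inl i))).re) * ∑ j, (M (e (.inr j)) (e (.inr j))).re := by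
        rw [Finset.sum_mul_sum]
    _ ≤ M.trace.re * M.trace.re :=
        mul_le_mul (diag_sum_le (.trans .inl e)) (diag_sum_le (.trans .inr e))
          (Finset.sum_nonneg fun j _ => re_diag_nonneg hM _) (re_trace_nonneg hM)
    _ = M.trace.re ^ 2 := (sq _).symm

lemma re_trace_mul_blockVec_dotProduct_sq_le {M : Matrix (Fin d) (Fin d) ℂ} (hM : M.PosSemidef)
    (v : Fin m × Fin m → ℝ) :
    M.trace.re * (blockVec e M ⬝ᵥ v) ^ 2 ≤
      (blockPerturbation e v * M * blockPerturbation e v).trace.re / 4 := by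
  have cauchy_schwarz := re_trace_mul_sq_le hM (blockPerturbation e v)
  rw [re_trace_mul_blockVec_dotProduct e hM, (blockPerturbation_isHermitian e v).eq]
    at cauchy_schwarz
  rcases (re_trace_nonneg hM).eq_or_lt with trace_eq | trace_pos
  · simp [eq_zero_of_re_trace_eq_zero hM trace_eq.symm]
  · refine le_of_mul_le_mul_left ?_ trace_pos
    linarith

lemma re_trace_maximallyMixed_mul (M : Matrix (Fin d) (Fin d) ℂ) :
    (maximallyMixed d * M).trace.re = M.trace.re / d := by
  rw [maximallyMixed, smul_mul_assoc, one_mul, trace_smul, smul_eq_mul, ← Complex.ofReal_natCast,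
    ← Complex.ofReal_inv, Complex.re_ofReal_mul, div_eq_inv_mul]

lemma sum_re_trace_effect {k : ℕ} (M : POVM d k) : ∑ z, (M.effect z).trace.re = d := by
  rw [← Complex.re_sum, ← trace_sum, M.sum_eq_one]
  simp

lemma isIsotropicStep_blockVec {k : ℕ} (hd : 0 < d) (M : POVM d k) (β : ℝ) :
    IsIsotropicStep (β ^ 2 / (2 * d)) (β ^ 2) (M.prob (maximallyMixed d))
      (fun z => β • blockVec e (M.effect z)) where
  mem_stdSimplex := by
    refine ⟨fun z => ?_, ?_⟩
    · rw [POVM.prob, re_trace_maximallyMixed_mul]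
      exact div_nonneg (re_trace_nonneg (M.posSemidef z)) (Nat.cast_nonneg _)
    · simp only [POVM.prob, re_trace_maximallyMixed_mul]
      rw [← Finset.sum_div, sum_re_trace_effect, div_self (by positivity)]
  norm_le z := by
    simp only [smul_dotProduct, dotProduct_smul, smul_eq_mul, ← mul_assoc, ← sq]
    exact mul_le_of_le_one_right (sq_nonneg β) (blockVec_norm_le_one e (M.posSemidef z))
  mean_eq_zero v := by
    have sum_eq_zero : ∑ z, (M.effect z).trace.re * (blockVec e (M.effect z) ⬝ᵥ v) = 0 := by
      have trace_sum_eq :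
          ∑ z, 2 * ((M.effect z).trace.re * (blockVec e (M.effect z) ⬝ᵥ v)) = 0 := by
        simp only [← re_trace_mul_blockVec_dotProduct e (M.posSemidef _)]
        rw [← Complex.re_sum, ← trace_sum, ← Finset.sum_mul, M.sum_eq_one, one_mul,
          trace_blockPerturbation, Complex.zero_re]
      rwa [← Finset.mul_sum, mul_eq_zero_iff_left two_ne_zero] at trace_sum_eq
    calc ∑ z, M.prob (maximallyMixed d) z * ((β • blockVec e (M.effect z)) ⬝ᵥ v)
        = β / d * ∑ z, (M.effect z).trace.re * (blockVec e (M.effect z) ⬝ᵥ v) := by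
          rw [Finset.mul_sum]
          refine Finset.sum_congr rfl fun z _ => ?_
          rw [POVM.prob, re_trace_maximallyMixed_mul, smul_dotProduct, smul_eq_mul]
          ring
      _ = 0 := by rw [sum_eq_zero, mul_zero]
  cov_le v := by
    calc ∑ z, M.prob (maximallyMixed d) z * ((β • blockVec e (M.effect z)) ⬝ᵥ v) ^ 2
        = β ^ 2 / d * ∑ z, (M.effect z).trace.re * (blockVec e (M.effect z) ⬝ᵥ v) ^ 2 := by
          rw [Finset.mul_sum]
          refine Finset.sum_congr rfl fun z _ => ?_
          rw [POVM.prob, re_trace_maximallyMixed_mul, smul_dotProduct, smul_eq_mul]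
          ring
      _ ≤ β ^ 2 / d *
          ∑ z, (blockPerturbation e v * M.effect z * blockPerturbation e v).trace.re / 4 := by
          gcongr with z
          exact re_trace_mul_blockVec_dotProduct_sq_le e (M.posSemidef z) v
      _ = β ^ 2 / (2 * d) * (v ⬝ᵥ v) := by
          rw [← Finset.sum_div, ← Complex.re_sum, ← trace_sum, ← Finset.sum_mul, ← Finset.mul_sum,
            M.sum_eq_one, mul_one, re_trace_blockPerturbation_sq]
          ring

lemma exists_eq_sqrt_smul {ι : Type*} [Fintype ι] (u : ι → ℝ) :
    ∃ u' : ι → ℝ, u' ⬝ᵥ u' ≤ 1 ∧ u = √(u ⬝ᵥ u) • u' := by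
  rcases eq_or_ne u 0 with rfl | u_ne
  · exact ⟨0, by simp, by simp⟩
  have norm_ne : √(u ⬝ᵥ u) ≠ 0 := by
    rwa [Real.sqrt_ne_zero (dotProduct_self_nonneg_real u), ne_eq, dotProduct_self_eq_zero]
  refine ⟨(√(u ⬝ᵥ u))⁻¹ • u, le_of_eq ?_, by rw [smul_inv_smul₀ norm_ne]⟩
  rw [smul_dotProduct, dotProduct_smul, smul_eq_mul, smul_eq_mul, ← mul_assoc, ← mul_inv,
    Real.mul_self_sqrt (dotProduct_self_nonneg_real u), inv_mul_cancel₀]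
  rwa [ne_eq, dotProduct_self_eq_zero]

variable {w : Fin m × Fin m → Bool}

lemma OpBounded.outer_dotProduct_le (hw : OpBounded w) (u v : Fin m → ℝ) :
    outer u v ⬝ᵥ signs w ≤ 11 / 4 * √m * (u ⬝ᵥ u + v ⬝ᵥ v) := by
  obtain ⟨u', hu', u_eq⟩ := exists_eq_sqrt_smul u
  obtain ⟨v', hv', v_eq⟩ := exists_eq_sqrt_smul v
  have u_sq := Real.sq_sqrt (dotProduct_self_nonneg_real u)
  have v_sq := Real.sq_sqrt (dotProduct_self_nonneg_real v)
  calc outer u v ⬝ᵥ signs w = √(u ⬝ᵥ u) * √(v ⬝ᵥ v) * (outer u' v' ⬝ᵥ signs w) := by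
        conv_lhs => rw [u_eq, v_eq]
        rw [outer_smul_left, outer_smul_right, smul_dotProduct, smul_dotProduct, smul_eq_mul,
          smul_eq_mul, mul_assoc]
    _ ≤ √(u ⬝ᵥ u) * √(v ⬝ᵥ v) * (11 / 2 * √m) := by gcongr; exact hw u' v' hu' hv'
    _ = 11 / 4 * √m * (2 * √(u ⬝ᵥ u) * √(v ⬝ᵥ v)) := by ring
    _ ≤ 11 / 4 * √m * (u ⬝ᵥ u + v ⬝ᵥ v) := by
        gcongr
        linarith [two_mul_le_add_sq √(u ⬝ᵥ u) √(v ⬝ᵥ v)]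

lemma OpBounded.abs_outer_dotProduct_le (hw : OpBounded w) (u v : Fin m → ℝ) :
    |outer u v ⬝ᵥ signs w| ≤ 11 / 4 * √m * (u ⬝ᵥ u + v ⬝ᵥ v) := by
  have neg_le := hw.outer_dotProduct_le (-u) v
  rw [neg_dotProduct_neg, ← neg_one_smul ℝ u, outer_smul_left, neg_one_smul, neg_dotProduct]
    at neg_le
  exact abs_le'.2 ⟨hw.outer_dotProduct_le u v, neg_le⟩

lemma OpBounded.abs_re_trace_vecMulVec_mul_blockPerturbation_le (hw : OpBounded w)
    (x : Fin d → ℂ) :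
    |(vecMulVec x (star x) * blockPerturbation e (signs w)).trace.re| ≤
      11 / 2 * √m * (star x ⬝ᵥ x).re := by
  set a : Fin d → ℝ := fun i => (x i).re
  set b : Fin d → ℝ := fun i => (x i).im
  have trace_eq : (vecMulVec x (star x) * blockPerturbation e (signs w)).trace.re =
      2 * (outer (fun i => a (e (.inl i))) (fun j => a (e (.inr j))) ⬝ᵥ signs w +
        outer (fun i => b (e (.inl i))) (fun j => b (e (.inr j))) ⬝ᵥ signs w) := by
    rw [re_trace_mul_blockPerturbation e _ (posSemidef_vecMulVec_self_star x).1]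
    simp only [dotProduct, Fintype.sum_prod_type, ← Finset.sum_add_distrib]
    refine congrArg (2 * ·) (Finset.sum_congr rfl fun i _ => Finset.sum_congr rfl fun j _ => ?_)
    simp [vecMulVec_apply, outer, a, b]
    ring
  have norm_eq : (star x ⬝ᵥ x).re = ∑ i, (a i * a i + b i * b i) := by
    simp [dotProduct, a, b]
  have restrict_le : ∑ s, (a (e s) * a (e s) + b (e s) * b (e s)) ≤ (star x ⬝ᵥ x).re := by
    rw [norm_eq]
    exact sum_comp_embedding_le e (f := fun i => a i * a i + b i * b i)
      fun i => add_nonneg (mul_self_nonneg _) (mul_self_nonneg _)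
  rw [Fintype.sum_sum_type] at restrict_le
  simp only [Finset.sum_add_distrib] at restrict_le
  have real_part_le := hw.abs_outer_dotProduct_le (fun i => a (e (.inl i))) fun j => a (e (.inr j))
  have imag_part_le := hw.abs_outer_dotProduct_le (fun i => b (e (.inl i))) fun j => b (e (.inr j))
  rw [trace_eq, abs_mul, abs_two]
  calc 2 * |_| ≤ 2 * (_ + _) := by
        gcongr
        exact (abs_add_le _ _).trans (add_le_add real_part_le imag_part_le)
    _ ≤ 11 / 2 * √m * (star x ⬝ᵥ x).re := by
        rw [← mul_add, ← mul_assoc, show 2 * (11 / 4 * √(m : ℝ)) = 11 / 2 * √m by ring]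
        gcongr
        simp only [dotProduct] at restrict_le ⊢
        linarith

lemma OpBounded.posSemidef_one_add_smul_blockPerturbation (hw : OpBounded w) {s : ℝ}
    (hs : |s| * (11 / 2 * √m) ≤ 1) :
    (1 + (s : ℂ) • blockPerturbation e (signs w)).PosSemidef := by
  have isHermitian : (1 + (s : ℂ) • blockPerturbation e (signs w)).IsHermitian := by
    rw [IsHermitian, conjTranspose_add, conjTranspose_smul,
      (blockPerturbation_isHermitian e (signs w)).eq]
    simp
  refine posSemidef_iff_dotProduct_mulVec.2 ⟨isHermitian, fun x => Complex.nonneg_iff.2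
    ⟨?_, (isHermitian.im_star_dotProduct_mulVec_self x).symm⟩⟩
  have norm_nonneg : 0 ≤ (star x ⬝ᵥ x).re :=
    (Complex.nonneg_iff.1 (dotProduct_star_self_nonneg x)).1
  have quadratic_form_eq : (star x ⬝ᵥ (1 + (s : ℂ) • blockPerturbation e (signs w)) *ᵥ x).re =
      (star x ⬝ᵥ x).re +
        s * (vecMulVec x (star x) * blockPerturbation e (signs w)).trace.re := by
    rw [add_mulVec, one_mulVec, smul_mulVec, dotProduct_add, dotProduct_smul, smul_eq_mul,
      Complex.add_re, Complex.re_ofReal_mul, trace_mul_comm, mul_vecMulVec, trace_vecMulVec,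
      dotProduct_comm (star x) (_ *ᵥ x)]
  have perturbation_le : |s * (vecMulVec x (star x) * blockPerturbation e (signs w)).trace.re| ≤
      (star x ⬝ᵥ x).re :=
    calc _ ≤ |s| * (11 / 2 * √m * (star x ⬝ᵥ x).re) := by
          rw [abs_mul]
          gcongr
          exact hw.abs_re_trace_vecMulVec_mul_blockPerturbation_le e x
      _ = |s| * (11 / 2 * √m) * (star x ⬝ᵥ x).re := by ring
      _ ≤ (star x ⬝ᵥ x).re := mul_le_of_le_one_left norm_nonneg hs
  rw [quadratic_form_eq]
  linarith [(abs_le.1 perturbation_le).1]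

lemma OpBounded.abs_dotProduct_blockVec_le (hw : OpBounded w) {M : Matrix (Fin d) (Fin d) ℂ}
    (hM : M.PosSemidef) : |2 / √m * (blockVec e M ⬝ᵥ signs w)| ≤ 11 / 2 := by
  rcases (re_trace_nonneg hM).eq_or_lt with trace_eq | trace_pos
  · have blockVec_eq : blockVec e M = 0 := by
      ext a
      simp [blockVec, ← trace_eq]
    simp only [blockVec_eq, zero_dotProduct, mul_zero, abs_zero]
    norm_num
  rcases (Real.sqrt_nonneg (m : ℝ)).eq_or_lt with sqrt_eq | sqrt_pos
  · simp only [← sqrt_eq, div_zero, zero_mul, abs_zero]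
    norm_num
  have nonneg_of_abs_le {s : ℝ} (hs : |s| * (11 / 2 * √m) ≤ 1) :
      0 ≤ 1 + 2 * s * (blockVec e M ⬝ᵥ signs w) := by
    have trace_nonneg := re_trace_mul_nonneg hM (hw.posSemidef_one_add_smul_blockPerturbation e hs)
    rw [mul_add, mul_one, mul_smul_comm, trace_add, trace_smul, smul_eq_mul, Complex.add_re,
      Complex.re_ofReal_mul, re_trace_mul_blockVec_dotProduct e hM] at trace_nonneg
    refine nonneg_of_mul_nonneg_right (a := M.trace.re) ?_ trace_pos
    linarith
  have abs_eq : |2 / (11 * √(m : ℝ))| * (11 / 2 * √m) = 1 := by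
    rw [abs_of_pos (by positivity)]
    field_simp
  have lower := nonneg_of_abs_le abs_eq.le
  have upper := nonneg_of_abs_le (s := -(2 / (11 * √m))) (by rw [abs_neg, abs_eq])
  have rescale : 2 * (2 / (11 * √m)) * (blockVec e M ⬝ᵥ signs w) =
      2 / 11 * (2 / √m * (blockVec e M ⬝ᵥ signs w)) := by field_simp
  rw [mul_neg, neg_mul, rescale] at upper
  rw [rescale] at lower
  rw [abs_le]
  constructor <;> linarith

/-- The perturbation of the maximally mixed state whose off-diagonal block is `t / (d √m)` times
the sign matrix `w`; it is a state only if `w` has small operator norm. -/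
noncomputable def hardState (t : ℝ) (w : Fin m × Fin m → Bool) : Matrix (Fin d) (Fin d) ℂ :=
  (d : ℂ)⁻¹ • (1 + ((t / √m : ℝ) : ℂ) • blockPerturbation e (signs w))

lemma re_trace_hardState_mul (t : ℝ) (w : Fin m × Fin m → Bool) {M : Matrix (Fin d) (Fin d) ℂ}
    (hM : M.PosSemidef) :
    (hardState e t w * M).trace.re =
      (maximallyMixed d * M).trace.re * (1 + ((2 * t / √m) • blockVec e M) ⬝ᵥ signs w) := by
  rw [trace_mul_comm, hardState, mul_smul_comm, mul_add, mul_one, mul_smul_comm, trace_smul,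
    trace_add, trace_smul, smul_eq_mul, smul_eq_mul, ← Complex.ofReal_natCast,
    ← Complex.ofReal_inv, Complex.re_ofReal_mul, Complex.add_re, Complex.re_ofReal_mul,
    re_trace_mul_blockVec_dotProduct e hM, smul_dotProduct, smul_eq_mul,
    re_trace_maximallyMixed_mul]
  ring

lemma OpBounded.hardState_isState (hw : OpBounded w) (hd : 0 < d) {t : ℝ} (ht : |t| ≤ 2 / 11) :
    IsState (hardState e t w) where
  posSemidef := by
    refine (hw.posSemidef_one_add_smul_blockPerturbation e ?_).smul (by simp)
    calc |t / √m| * (11 / 2 * √m) = 11 / 2 * |t| * (√m / √m) := by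
          rw [abs_div, abs_of_nonneg (Real.sqrt_nonneg _)]
          ring
      _ ≤ 11 / 2 * |t| * 1 := by gcongr; exact div_self_le_one _
      _ ≤ 1 := by linarith
  trace_eq_one := by
    rw [hardState, trace_smul, trace_add, trace_smul, trace_blockPerturbation]
    simp [hd.ne']

lemma hardState_sub_maximallyMixed (t : ℝ) (w : Fin m × Fin m → Bool) :
    hardState e t w - maximallyMixed d =
      ((t / (d * √m) : ℝ) : ℂ) • blockPerturbation e (signs w) := by
  rw [hardState, maximallyMixed, smul_add, add_sub_cancel_left, smul_smul]
  congr 1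
  push_cast
  ring

lemma le_traceNorm_smul_blockPerturbation (c : ℝ) {b : ℝ} (hb : 0 < b) (v : Fin m × Fin m → ℝ) :
    3 * c ^ 2 / b * (v ⬝ᵥ v) - c ^ 4 / b ^ 3 * quarticTrace v ≤
      traceNorm ((c : ℂ) • blockPerturbation e v) := by
  set P := blockPerturbation e v with P_def
  have gram_eq : ((c : ℂ) • P)ᴴ * ((c : ℂ) • P) = ((c ^ 2 : ℝ) : ℂ) • (P * P) := by
    rw [conjTranspose_smul, (blockPerturbation_isHermitian e v).eq, smul_mul_smul_comm]
    simp [sq, P_def]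
  refine le_trans (le_of_eq ?_) (le_traceNorm _ hb)
  rw [gram_eq, smul_mul_smul_comm, trace_smul, trace_smul, smul_eq_mul, smul_eq_mul,
    ← Complex.ofReal_mul, Complex.re_ofReal_mul, Complex.re_ofReal_mul,
    re_trace_blockPerturbation_sq, re_trace_blockPerturbation_pow_four]
  ring

lemma lt_traceNorm_hardState (hm : d ≤ 2 * m + 1) (hd : 90 ≤ d) {ε : ℝ} (hε : 0 < ε)
    (hw : quarticTrace (signs w) ≤ 39 / 10 * (m : ℝ) ^ 3) :
    ε < traceNorm (hardState e (2 * ε) w - maximallyMixed d) := by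
  have m_pos : (0 : ℝ) < m := by exact_mod_cast (show 0 < m by omega)
  have d_pos : (0 : ℝ) < d := by exact_mod_cast (show 0 < d by omega)
  set s := √(m : ℝ)
  have s_pos : 0 < s := Real.sqrt_pos.2 m_pos
  have s_sq : s ^ 2 = m := Real.sq_sqrt m_pos.le
  set c : ℝ := 2 * ε / (d * s) with c_def
  have norm_signs : signs w ⬝ᵥ signs w = (m : ℝ) ^ 2 := by
    simp [dotProduct, ← sq, signs_sq]
  have ratio_lt : (d : ℝ) < (300 / 197 - 3900000 / 197 ^ 3) * (2 * m) := by
    have : (d : ℝ) ≤ 2 * m + 1 := by exact_mod_cast hm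
    have : (90 : ℝ) ≤ d := by exact_mod_cast hd
    norm_num
    linarith
  -- The singular values of a sign matrix of size `m` are of order `s`; the weight `197 / 100`
  -- optimizes the bound of `le_traceNorm`.
  calc ε < (300 / 197 - 3900000 / 197 ^ 3) * (2 * ε * m / d) := by
        rw [← mul_div_assoc, lt_div_iff₀ d_pos]
        nlinarith
    _ = 3 * c ^ 2 / (197 / 100 * c * s) * (m : ℝ) ^ 2 -
        c ^ 4 / (197 / 100 * c * s) ^ 3 * (39 / 10 * (m : ℝ) ^ 3) := by
        rw [c_def, ← s_sq]
        field_simp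
        ring
    _ ≤ 3 * c ^ 2 / (197 / 100 * c * s) * (signs w ⬝ᵥ signs w) -
        c ^ 4 / (197 / 100 * c * s) ^ 3 * quarticTrace (signs w) := by
        rw [norm_signs]
        gcongr
    _ ≤ traceNorm (hardState e (2 * ε) w - maximallyMixed d) := by
        rw [hardState_sub_maximallyMixed]
        exact le_traceNorm_smul_blockPerturbation e c (by positivity) _

end HardStates

/-! ### Lower bound -/

section LeafMeans

variable {d n : ℕ}

/-- The mean of `φ` over the leaves of an algorithm that is run on copies of `ρ`, as a function of
the answer and of the effects observed on the way to the leaf, latest first, followed by `l`. -/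
noncomputable def leafMean (ρ : Matrix (Fin d) (Fin d) ℂ)
    (φ : List (Matrix (Fin d) (Fin d) ℂ) → Answer → ℝ) :
    {n : ℕ} → IncoherentAlgorithm d n → List (Matrix (Fin d) (Fin d) ℂ) → ℝ
  | _, .output a, l => φ l a
  | _, .measure M next, l => ∑ z, M.prob ρ z * leafMean ρ φ (next z) (M.effect z :: l)

lemma sum_prob {k : ℕ} (M : POVM d k) {ρ : Matrix (Fin d) (Fin d) ℂ} (hρ : ρ.trace = 1) :
    ∑ z, M.prob ρ z = 1 := by
  simp only [POVM.prob]
  rw [← Complex.re_sum, ← trace_sum, ← Finset.mul_sum, M.sum_eq_one, mul_one, hρ, Complex.one_re]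

lemma answerProb_nonneg (A : IncoherentAlgorithm d n) {ρ : Matrix (Fin d) (Fin d) ℂ}
    (hρ : ρ.PosSemidef) (a : Answer) : 0 ≤ A.answerProb ρ a := by
  induction A with
  | output b =>
    rw [IncoherentAlgorithm.answerProb]
    split_ifs <;> norm_num
  | measure M next ih =>
    exact Finset.sum_nonneg fun z _ => mul_nonneg (re_trace_mul_nonneg hρ (M.posSemidef z)) (ih z)

lemma answerProb_mixed_add_far (A : IncoherentAlgorithm d n) {ρ : Matrix (Fin d) (Fin d) ℂ}
    (hρ : ρ.trace = 1) : A.answerProb ρ .mixed + A.answerProb ρ .far = 1 := by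
  induction A with
  | output b => cases b <;> simp [IncoherentAlgorithm.answerProb]
  | measure M next ih =>
    simp only [IncoherentAlgorithm.answerProb, ← Finset.sum_add_distrib, ← mul_add, ih, mul_one,
      sum_prob M hρ]

variable (ρ : Matrix (Fin d) (Fin d) ℂ) (A : IncoherentAlgorithm d n)
  (l : List (Matrix (Fin d) (Fin d) ℂ))

lemma leafMean_indicator (a : Answer) :
    leafMean ρ (fun _ b => if b = a then 1 else 0) A l = A.answerProb ρ a := by
  induction A generalizing l with
  | output => rfl
  | measure M next ih => simp only [leafMean, ih, IncoherentAlgorithm.answerProb]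

lemma leafMean_sub (φ ψ : List (Matrix (Fin d) (Fin d) ℂ) → Answer → ℝ) :
    leafMean ρ (fun l a => φ l a - ψ l a) A l = leafMean ρ φ A l - leafMean ρ ψ A l := by
  induction A generalizing l with
  | output => rfl
  | measure M next ih => simp only [leafMean, ih, mul_sub, Finset.sum_sub_distrib]

lemma leafMean_const_mul (c : ℝ) (φ : List (Matrix (Fin d) (Fin d) ℂ) → Answer → ℝ) :
    leafMean ρ (fun l a => c * φ l a) A l = c * leafMean ρ φ A l := by
  induction A generalizing l with
  | output => rfl
  | measure M next ih => simp only [leafMean, ih, Finset.mul_sum, mul_left_comm c]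

lemma prodMean_leafMean {ι Ω : Type*} [Fintype ι] [DecidableEq ι] [Fintype Ω] (p : ι → Ω → ℝ)
    (φ : (ι → Ω) → List (Matrix (Fin d) (Fin d) ℂ) → Answer → ℝ) :
    prodMean p (fun w => leafMean ρ (φ w) A l) =
      leafMean ρ (fun l a => prodMean p fun w => φ w l a) A l := by
  induction A generalizing l with
  | output => rfl
  | measure M next ih => simp only [leafMean, prodMean_sum, prodMean_const_mul, ih]

variable {ρ}

lemma leafMean_likelihoodRatio {σ : Matrix (Fin d) (Fin d) ℂ} {L : Matrix (Fin d) (Fin d) ℂ → ℝ}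
    (hL : ∀ M : Matrix (Fin d) (Fin d) ℂ, M.PosSemidef →
      (σ * M).trace.re = (ρ * M).trace.re * L M) (a : Answer) :
    leafMean ρ (fun l b => (l.map L).prod * if b = a then 1 else 0) A l =
      (l.map L).prod * A.answerProb σ a := by
  induction A generalizing l with
  | output => rfl
  | measure M next ih =>
    simp only [leafMean, ih, IncoherentAlgorithm.answerProb, Finset.mul_sum, POVM.prob,
      hL _ (M.posSemidef _), List.map_cons, List.prod_cons]
    exact Finset.sum_congr rfl fun z _ => by ring

variable {l}

lemma leafMean_mono (hρ : ρ.PosSemidef) {φ ψ : List (Matrix (Fin d) (Fin d) ℂ) → Answer → ℝ}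
    (hl : ∀ M ∈ l, M.PosSemidef)
    (hφ : ∀ l' : List (Matrix (Fin d) (Fin d) ℂ), (∀ M ∈ l', M.PosSemidef) →
      l'.length = l.length + n → ∀ a, φ l' a ≤ ψ l' a) :
    leafMean ρ φ A l ≤ leafMean ρ ψ A l := by
  induction A generalizing l with
  | output b => exact hφ l hl rfl b
  | measure M next ih =>
    refine Finset.sum_le_sum fun z _ => mul_le_mul_of_nonneg_left
      (ih z (List.forall_mem_cons.2 ⟨M.posSemidef z, hl⟩) fun l' hl' length_eq a =>
        hφ l' hl' ?_ a) (re_trace_mul_nonneg hρ (M.posSemidef z))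
    rw [length_eq, List.length_cons]
    ring

lemma maximallyMixed_posSemidef : (maximallyMixed d).PosSemidef :=
  PosSemidef.one.smul (by simp)

end LeafMeans

section Likelihood

variable {ι : Type*} [Fintype ι] {l : List (ι → ℝ)}

lemma sum_dotProduct_sum_le {r : ℝ} (hl : ∀ u ∈ l, u ⬝ᵥ u ≤ r) :
    l.sum ⬝ᵥ l.sum ≤ r * l.length + 2 * pairSum l := by
  have norms_le := List.sum_le_card_nsmul (l.map fun u => u ⬝ᵥ u) r (by simpa using hl)
  rw [List.length_map, nsmul_eq_mul] at norms_le
  linarith [sum_dotProduct_sum l]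

lemma abs_sum_apply_le {t : ℝ} (ht : 0 ≤ t) (hl : potential l ≤ t ^ 4) (a : ι) :
    |l.sum a| ≤ t := by
  refine le_of_pow_le_pow_left₀ four_ne_zero ht ?_
  calc |l.sum a| ^ 4 = l.sum a ^ 4 := (by decide : Even 4).pow_abs _
    _ ≤ quarticSum l := Finset.single_le_sum (f := fun a => l.sum a ^ 4)
        (fun _ _ => by positivity) (Finset.mem_univ a)
    _ ≤ potential l := by
        rw [potential]
        linarith [sq_nonneg (pairSum l), alignSum_nonneg l]
    _ ≤ t ^ 4 := hl

lemma nine_tenths_le_prodMean_indicator_prod [DecidableEq ι] {D r b : ℝ} (hD : 30 ≤ D) (hr : 0 ≤ r)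
    (hrD : r * D ^ 2 ≤ 1 / 3) (hl : ∀ u ∈ l, u ⬝ᵥ u ≤ r) (hlen : r * l.length ≤ D / 10 ^ 6)
    (hpot : potential l ≤ 1 / 10 ^ 4) {G : Set (ι → Bool)}
    (hgood : ∀ w ∈ G, ∀ u ∈ l, |u ⬝ᵥ signs w| ≤ 11 / 12) (hb : 0 ≤ b)
    (hbD : b ≤ Real.exp (-(D ^ 2 / 6))) (hbad : prodMean (signLaw 0) (Gᶜ.indicator 1) ≤ b ^ 2) :
    9 / 10 ≤ prodMean (signLaw 0)
      (G.indicator fun w => (l.map fun u => 1 + u ⬝ᵥ signs w).prod) := by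
  have D_pos : 0 < D := by linarith
  have align_nonneg := alignSum_nonneg l
  have quartic_nonneg := quarticSum_nonneg l
  have pot_le : pairSum l ^ 2 + alignSum l + quarticSum l ≤ 1 / 10 ^ 4 := hpot
  have align_le : alignSum l ≤ 1 / 10 ^ 4 := by linarith [sq_nonneg (pairSum l)]
  have quartic_le : quarticSum l ≤ 1 / 10 ^ 4 := by linarith [sq_nonneg (pairSum l)]
  obtain ⟨le_pair, pair_le⟩ := abs_le.1 (abs_le_of_sq_le_sq (a := pairSum l) (b := 1 / 100)
    (by linarith) (by norm_num))
  have norm_le : l.sum ⬝ᵥ l.sum ≤ D / 10 ^ 6 + 1 / 50 := by linarith [sum_dotProduct_sum_le hl]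
  have second_order_le : 6 * (1 / D) * (r * l.length + alignSum l) ≤ 1 / 1000 := by
    rw [mul_one_div, div_mul_eq_mul_div, div_le_iff₀ D_pos]
    linarith
  have fourth_order_le : 48 / (1 / D) *
      (3 * r ^ 2 * l.length + r * (l.sum ⬝ᵥ l.sum) * alignSum l) ≤ 1 / 1000 := by
    have norm_align_le : (l.sum ⬝ᵥ l.sum) * alignSum l ≤ (D / 10 ^ 6 + 1 / 50) * (1 / 10 ^ 4) :=
      mul_le_mul norm_le align_le align_nonneg (by positivity)
    calc 48 / (1 / D) * (3 * r ^ 2 * l.length + r * (l.sum ⬝ᵥ l.sum) * alignSum l)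
        = 48 * (r * D) * (3 * (r * l.length) + (l.sum ⬝ᵥ l.sum) * alignSum l) := by
          field_simp
      _ ≤ 48 * (r * D) * (D / 10 ^ 5) := by
          gcongr
          linarith
      _ = 48 / 10 ^ 5 * (r * D ^ 2) := by ring
      _ ≤ 1 / 1000 := by linarith
  have bad_le : b * Real.exp (l.sum ⬝ᵥ l.sum) ≤ 1 / 15 := by
    calc b * Real.exp (l.sum ⬝ᵥ l.sum)
        ≤ Real.exp (-(D ^ 2 / 6)) * Real.exp (D / 10 ^ 6 + 1 / 50) := by gcongr
      _ ≤ Real.exp (-14) := by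
          rw [← Real.exp_add, Real.exp_le_exp]
          linarith [mul_le_mul_of_nonneg_right hD D_pos.le]
      _ ≤ 1 / 15 := by
          rw [Real.exp_neg, one_div]
          gcongr
          linarith [Real.add_one_le_exp (14 : ℝ)]
  refine le_trans ?_ (exp_sub_le_prodMean_indicator_prod (one_div_pos.2 D_pos) hb hl
    (abs_sum_apply_le (by norm_num) (by linarith)) hgood hbad)
  refine le_trans ?_ (sub_le_sub (Real.add_one_le_exp _) bad_le)
  linarith

end Likelihood

section LowerBound

variable {d m n : ℕ} (e : Fin m ⊕ Fin m ↪ Fin d)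

/-- The vectors `β • blockVec e M`, for the matrices `M` of a list. -/
noncomputable def blockVecs (β : ℝ) (l : List (Matrix (Fin d) (Fin d) ℂ)) :
    List (Fin m × Fin m → ℝ) :=
  l.map fun M => β • blockVec e M

variable {l : List (Matrix (Fin d) (Fin d) ℂ)}

lemma norm_le_of_mem_blockVecs (β : ℝ) (hl : ∀ M ∈ l, M.PosSemidef) :
    ∀ u ∈ blockVecs e β l, u ⬝ᵥ u ≤ β ^ 2 := by
  rw [blockVecs, List.forall_mem_map]
  intro M hM
  rw [smul_dotProduct, dotProduct_smul, smul_eq_mul, smul_eq_mul, ← mul_assoc, ← sq]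
  exact mul_le_of_le_one_right (sq_nonneg β) (blockVec_norm_le_one e (hl M hM))

lemma OpBounded.abs_dotProduct_signs_le_of_mem_blockVecs {w : Fin m × Fin m → Bool}
    (hw : OpBounded w) {t : ℝ} (ht : |t| ≤ 1 / 6) (hl : ∀ M ∈ l, M.PosSemidef) :
    ∀ u ∈ blockVecs e (2 * t / √m) l, |u ⬝ᵥ signs w| ≤ 11 / 12 := by
  rw [blockVecs, List.forall_mem_map]
  intro M hM
  calc |((2 * t / √m) • blockVec e M) ⬝ᵥ signs w|
      = |t| * |2 / √m * (blockVec e M ⬝ᵥ signs w)| := by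
        rw [smul_dotProduct, smul_eq_mul, ← abs_mul]
        ring_nf
    _ ≤ 1 / 6 * (11 / 2) := by
        gcongr
        exact hw.abs_dotProduct_blockVec_le e (hl M hM)
    _ = 11 / 12 := by norm_num

lemma leafMean_potential_le (hd : 0 < d) (A : IncoherentAlgorithm d n) (β : ℝ)
    (hl : ∀ M ∈ l, M.PosSemidef) :
    leafMean (maximallyMixed d) (fun l _ => potential (blockVecs e β l)) A l ≤
      potential (blockVecs e β l) + β ^ 2 / (2 * d) *
        (11 * n * ((blockVecs e β l).sum ⬝ᵥ (blockVecs e β l).sum) + β ^ 2 * n * l.length +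
          6 * β ^ 2 * n ^ 2) + 5 * (β ^ 2) ^ 2 * n := by
  induction A generalizing l with
  | output => simp [leafMean]
  | @measure n k M next ih =>
    set X := (blockVecs e β l).sum
    set κ := β ^ 2 / (2 * (d : ℝ))
    have κ_nonneg : 0 ≤ κ := by positivity
    have step := isIsotropicStep_blockVec e hd M β
    have potential_le := step.mean_potential_le κ_nonneg (norm_le_of_mem_blockVecs e β hl)
    have drift_le := mul_le_mul_of_nonneg_left (step.mean_norm_add_sq_le X)
      (show 0 ≤ 11 * κ * n by positivity)
    rw [blockVecs, List.length_map, ← blockVecs] at potential_le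
    set p := M.prob (maximallyMixed d)
    set y := fun z => β • blockVec e (M.effect z)
    set c := κ * (β ^ 2 * n * (l.length + 1) + 6 * β ^ 2 * n ^ 2) + 5 * (β ^ 2) ^ 2 * n
    calc leafMean (maximallyMixed d) (fun l _ => potential (blockVecs e β l)) (.measure M next) l
        ≤ ∑ z, p z * (potential (y z :: blockVecs e β l) +
            11 * κ * n * ((y z + X) ⬝ᵥ (y z + X)) + c) := by
          refine Finset.sum_le_sum fun z _ => mul_le_mul_of_nonneg_left
            ((ih z (List.forall_mem_cons.2 ⟨M.posSemidef z, hl⟩)).trans_eq ?_)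
            (step.mem_stdSimplex.1 z)
          simp only [blockVecs, List.map_cons, List.sum_cons, List.length_cons, Nat.cast_add,
            Nat.cast_one, c, y, X]
          ring
      _ = ∑ z, p z * potential (y z :: blockVecs e β l) +
            11 * κ * n * ∑ z, p z * ((y z + X) ⬝ᵥ (y z + X)) + c := by
          simp only [mul_add (p _), Finset.sum_add_distrib, mul_left_comm (p _), ← Finset.mul_sum,
            ← Finset.sum_mul, step.mem_stdSimplex.2, one_mul]
      _ ≤ _ := by
          push_cast
          linarith [mul_nonneg κ_nonneg (sq_nonneg β)]

lemma leafMean_potential_nil_le (hd : 0 < d) (A : IncoherentAlgorithm d n) (β : ℝ) :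
    leafMean (maximallyMixed d) (fun l _ => potential (blockVecs e β l)) A [] ≤
      (β ^ 2) ^ 2 * (3 * n ^ 2 / d + 5 * n) := by
  refine (leafMean_potential_le e hd A β (by simp)).trans_eq ?_
  simp only [blockVecs, List.map_nil, potential_nil, List.sum_nil, dotProduct_zero,
    List.length_nil, Nat.cast_zero, mul_zero, zero_add]
  field_simp
  ring

lemma prodMean_indicator_answerProb_hardState (A : IncoherentAlgorithm d n) (t : ℝ)
    (G : Set (Fin m × Fin m → Bool)) (a : Answer) :
    prodMean (signLaw 0) (G.indicator fun w => A.answerProb (hardState e t w) a) =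
      leafMean (maximallyMixed d) (fun l b => prodMean (signLaw 0) (G.indicator fun w =>
        ((blockVecs e (2 * t / √m) l).map fun u => 1 + u ⬝ᵥ signs w).prod) *
          if b = a then 1 else 0) A [] := by
  have change_of_measure : G.indicator (fun w => A.answerProb (hardState e t w) a) =
      fun w => leafMean (maximallyMixed d) (fun l b => (if b = a then 1 else 0) *
        G.indicator (fun w =>
          ((blockVecs e (2 * t / √m) l).map fun u => 1 + u ⬝ᵥ signs w).prod) w) A [] := by
    funext w
    by_cases hw : w ∈ G
    · have likelihoodRatio := leafMean_likelihoodRatio A []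
        (fun M => re_trace_hardState_mul e t w (M := M)) a
      rw [List.map_nil, List.prod_nil, one_mul] at likelihoodRatio
      simp only [Set.indicator_of_mem hw, blockVecs, List.map_map, Function.comp_def,
        ← likelihoodRatio, mul_comm]
    · have leafMean_zero := leafMean_const_mul (maximallyMixed d) A [] 0 fun _ _ => 0
      simp only [zero_mul] at leafMean_zero
      simp only [Set.indicator_of_notMem hw, mul_zero, leafMean_zero]
  rw [change_of_measure, prodMean_leafMean]
  simp only [prodMean_const_mul, mul_comm]

variable {ε : ℝ}

lemma sq_perturbation_mul_le (hm : 0 < m) (hdm : d ≤ 2 * m + 1) :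
    (2 * (2 * ε) / √m) ^ 2 * √d ^ 2 ≤ 48 * ε ^ 2 := by
  have d_le : (d : ℝ) ≤ 3 * m := by exact_mod_cast (show d ≤ 3 * m by omega)
  rw [div_pow, Real.sq_sqrt m.cast_nonneg, Real.sq_sqrt d.cast_nonneg, div_mul_eq_mul_div,
    div_le_iff₀ (by exact_mod_cast hm)]
  linarith [mul_le_mul_of_nonneg_left d_le (sq_nonneg ε)]

lemma sq_perturbation_mul_length_le (hm : 0 < m) (hd : 0 < d) (hdm : d ≤ 2 * m + 1)
    {N : ℝ} (hN : 0 ≤ N) (hNε : N * ε ^ 2 ≤ 1 / 10 ^ 8 * √d ^ 3) :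
    (2 * (2 * ε) / √m) ^ 2 * N ≤ √d / 10 ^ 6 := by
  have sqrt_pos : 0 < √(d : ℝ) := Real.sqrt_pos.2 (by exact_mod_cast hd)
  refine le_of_mul_le_mul_right ?_ (pow_pos sqrt_pos 2)
  linarith [mul_le_mul_of_nonneg_left (sq_perturbation_mul_le (ε := ε) hm hdm) hN,
    pow_pos sqrt_pos 3]

lemma nine_tenths_le_prodMean_likelihoodRatio (hdm : d ≤ 2 * m + 1) (hd : 1000 ≤ d)
    (hε : |ε| ≤ 1 / 12) (hl : ∀ M ∈ l, M.PosSemidef)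
    (hlen : l.length * ε ^ 2 ≤ 1 / 10 ^ 8 * √d ^ 3)
    (hpot : potential (blockVecs e (2 * (2 * ε) / √m) l) ≤ 1 / 10 ^ 4) :
    9 / 10 ≤ prodMean (signLaw 0) ({w | OpBounded w}.indicator fun w =>
      ((blockVecs e (2 * (2 * ε) / √m) l).map fun u => 1 + u ⬝ᵥ signs w).prod) := by
  have m_pos : 0 < m := by omega
  have d_le : (d : ℝ) ≤ 3 * m := by exact_mod_cast (show d ≤ 3 * m by omega)
  have sqrt_ge : 30 ≤ √(d : ℝ) :=
    Real.le_sqrt_of_sq_le (by norm_num; exact_mod_cast (show 900 ≤ d by omega))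
  have sq_le : ε ^ 2 ≤ (1 / 12) ^ 2 := sq_le_sq' (abs_le.1 hε).1 (abs_le.1 hε).2
  refine nine_tenths_le_prodMean_indicator_prod sqrt_ge (sq_nonneg _) ?_
    (norm_le_of_mem_blockVecs e _ hl) ?_ hpot
    (fun w hw => hw.abs_dotProduct_signs_le_of_mem_blockVecs e ?_ hl) (Real.exp_nonneg _)
    (Real.exp_le_exp.2 ?_) (prodMean_indicator_not_opBounded_le m_pos)
  · linarith [sq_perturbation_mul_le (ε := ε) m_pos hdm]
  · rw [blockVecs, List.length_map]
    exact sq_perturbation_mul_length_le m_pos (by omega) hdm (Nat.cast_nonneg _) hlen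
  · rw [abs_mul, abs_two]
    linarith
  · rw [Real.sq_sqrt d.cast_nonneg]
    linarith

lemma prodMean_answerProb_hardState_le (hdm : d ≤ 2 * m + 1) (hd : 90 ≤ d) (hε : 0 < ε)
    (hε' : ε ≤ 1 / 11) {A : IncoherentAlgorithm d n} (hA : A.TestsMixedness ε) :
    prodMean (signLaw 0) ({w : Fin m × Fin m → Bool | OpBounded w}.indicator fun w =>
      A.answerProb (hardState e (2 * ε) w) .mixed) ≤ 1 / 3 + 2 / 3 * (10 / 29) := by
  have pointwise (w : Fin m × Fin m → Bool) :
      {w : Fin m × Fin m → Bool | OpBounded w}.indicator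
          (fun w => A.answerProb (hardState e (2 * ε) w) .mixed) w ≤
        1 / 3 + 2 / 3 * {w : Fin m × Fin m → Bool |
          39 / 10 * (m : ℝ) ^ 3 < quarticTrace (signs w)}.indicator 1 w := by
    have indicator_nonneg : 0 ≤ {w : Fin m × Fin m → Bool | 39 / 10 * (m : ℝ) ^ 3 <
        quarticTrace (signs w)}.indicator (1 : (Fin m × Fin m → Bool) → ℝ) w :=
      Set.indicator_apply_nonneg fun _ => zero_le_one
    by_cases hw : OpBounded w
    · have isState := hw.hardState_isState e (t := 2 * ε) (by omega)
        (by rw [abs_of_pos] <;> linarith)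
      have add_eq_one := answerProb_mixed_add_far A isState.trace_eq_one
      have far_nonneg := answerProb_nonneg A isState.posSemidef .far
      rw [Set.indicator_of_mem (s := {w | OpBounded w}) hw]
      by_cases trace_gt : 39 / 10 * (m : ℝ) ^ 3 < quarticTrace (signs w)
      · rw [Set.indicator_of_mem (by exact trace_gt), Pi.one_apply]
        linarith
      · linarith [hA.2 _ isState (lt_traceNorm_hardState e hdm hd hε (not_lt.1 trace_gt))]
    · rw [Set.indicator_of_notMem (s := {w | OpBounded w}) hw]
      linarith
  refine (prodMean_mono (fun a => (signLaw_zero_mem_stdSimplex a).1) pointwise).trans ?_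
  rw [prodMean_add, prodMean_const (sum_signLaw _), prodMean_const_mul]
  linarith [prodMean_indicator_lt_quarticTrace_le (m := m) (by omega)]

lemma le_prodMean_answerProb_hardState (hdm : d ≤ 2 * m + 1) (hd : 1000 ≤ d) (hε : |ε| ≤ 1 / 12)
    (A : IncoherentAlgorithm d n) (hn : n * ε ^ 2 ≤ 1 / 10 ^ 8 * √d ^ 3) (a : Answer) :
    9 / 10 * (A.answerProb (maximallyMixed d) a - 10 ^ 4 * leafMean (maximallyMixed d)
        (fun l _ => potential (blockVecs e (2 * (2 * ε) / √m) l)) A []) ≤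
      prodMean (signLaw 0) ({w : Fin m × Fin m → Bool | OpBounded w}.indicator fun w =>
        A.answerProb (hardState e (2 * ε) w) a) := by
  rw [prodMean_indicator_answerProb_hardState, ← leafMean_indicator _ A [], ← leafMean_const_mul,
    ← leafMean_sub, ← leafMean_const_mul]
  refine leafMean_mono A maximallyMixed_posSemidef (by simp) fun l hl length_eq b => ?_
  have potential_nonneg := potential_nonneg (blockVecs e (2 * (2 * ε) / √m) l)
  have likelihood_nonneg : 0 ≤ prodMean (signLaw 0) ({w | OpBounded w}.indicator fun w =>
      ((blockVecs e (2 * (2 * ε) / √m) l).map fun u => 1 + u ⬝ᵥ signs w).prod) := by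
    refine prodMean_nonneg (fun a => (signLaw_zero_mem_stdSimplex a).1) fun w =>
      Set.indicator_apply_nonneg fun hw => List.prod_nonneg (List.forall_mem_map.2 fun u hu => ?_)
    have dot_le := hw.abs_dotProduct_signs_le_of_mem_blockVecs e (t := 2 * ε)
      (by rw [abs_mul, abs_two]; linarith) hl u hu
    linarith [(abs_le.1 dot_le).1]
  split_ifs
  · rw [mul_one]
    by_cases hpot : potential (blockVecs e (2 * (2 * ε) / √m) l) ≤ 1 / 10 ^ 4
    · linarith [nine_tenths_le_prodMean_likelihoodRatio e hdm hd hε hl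
        (by simpa [length_eq] using hn) hpot]
    · linarith
  · linarith

lemma leafMean_potential_le_of_length_le (hdm : d ≤ 2 * m + 1) (hd : 1000 ≤ d)
    (hε : |ε| ≤ 1 / 12) (A : IncoherentAlgorithm d n) (hn : n * ε ^ 2 ≤ 1 / 10 ^ 8 * √d ^ 3) :
    leafMean (maximallyMixed d) (fun l _ => potential (blockVecs e (2 * (2 * ε) / √m) l)) A [] ≤
      1 / 10 ^ 6 := by
  have m_pos : 0 < m := by omega
  have sq_le : ε ^ 2 ≤ (1 / 12) ^ 2 := sq_le_sq' (abs_le.1 hε).1 (abs_le.1 hε).2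
  have mul_le := sq_perturbation_mul_le (ε := ε) m_pos hdm
  have mul_length_le := sq_perturbation_mul_length_le m_pos (by omega) hdm n.cast_nonneg hn
  have sqrt_ge : 30 ≤ √(d : ℝ) :=
    Real.le_sqrt_of_sq_le (by norm_num; exact_mod_cast (show 900 ≤ d by omega))
  refine (leafMean_potential_nil_le e (by omega) A _).trans ?_
  rw [← Real.sq_sqrt d.cast_nonneg]
  set r := (2 * (2 * ε) / √m) ^ 2
  set D := √(d : ℝ)
  have r_nonneg : 0 ≤ r := sq_nonneg _
  calc r ^ 2 * (3 * n ^ 2 / D ^ 2 + 5 * n) = 3 * (r * n) ^ 2 / D ^ 2 + 5 * r * (r * n) := by ring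
    _ ≤ 3 * (D / 10 ^ 6) ^ 2 / D ^ 2 + 5 * r * (D / 10 ^ 6) := by gcongr
    _ = 3 / 10 ^ 12 + 5 / 10 ^ 6 * (r * D) := by
        field_simp
    _ ≤ 1 / 10 ^ 6 := by
        linarith [mul_le_mul_of_nonneg_left sqrt_ge (mul_nonneg r_nonneg (Real.sqrt_nonneg d))]

/-- Le Cam's method for the mixture of the hard states, restricted to the sign matrices that give
a state. -/
theorem lower_bound (hd : 1000 ≤ d) (hε : 0 < ε) (hε' : ε ≤ 1 / 12)
    {A : IncoherentAlgorithm d n} (hA : A.TestsMixedness ε) :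
    1 / 10 ^ 8 * √d ^ 3 ≤ n * ε ^ 2 := by
  by_contra! hn
  have abs_le : |ε| ≤ 1 / 12 := by rwa [abs_of_pos hε]
  let e : Fin (d / 2) ⊕ Fin (d / 2) ↪ Fin d :=
    finSumFinEquiv.toEmbedding.trans (Fin.castLEEmb (by omega))
  have hdm : d ≤ 2 * (d / 2) + 1 := by omega
  linarith [hA.1, prodMean_answerProb_hardState_le e hdm (by omega) hε (by linarith) hA,
    le_prodMean_answerProb_hardState e hdm hd abs_le A hn.le .mixed,
    leafMean_potential_le_of_length_le e hdm hd abs_le A hn.le]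

end LowerBound

/-! ### Quadratic forms in random signs -/

lemma paley_zygmund_prodMean {ι α : Type*} [Fintype ι] [DecidableEq ι] [Fintype α]
    {p : ι → α → ℝ} (hp : ∀ i, p i ∈ stdSimplex ℝ α) {f : (ι → α) → ℝ} (hf : 0 ≤ prodMean p f)
    {θ : ℝ} (hθ : θ ∈ Set.Icc 0 1) :
    ((1 - θ) * prodMean p f) ^ 2 ≤ prodMean p (fun w => f w ^ 2) *
      prodMean p ({w | θ * prodMean p f ≤ f w}.indicator 1) := by
  set m := prodMean p f
  set I : (ι → α) → ℝ := {w | θ * m ≤ f w}.indicator 1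
  have split (w : ι → α) : f w ≤ θ * m + f w * I w := by
    by_cases hw : θ * m ≤ f w
    · simp [I, hw, mul_nonneg hθ.1 hf]
    · simp [I, hw, le_of_not_ge hw]
  have mass : (1 - θ) * m ≤ prodMean p (fun w => f w * I w) := by
    have h := prodMean_mono (fun i => (hp i).1) split
    rw [prodMean_add, prodMean_const fun i => (hp i).2] at h
    linarith
  have indicator_sq (w : ι → α) : I w ^ 2 = I w := by
    by_cases hw : θ * m ≤ f w <;> simp [I, hw]
  calc ((1 - θ) * m) ^ 2
      ≤ prodMean p (fun w => f w * I w) ^ 2 :=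
        pow_le_pow_left₀ (mul_nonneg (sub_nonneg.2 hθ.2) hf) mass 2
    _ ≤ prodMean p (fun w => f w ^ 2) * prodMean p (fun w => I w ^ 2) :=
        sq_prodMean_mul_le (fun i => (hp i).1) f I
    _ = prodMean p (fun w => f w ^ 2) * prodMean p I := by simp only [indicator_sq]

section SignForms

variable {ι E : Type*} [NormedAddCommGroup E] [InnerProductSpace ℝ E]

/-- The quadratic form with vector coefficients `q` in the signs indexed by `s`. Its moments are
computed by induction on `s`. -/
def signForm (q : ι → ι → E) (s : Finset ι) (w : ι → Bool) : E :=
  ∑ a ∈ s, ∑ b ∈ s, (signs w a * signs w b) • q a b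

variable [DecidableEq ι] {q : ι → ι → E}

lemma signForm_insert (hsymm : ∀ a b, q a b = q b a) (hdiag : ∀ a, q a a = 0) {s : Finset ι}
    {a : ι} (ha : a ∉ s) (w : ι → Bool) :
    signForm q (insert a s) w =
      signForm q s w + signs w a • ∑ b ∈ s, signs w b • (2 : ℝ) • q a b := by
  simp only [signForm, Finset.sum_insert ha, hdiag, smul_zero, zero_add, Finset.sum_add_distrib,
    Finset.smul_sum, smul_smul]
  rw [← add_assoc, ← Finset.sum_add_distrib, add_comm]
  congr 1
  refine Finset.sum_congr rfl fun b _ => ?_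
  rw [hsymm b a, ← add_smul]
  congr 1
  ring

lemma signForm_update {s : Finset ι} {a : ι} (ha : a ∉ s) (w : ι → Bool) (x : Bool) :
    signForm q s (Function.update w a x) = signForm q s w :=
  Finset.sum_congr rfl fun b hb => Finset.sum_congr rfl fun c hc => by
    simp only [signs, Function.update_of_ne (ne_of_mem_of_not_mem hb ha),
      Function.update_of_ne (ne_of_mem_of_not_mem hc ha)]

variable [Fintype ι]

lemma prodMean_add_sign_smul {a : ι} {f g : (ι → Bool) → E}
    (hf : ∀ w b, f (Function.update w a b) = f w) (hg : ∀ w b, g (Function.update w a b) = g w)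
    (F : E → ℝ) :
    prodMean (signLaw 0) (fun w => F (f w + signs w a • g w)) =
      prodMean (signLaw 0) (fun w => (F (f w + g w) + F (f w - g w)) / 2) := by
  have h := prodMean_apply_eq_sum (sum_signLaw 0 a)
    (F := fun b w => F (f w + (if b then (1 : ℝ) else -1) • g w)) fun x y w => by rw [hf, hg]
  refine h.trans ?_
  rw [sum_signLaw_mul, ← prodMean_const_mul, ← prodMean_const_mul, ← prodMean_add]
  congr 1
  funext w
  simp [← sub_eq_add_neg]
  ring

lemma prodMean_norm_add_sign_smul_sq {a : ι} {f g : (ι → Bool) → E}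
    (hf : ∀ w b, f (Function.update w a b) = f w) (hg : ∀ w b, g (Function.update w a b) = g w) :
    prodMean (signLaw 0) (fun w => ‖f w + signs w a • g w‖ ^ 2) =
      prodMean (signLaw 0) (fun w => ‖f w‖ ^ 2) + prodMean (signLaw 0) (fun w => ‖g w‖ ^ 2) := by
  rw [prodMean_add_sign_smul hf hg fun x => ‖x‖ ^ 2, ← prodMean_add]
  congr 1
  funext w
  rw [norm_add_sq_real, norm_sub_sq_real]
  ring

lemma prodMean_norm_add_sign_smul_pow_four_le {a : ι} {f g : (ι → Bool) → E}
    (hf : ∀ w b, f (Function.update w a b) = f w) (hg : ∀ w b, g (Function.update w a b) = g w) :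
    prodMean (signLaw 0) (fun w => ‖f w + signs w a • g w‖ ^ 4) ≤
      prodMean (signLaw 0) (fun w => ‖f w‖ ^ 4) +
        6 * prodMean (signLaw 0) (fun w => ‖f w‖ ^ 2 * ‖g w‖ ^ 2) +
          prodMean (signLaw 0) (fun w => ‖g w‖ ^ 4) := by
  rw [prodMean_add_sign_smul hf hg fun x => ‖x‖ ^ 4, ← prodMean_const_mul, ← prodMean_add,
    ← prodMean_add]
  refine prodMean_mono (fun i => (signLaw_zero_mem_stdSimplex i).1) fun w => ?_
  have cauchy_schwarz : inner ℝ (f w) (g w) ^ 2 ≤ ‖f w‖ ^ 2 * ‖g w‖ ^ 2 := by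
    rw [← mul_pow]
    exact sq_le_sq' (neg_le_of_abs_le (abs_real_inner_le_norm _ _)) (real_inner_le_norm _ _)
  have pow_four (x : E) : ‖x‖ ^ 4 = (‖x‖ ^ 2) ^ 2 := by ring
  simp only [pow_four, norm_add_sq_real, norm_sub_sq_real]
  linarith

lemma prodMean_norm_sum_signs_smul_sq (c : ι → E) (s : Finset ι) :
    prodMean (signLaw 0) (fun w => ‖∑ a ∈ s, signs w a • c a‖ ^ 2) = ∑ a ∈ s, ‖c a‖ ^ 2 := by
  have h := prodMean_norm_sum_sq (sum_signLaw (0 : ι → ℝ))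
    (v := fun a b => (if b then (1 : ℝ) else -1) • c a) (fun a => by simp [signLaw]) s
  refine h.trans (Finset.sum_congr rfl fun a _ => ?_)
  rw [sum_signLaw_mul]
  simp
  ring

lemma prodMean_norm_sum_signs_smul_pow_four_le (c : ι → E) (s : Finset ι) :
    prodMean (signLaw 0) (fun w => ‖∑ a ∈ s, signs w a • c a‖ ^ 4) ≤
      3 * (∑ a ∈ s, ‖c a‖ ^ 2) ^ 2 := by
  have mean (a : ι) : ∑ b, signLaw (0 : ι → ℝ) a b • (if b then (1 : ℝ) else -1) • c a = 0 := by
    simp [signLaw]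
  have moment (a : ι) (n : ℕ) :
      ∑ b, signLaw (0 : ι → ℝ) a b * ‖(if b then (1 : ℝ) else -1) • c a‖ ^ n = ‖c a‖ ^ n := by
    rw [sum_signLaw_mul]
    simp
    ring
  exact prodMean_norm_sum_pow_four_le signLaw_zero_mem_stdSimplex mean (σ := fun a => ‖c a‖)
    (fun a => (moment a 2).le)
    (fun a => (moment a 4).trans_le (by linarith [pow_nonneg (norm_nonneg (c a)) 4])) s

lemma prodMean_norm_signForm_sq (hsymm : ∀ a b, q a b = q b a) (hdiag : ∀ a, q a a = 0)
    (s : Finset ι) :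
    prodMean (signLaw 0) (fun w => ‖signForm q s w‖ ^ 2) =
      2 * ∑ a ∈ s, ∑ b ∈ s, ‖q a b‖ ^ 2 := by
  induction s using Finset.induction with
  | empty => simp [signForm, prodMean_const (sum_signLaw 0)]
  | insert a s ha ih =>
    simp only [signForm_insert hsymm hdiag ha]
    rw [prodMean_norm_add_sign_smul_sq (signForm_update ha)
      fun w x => sum_update_of_notMem ha (fun b y => (if y then (1 : ℝ) else -1) • _) w x,
      prodMean_norm_sum_signs_smul_sq, ih]
    simp only [Finset.sum_insert ha, hdiag, norm_zero, norm_smul, Finset.sum_add_distrib, mul_pow,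
      ← Finset.mul_sum, hsymm _ a]
    norm_num
    ring

lemma prodMean_norm_signForm_pow_four_le (hsymm : ∀ a b, q a b = q b a) (hdiag : ∀ a, q a a = 0)
    (s : Finset ι) :
    prodMean (signLaw 0) (fun w => ‖signForm q s w‖ ^ 4) ≤
      27 * prodMean (signLaw 0) (fun w => ‖signForm q s w‖ ^ 2) ^ 2 := by
  have sign_nonneg (i : ι) := (signLaw_zero_mem_stdSimplex i).1
  induction s using Finset.induction with
  | empty => simp [signForm, prodMean_const (sum_signLaw 0)]
  | insert a s ha ih =>
    set f := signForm q s
    set g : (ι → Bool) → E := fun w => ∑ b ∈ s, signs w b • (2 : ℝ) • q a b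
    have hf : ∀ w x, f (Function.update w a x) = f w := signForm_update ha
    have hg : ∀ w x, g (Function.update w a x) = g w := fun w x =>
      sum_update_of_notMem ha (fun b y => (if y then (1 : ℝ) else -1) • (2 : ℝ) • q a b) w x
    simp only [signForm_insert hsymm hdiag ha]
    rw [prodMean_norm_add_sign_smul_sq hf hg]
    set F := prodMean (signLaw 0) fun w => ‖f w‖ ^ 2
    set G := prodMean (signLaw 0) fun w => ‖g w‖ ^ 2
    have F_nonneg : 0 ≤ F := prodMean_nonneg sign_nonneg fun w => by positivity
    have G_nonneg : 0 ≤ G := prodMean_nonneg sign_nonneg fun w => by positivity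
    have g_fourth : prodMean (signLaw 0) (fun w => ‖g w‖ ^ 4) ≤ 3 * G ^ 2 := by
      simp only [G, g, prodMean_norm_sum_signs_smul_sq]
      exact prodMean_norm_sum_signs_smul_pow_four_le _ s
    have cross : prodMean (signLaw 0) (fun w => ‖f w‖ ^ 2 * ‖g w‖ ^ 2) ≤ 9 * (F * G) := by
      refine (abs_le_of_sq_le_sq' ?_ (by positivity)).2
      calc prodMean (signLaw 0) (fun w => ‖f w‖ ^ 2 * ‖g w‖ ^ 2) ^ 2
          ≤ prodMean (signLaw 0) (fun w => (‖f w‖ ^ 2) ^ 2) *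
              prodMean (signLaw 0) (fun w => (‖g w‖ ^ 2) ^ 2) :=
            sq_prodMean_mul_le sign_nonneg _ _
        _ ≤ (27 * F ^ 2) * (3 * G ^ 2) := by
            simp only [← pow_mul]
            exact mul_le_mul ih g_fourth (prodMean_nonneg sign_nonneg fun w => by positivity)
              (by positivity)
        _ = (9 * (F * G)) ^ 2 := by ring
    calc prodMean (signLaw 0) (fun w => ‖f w + signs w a • g w‖ ^ 4)
        ≤ _ := prodMean_norm_add_sign_smul_pow_four_le hf hg
      _ ≤ 27 * F ^ 2 + 6 * (9 * (F * G)) + 3 * G ^ 2 := by gcongr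
      _ ≤ 27 * (F + G) ^ 2 := by nlinarith [sq_nonneg G]

lemma le_prodMean_indicator_norm_signForm_sq (hsymm : ∀ a b, q a b = q b a)
    (hdiag : ∀ a, q a a = 0) (s : Finset ι) :
    1 / 108 ≤ prodMean (signLaw 0)
      ({w | ∑ a ∈ s, ∑ b ∈ s, ‖q a b‖ ^ 2 ≤ ‖signForm q s w‖ ^ 2}.indicator 1) := by
  set S := ∑ a ∈ s, ∑ b ∈ s, ‖q a b‖ ^ 2
  have second : prodMean (signLaw 0) (fun w => ‖signForm q s w‖ ^ 2) = 2 * S :=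
    prodMean_norm_signForm_sq hsymm hdiag s
  have fourth := prodMean_norm_signForm_pow_four_le hsymm hdiag s
  have S_nonneg : 0 ≤ S := Finset.sum_nonneg fun a _ => Finset.sum_nonneg fun b _ => by positivity
  set P := prodMean (signLaw 0) ({w | S ≤ ‖signForm q s w‖ ^ 2}.indicator 1)
  rcases S_nonneg.eq_or_lt with S_zero | S_pos
  · have event_univ : {w | S ≤ ‖signForm q s w‖ ^ 2} = Set.univ :=
      Set.eq_univ_of_forall fun w => S_zero.ge.trans (sq_nonneg ‖signForm q s w‖)
    have : P = 1 := by
      simp only [P, event_univ, Set.indicator_univ]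
      exact prodMean_const (sum_signLaw 0) 1
    linarith
  · have P_nonneg : 0 ≤ P := prodMean_nonneg (fun i => (signLaw_zero_mem_stdSimplex i).1)
      fun w => Set.indicator_nonneg (fun _ _ => zero_le_one) w
    have paley_zygmund : ((1 - 1 / 2) * (2 * S)) ^ 2 ≤
        prodMean (signLaw 0) (fun w => ‖signForm q s w‖ ^ 4) * P := by
      have h := paley_zygmund_prodMean (f := fun w => ‖signForm q s w‖ ^ 2) (θ := 1 / 2)
        (signLaw_zero_mem_stdSimplex (ι := ι)) (by rw [second]; positivity)
        ⟨by norm_num, by norm_num⟩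
      simpa only [second, ← pow_mul, one_div, inv_mul_cancel_left₀ (two_ne_zero' ℝ)] using h
    rw [second] at fourth
    have mass : S ^ 2 * 1 ≤ S ^ 2 * (108 * P) := by
      nlinarith [mul_le_mul_of_nonneg_right fourth P_nonneg]
    linarith [le_of_mul_le_mul_left mass (by positivity)]

end SignForms

/-! ### Random bases -/

section Phases

variable {ι : Type*}

/-- The random phase `(±1 ± i) / √2` attached to `j`, with the signs read off at `inl j` and
`inr j`. -/
noncomputable def phase (w : ι ⊕ ι → Bool) (j : ι) : ℂ :=
  (signs w (.inl j) + signs w (.inr j) * Complex.I) / (√2 : ℝ)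

lemma conj_phase_mul_phase (w : ι ⊕ ι → Bool) (j k : ι) :
    conj (phase w j) * phase w k =
      (((signs w (.inl j) * signs w (.inl k) + signs w (.inr j) * signs w (.inr k)) / 2 : ℝ) : ℂ) +
      (((signs w (.inl j) * signs w (.inr k) - signs w (.inr j) * signs w (.inl k)) / 2 : ℝ) : ℂ) *
        Complex.I := by
  have sqrt_two : ((√2 : ℝ) : ℂ) * ((√2 : ℝ) : ℂ) = 2 := by
    rw [← Complex.ofReal_mul, Real.mul_self_sqrt zero_le_two, Complex.ofReal_ofNat]
  simp only [phase, map_div₀, map_add, map_mul, Complex.conj_ofReal, Complex.conj_I]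
  rw [div_mul_div_comm, sqrt_two]
  push_cast
  ring_nf
  rw [Complex.I_sq]
  ring

lemma conj_phase_mul_self (w : ι ⊕ ι → Bool) (j : ι) : conj (phase w j) * phase w j = 1 := by
  rw [conj_phase_mul_phase, ← sq, ← sq, signs_sq, signs_sq]
  push_cast
  ring

/-- Half of the real matrix of the complex matrix `c`: the coefficients, in the signs, of the
quadratic form `Re ∑ c j k * conj (phase j) * phase k`. -/
noncomputable def realify (c : Matrix ι ι ℂ) : Matrix (ι ⊕ ι) (ι ⊕ ι) ℝ :=
  (1 / 2 : ℝ) • fromBlocks (c.map Complex.re) (-c.map Complex.im) (c.map Complex.im)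
    (c.map Complex.re)

lemma realify_isSymm {c : Matrix ι ι ℂ} (hc : c.IsHermitian) : (realify c).IsSymm := by
  have re_symm : (c.map Complex.re)ᵀ = c.map Complex.re := by
    ext j k
    simp [← hc.apply j k]
  have im_antisymm : (c.map Complex.im)ᵀ = -c.map Complex.im := by
    ext j k
    simp [← hc.apply j k]
  rw [IsSymm, realify, transpose_smul, fromBlocks_transpose, re_symm, transpose_neg, im_antisymm,
    neg_neg]

lemma realify_diag {c : Matrix ι ι ℂ} (hc : ∀ j, c j j = 0) (a : ι ⊕ ι) : realify c a a = 0 := by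
  cases a <;> simp [realify, hc]

variable [Fintype ι]

lemma signForm_realify (c : Matrix ι ι ℂ) (w : ι ⊕ ι → Bool) :
    signForm (realify c) Finset.univ w =
      ∑ j, ∑ k, (c j k * (conj (phase w j) * phase w k)).re := by
  simp only [signForm, Fintype.sum_sum_type, realify, Matrix.smul_apply, fromBlocks_apply₁₁,
    fromBlocks_apply₁₂, fromBlocks_apply₂₁, fromBlocks_apply₂₂, map_apply, Matrix.neg_apply,
    smul_eq_mul, ← Finset.sum_add_distrib]
  refine Finset.sum_congr rfl fun j _ => Finset.sum_congr rfl fun k _ => ?_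
  rw [conj_phase_mul_phase, Complex.mul_re]
  simp
  ring

lemma sum_realify_sq (c : Matrix ι ι ℂ) :
    ∑ a, ∑ b, realify c a b ^ 2 = (∑ j, ∑ k, ‖c j k‖ ^ 2) / 2 := by
  simp only [Fintype.sum_sum_type, realify, Matrix.smul_apply, fromBlocks_apply₁₁,
    fromBlocks_apply₁₂, fromBlocks_apply₂₁, fromBlocks_apply₂₂, map_apply, Matrix.neg_apply,
    smul_eq_mul, ← Finset.sum_add_distrib, Finset.sum_div, Complex.sq_norm, Complex.normSq_apply]
  exact Finset.sum_congr rfl fun j _ => Finset.sum_congr rfl fun k _ => by ring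

lemma le_prodMean_indicator_sum_phase_form_sq [DecidableEq ι] {κ : Type*} [Fintype κ]
    {c : κ → Matrix ι ι ℂ} (hc : ∀ z, (c z).IsHermitian) (hdiag : ∀ z j, c z j j = 0) :
    1 / 108 ≤ prodMean (signLaw 0) ({w | (∑ z, ∑ j, ∑ k, ‖c z j k‖ ^ 2) / 2 ≤
      ∑ z, (∑ j, ∑ k, (c z j k * (conj (phase w j) * phase w k)).re) ^ 2}.indicator 1) := by
  set q : ι ⊕ ι → ι ⊕ ι → EuclideanSpace ℝ κ := fun a b => WithLp.toLp 2 fun z => realify (c z) a b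
  have q_symm (a b : ι ⊕ ι) : q a b = q b a := by
    simp only [q, (realify_isSymm (hc _)).apply a b]
  have q_diag (a : ι ⊕ ι) : q a a = 0 := by
    simp only [q, realify_diag (hdiag _)]
    rfl
  have sum_q : ∑ a, ∑ b, ‖q a b‖ ^ 2 = (∑ z, ∑ j, ∑ k, ‖c z j k‖ ^ 2) / 2 := by
    simp only [Finset.sum_div _ (fun z => ∑ j, ∑ k, ‖c z j k‖ ^ 2), ← sum_realify_sq,
      EuclideanSpace.norm_sq_eq, Real.norm_eq_abs, sq_abs, q]
    rw [Finset.sum_comm (s := (Finset.univ : Finset κ))]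
    exact Finset.sum_congr rfl fun _ _ => Finset.sum_comm
  have form_q (w : ι ⊕ ι → Bool) : ‖signForm q Finset.univ w‖ ^ 2 =
      ∑ z, (∑ j, ∑ k, (c z j k * (conj (phase w j) * phase w k)).re) ^ 2 := by
    simp only [← signForm_realify, EuclideanSpace.norm_sq_eq, Real.norm_eq_abs, sq_abs]
    simp [q, signForm]
  simpa only [sum_q, form_q] using le_prodMean_indicator_norm_signForm_sq q_symm q_diag Finset.univ

end Phases

section Bases

variable {d : ℕ}

/-- The measurement in the orthonormal basis formed by the columns of `U`. -/
noncomputable def basisPOVM (U : unitaryGroup (Fin d) ℂ) : POVM d d where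
  effect z := vecMulVec (U.1.col z) (star (U.1.col z))
  posSemidef z := posSemidef_vecMulVec_self_star _
  sum_eq_one := by
    rw [← Unitary.coe_mul_star_self U]
    ext i j
    simp [Matrix.sum_apply, vecMulVec_apply, mul_apply, star_apply]

lemma basisPOVM_prob (U : unitaryGroup (Fin d) ℂ) (ρ : Matrix (Fin d) (Fin d) ℂ) (z : Fin d) :
    (basisPOVM U).prob ρ z = ((U.1ᴴ * ρ * U.1) z z).re := by
  rw [POVM.prob, basisPOVM, mul_vecMulVec, trace_vecMulVec, dotProduct_comm, mul_assoc]
  rfl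

lemma basisPOVM_prob_maximallyMixed (U : unitaryGroup (Fin d) ℂ) (z : Fin d) :
    (basisPOVM U).prob (maximallyMixed d) z = 1 / d := by
  rw [basisPOVM_prob, maximallyMixed, mul_smul_comm, mul_one, smul_mul_assoc,
    ← star_eq_conjTranspose, Unitary.coe_star_mul_self U]
  simp

lemma basisPOVM_one_prob (ρ : Matrix (Fin d) (Fin d) ℂ) (z : Fin d) :
    (basisPOVM 1).prob ρ z = (ρ z z).re := by
  simp [basisPOVM_prob]

/-- The normalized discrete Fourier matrix. -/
noncomputable def fourierMatrix (d : ℕ) : Matrix (Fin d) (Fin d) ℂ :=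
  of fun j z => Complex.exp (2 * Real.pi * Complex.I / d) ^ (j * z : ℕ) / (√d : ℝ)

lemma norm_fourierMatrix_sq (j z : Fin d) : ‖fourierMatrix d j z‖ ^ 2 = 1 / d := by
  have hd : d ≠ 0 := by have := j.2; omega
  simp [fourierMatrix, (Complex.isPrimitiveRoot_exp d hd).norm'_eq_one hd]

lemma fourierMatrix_mem_unitaryGroup : fourierMatrix d ∈ unitaryGroup (Fin d) ℂ := by
  rw [mem_unitaryGroup_iff]
  ext j k
  have hd : d ≠ 0 := by have := j.2; omega
  have primitive := Complex.isPrimitiveRoot_exp d hd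
  set ω := Complex.exp (2 * Real.pi * Complex.I / d)
  have conj_pow_mul_pow (n : ℕ) : conj (ω ^ n) * ω ^ n = 1 := by
    rw [mul_comm, Complex.mul_conj', norm_pow, primitive.norm'_eq_one hd]
    simp
  set r := ω ^ (j : ℕ) * conj (ω ^ (k : ℕ)) with hr
  have r_mul : r * ω ^ (k : ℕ) = ω ^ (j : ℕ) := by
    rw [hr, mul_assoc, conj_pow_mul_pow, mul_one]
  have r_pow : r ^ d = 1 := by
    rw [hr, mul_pow, ← map_pow, pow_right_comm, pow_right_comm ω k, primitive.pow_eq_one]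
    simp
  have entry : (fourierMatrix d * star (fourierMatrix d)) j k = (∑ z : Fin d, r ^ (z : ℕ)) / d := by
    simp only [mul_apply, star_apply, fourierMatrix, of_apply, Finset.sum_div]
    refine Finset.sum_congr rfl fun z _ => ?_
    rw [star_div₀, div_mul_div_comm, hr, mul_pow, ← map_pow, ← pow_mul, ← pow_mul,
      Complex.star_def, Complex.conj_ofReal, ← Complex.ofReal_mul, Real.mul_self_sqrt d.cast_nonneg,
      Complex.ofReal_natCast]
  rw [entry, Fin.sum_univ_eq_sum_range (r ^ ·)]
  by_cases hjk : j = k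
  · have r_eq_one : r = 1 := by rw [hr, hjk, mul_comm, conj_pow_mul_pow]
    subst hjk
    simp [r_eq_one, hd]
  · have r_ne_one : r ≠ 1 := fun h => hjk <| Fin.ext <| primitive.pow_inj j.2 k.2 <| by
      rw [← r_mul, h, one_mul]
    rw [geom_sum_eq r_ne_one, r_pow, sub_self, zero_div, zero_div, one_apply_ne hjk]

end Bases

/-! ### Distance from uniform -/

section OffDiagonal

variable {d : ℕ}

/-- The matrix with the diagonal of `ρ` replaced by zeros. -/
noncomputable def offDiag (ρ : Matrix (Fin d) (Fin d) ℂ) : Matrix (Fin d) (Fin d) ℂ :=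
  ρ - diagonal ρ.diag

lemma offDiag_diag (ρ : Matrix (Fin d) (Fin d) ℂ) (j : Fin d) : offDiag ρ j j = 0 := by
  simp [offDiag]

lemma re_trace_conjTranspose_mul_self {m n : Type*} [Fintype m] [Fintype n] (A : Matrix m n ℂ) :
    (Aᴴ * A).trace.re = ∑ i, ∑ j, ‖A i j‖ ^ 2 := by
  rw [Finset.sum_comm]
  simp [trace, mul_apply, ← Complex.normSq_eq_norm_sq, Complex.normSq_apply]

lemma re_trace_sub_maximallyMixed_sq {ρ : Matrix (Fin d) (Fin d) ℂ} (hρ : ρ.IsHermitian) :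
    ((ρ - maximallyMixed d)ᴴ * (ρ - maximallyMixed d)).trace.re =
      ∑ j, ((ρ j j).re - 1 / d) ^ 2 + ∑ j, ∑ k, ‖offDiag ρ j k‖ ^ 2 := by
  rw [re_trace_conjTranspose_mul_self, ← Finset.sum_add_distrib]
  refine Finset.sum_congr rfl fun j _ => ?_
  have diag_entry : ((ρ j j).re - 1 / d) ^ 2 = ‖(ρ - maximallyMixed d) j j‖ ^ 2 := by
    have : (ρ - maximallyMixed d) j j = (((ρ j j).re - 1 / d : ℝ) : ℂ) := by
      have diag_real : ((ρ j j).re : ℂ) = ρ j j := hρ.coe_re_apply_self j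
      simp [maximallyMixed, diag_real]
    rw [this, Complex.norm_real, Real.norm_eq_abs, sq_abs]
  have offDiag_entry {k : Fin d} (hk : k ≠ j) : offDiag ρ j k = (ρ - maximallyMixed d) j k := by
    simp [offDiag, maximallyMixed, diagonal_apply_ne _ hk.symm, one_apply_ne hk.symm]
  rw [diag_entry, ← Finset.add_sum_erase _ _ (Finset.mem_univ j),
    ← Finset.add_sum_erase _ _ (Finset.mem_univ j), offDiag_diag, norm_zero, zero_pow two_ne_zero,
    zero_add]
  congr 1
  exact Finset.sum_congr rfl fun k hk => by rw [offDiag_entry (Finset.ne_of_mem_erase hk)]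

end OffDiagonal

section RandomBasis

variable {d : ℕ}

/-- The diagonal unitary matrix of random phases. -/
noncomputable def phaseUnitary (w : Fin d ⊕ Fin d → Bool) : unitaryGroup (Fin d) ℂ :=
  ⟨diagonal (phase w), by
    rw [mem_unitaryGroup_iff', star_eq_conjTranspose, diagonal_conjTranspose, diagonal_mul_diagonal]
    exact (congrArg diagonal (funext (conj_phase_mul_self w))).trans diagonal_one⟩

/-- The standard basis or, with equal probability, a Fourier basis with random phases: the first
sees the diagonal of a state and the second the rest of it. -/
noncomputable def randomBasis : Bool × (Fin d ⊕ Fin d → Bool) → unitaryGroup (Fin d) ℂ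
  | (true, _) => 1
  | (false, w) => phaseUnitary w * ⟨fourierMatrix d, fourierMatrix_mem_unitaryGroup⟩

/-- The coefficients of the outcome `z` of the Fourier basis as a quadratic form in the phases. -/
noncomputable def fourierForm (ρ : Matrix (Fin d) (Fin d) ℂ) (z : Fin d) :
    Matrix (Fin d) (Fin d) ℂ :=
  of fun j k => conj (fourierMatrix d j z) * offDiag ρ j k * fourierMatrix d k z

lemma fourierForm_isHermitian {ρ : Matrix (Fin d) (Fin d) ℂ} (hρ : ρ.IsHermitian) (z : Fin d) :
    (fourierForm ρ z).IsHermitian := by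
  have offDiag_herm : (offDiag ρ).IsHermitian := by
    refine hρ.sub (isHermitian_diagonal_of_self_adjoint _ ?_)
    exact funext fun j => hρ.apply j j
  ext j k
  have := offDiag_herm.apply j k
  simp only [fourierForm, conjTranspose_apply, of_apply, ← this, star_mul', Complex.star_def,
    Complex.conj_conj]
  ring

lemma fourierForm_diag (ρ : Matrix (Fin d) (Fin d) ℂ) (z j : Fin d) : fourierForm ρ z j j = 0 := by
  simp [fourierForm, offDiag_diag]

lemma sum_norm_fourierForm_sq (ρ : Matrix (Fin d) (Fin d) ℂ) :
    ∑ z, ∑ j, ∑ k, ‖fourierForm ρ z j k‖ ^ 2 = (∑ j, ∑ k, ‖offDiag ρ j k‖ ^ 2) / d := by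
  have entry (z j k : Fin d) : ‖fourierForm ρ z j k‖ ^ 2 = ‖offDiag ρ j k‖ ^ 2 / d / d := by
    simp only [fourierForm, of_apply, norm_mul, mul_pow, RCLike.norm_conj, norm_fourierMatrix_sq]
    ring
  simp only [entry, ← Finset.sum_div, Finset.sum_const, Finset.card_univ, Fintype.card_fin,
    nsmul_eq_mul]
  rcases eq_or_ne (d : ℝ) 0 with hd | hd
  · simp [hd]
  · field_simp

lemma basisPOVM_randomBasis_prob_sub {ρ : Matrix (Fin d) (Fin d) ℂ} (hρ : ρ.trace = 1)
    (w : Fin d ⊕ Fin d → Bool) (z : Fin d) :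
    (basisPOVM (randomBasis (false, w))).prob ρ z - 1 / d =
      ∑ j, ∑ k, (fourierForm ρ z j k * (conj (phase w j) * phase w k)).re := by
  set U := (randomBasis (false, w)).1
  have U_apply (j : Fin d) : U j z = phase w j * fourierMatrix d j z :=
    (diagonal_mul _ _ j z : (diagonal (phase w) * fourierMatrix d) j z = _)
  have form_apply (A : Matrix (Fin d) (Fin d) ℂ) :
      (Uᴴ * A * U) z z = ∑ j, ∑ k, conj (U j z) * A j k * U k z := by
    rw [Finset.sum_comm]
    simp only [mul_apply, conjTranspose_apply, Finset.sum_mul, Complex.star_def]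
  have diag_part : ((Uᴴ * diagonal ρ.diag * U) z z).re = 1 / d := by
    have entry (j : Fin d) : conj (U j z) * ρ j j * U j z = ρ j j * (1 / d) := by
      have norm_U : conj (U j z) * U j z = 1 / d := by
        rw [U_apply, map_mul, mul_mul_mul_comm, conj_phase_mul_self, one_mul, Complex.conj_mul',
          ← Complex.ofReal_pow, norm_fourierMatrix_sq, Complex.ofReal_div, Complex.ofReal_one,
          Complex.ofReal_natCast]
      rw [mul_right_comm, norm_U, mul_comm]
    simp only [form_apply, diagonal_apply, mul_ite, ite_mul, mul_zero, zero_mul,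
      Finset.sum_ite_eq, Finset.mem_univ, if_true, diag_apply, entry, ← Finset.sum_mul]
    change (ρ.trace * (1 / d)).re = 1 / d
    simp [hρ]
  have offDiag_part : (Uᴴ * offDiag ρ * U) z z =
      ∑ j, ∑ k, fourierForm ρ z j k * (conj (phase w j) * phase w k) := by
    simp only [form_apply, U_apply, fourierForm, of_apply, map_mul]
    exact Finset.sum_congr rfl fun j _ => Finset.sum_congr rfl fun k _ => by ring
  have decomposition : Uᴴ * ρ * U = Uᴴ * diagonal ρ.diag * U + Uᴴ * offDiag ρ * U := by
    rw [← Matrix.add_mul, ← Matrix.mul_add, offDiag, add_sub_cancel]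
  rw [basisPOVM_prob, decomposition, Matrix.add_apply, Complex.add_re, diag_part, offDiag_part,
    add_sub_cancel_left]
  simp only [Complex.re_sum]

end RandomBasis

section UniformDistance

/-- The squared `ℓ²` distance of `p` to the uniform distribution. -/
noncomputable def uniformDistSq {α : Type*} [Fintype α] (p : α → ℝ) : ℝ :=
  ∑ x, (p x - (Fintype.card α : ℝ)⁻¹) ^ 2

variable {d : ℕ} {ρ : Matrix (Fin d) (Fin d) ℂ}

lemma uniformDistSq_standardBasis (w : Fin d ⊕ Fin d → Bool) :
    uniformDistSq ((basisPOVM (randomBasis (true, w))).prob ρ) = ∑ j, ((ρ j j).re - 1 / d) ^ 2 := by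
  simp only [uniformDistSq, randomBasis, basisPOVM_one_prob, Fintype.card_fin, one_div]

lemma le_prodMean_uniformDistSq_fourierBasis (hρ : IsState ρ) :
    1 / 108 ≤ prodMean (signLaw 0) ({w | (∑ j, ∑ k, ‖offDiag ρ j k‖ ^ 2) / d / 2 ≤
      uniformDistSq ((basisPOVM (randomBasis (false, w))).prob ρ)}.indicator 1) := by
  have := le_prodMean_indicator_sum_phase_form_sq
    (fourierForm_isHermitian hρ.posSemidef.isHermitian) (fourierForm_diag ρ)
  simpa only [sum_norm_fourierForm_sq, ← basisPOVM_randomBasis_prob_sub hρ.trace_eq_one,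
    uniformDistSq, Fintype.card_fin, one_div] using this

lemma prodMean_signLaw_zero_eq_expect {ι : Type*} [Fintype ι] [DecidableEq ι]
    (f : (ι → Bool) → ℝ) : prodMean (signLaw 0) f = 𝔼 w, f w := by
  rw [prodMean_signLaw_zero, Fintype.expect_eq_sum_div_card, Fintype.card_fun, Fintype.card_bool,
    div_eq_inv_mul, Nat.cast_pow, Nat.cast_ofNat]

lemma diag_far_or_offDiag_far {ε : ℝ} (hε : 0 ≤ ε) (hρ : ρ.IsHermitian)
    (hfar : ε < traceNorm (ρ - maximallyMixed d)) :
    ε ^ 2 / (2 * d) ≤ ∑ j, ((ρ j j).re - 1 / d) ^ 2 ∨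
      ε ^ 2 / (2 * d) ≤ ∑ j, ∑ k, ‖offDiag ρ j k‖ ^ 2 := by
  have frobenius_far : ε ^ 2 / d ≤
      ∑ j, ((ρ j j).re - 1 / d) ^ 2 + ∑ j, ∑ k, ‖offDiag ρ j k‖ ^ 2 := by
    rw [← re_trace_sub_maximallyMixed_sq hρ]
    refine div_le_of_le_mul₀ d.cast_nonneg ?_ ?_
    · rw [re_trace_conjTranspose_mul_self]
      positivity
    · exact ((pow_le_pow_left₀ hε hfar.le 2).trans (traceNorm_sq_le _)).trans_eq (mul_comm _ _)
  have halves : ε ^ 2 / d = ε ^ 2 / (2 * d) + ε ^ 2 / (2 * d) := by ring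
  by_contra! h
  linarith

lemma le_expect_uniformDistSq {ε : ℝ} (hε : 0 ≤ ε) (hρ : IsState ρ)
    (hfar : ε < traceNorm (ρ - maximallyMixed d)) :
    1 / 216 ≤ 𝔼 i, {i | ε ^ 2 / (4 * d ^ 2) ≤
      uniformDistSq ((basisPOVM (randomBasis i)).prob ρ)}.indicator (1 : (Bool × _) → ℝ) i := by
  set far := {i | ε ^ 2 / (4 * d ^ 2) ≤ uniformDistSq ((basisPOVM (randomBasis i)).prob ρ)}
  have split : 𝔼 i, far.indicator (1 : (Bool × _) → ℝ) i =
      (𝔼 w, far.indicator 1 (true, w) + 𝔼 w, far.indicator 1 (false, w)) / 2 := by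
    rw [← Finset.univ_product_univ, Finset.expect_product, Fintype.expect_eq_sum_div_card]
    simp
  have nonneg (b : Bool) : 0 ≤ 𝔼 w, far.indicator (1 : (Bool × _) → ℝ) (b, w) :=
    Finset.expect_nonneg fun w _ => Set.indicator_nonneg (fun _ _ => zero_le_one) _
  have hd : 1 ≤ (d : ℝ) := by
    rcases Nat.eq_zero_or_pos d with rfl | hd
    · simpa using hρ.trace_eq_one
    · exact_mod_cast hd
  rcases diag_far_or_offDiag_far hε hρ.posSemidef.isHermitian hfar with diag_far | offDiag_far
  · have mem (w) : (true, w) ∈ far := by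
      refine le_trans ?_ (diag_far.trans_eq (uniformDistSq_standardBasis w).symm)
      gcongr
      · norm_num
      · exact le_self_pow₀ hd two_ne_zero
    have : 𝔼 w, far.indicator (1 : (Bool × _) → ℝ) (true, w) = 1 := by
      simp [mem]
    linarith [nonneg false]
  · have subset : {w | (∑ j, ∑ k, ‖offDiag ρ j k‖ ^ 2) / d / 2 ≤
        uniformDistSq ((basisPOVM (randomBasis (false, w))).prob ρ)} ⊆ Prod.mk false ⁻¹' far := by
      intro w hw
      simp only [far, Set.mem_preimage, Set.mem_ofPred_eq] at hw ⊢
      refine le_trans ?_ hw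
      calc ε ^ 2 / (4 * d ^ 2) = ε ^ 2 / (2 * d) / d / 2 := by ring
        _ ≤ (∑ j, ∑ k, ‖offDiag ρ j k‖ ^ 2) / d / 2 := by gcongr
    have : 1 / 108 ≤ 𝔼 w, far.indicator (1 : (Bool × _) → ℝ) (false, w) := by
      rw [← prodMean_signLaw_zero_eq_expect]
      exact (le_prodMean_uniformDistSq_fourierBasis hρ).trans <|
        prodMean_mono (fun a => (signLaw_zero_mem_stdSimplex a).1)
          (Set.indicator_le_indicator_of_subset subset fun _ => zero_le_one)
    linarith [nonneg true]

end UniformDistance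

/-! ### Collision statistics -/

section TwoSamples

variable {ι κ α β : Type*} [Fintype ι] [Fintype κ] [Fintype α] [Fintype β] [DecidableEq ι]
  [DecidableEq κ] {p : α → ℝ} {q : β → ℝ}

lemma prodMean_sum_apply (hp : ∑ x, p x = 1) (g : α → ℝ) :
    prodMean (fun _ : ι => p) (fun w => ∑ i, g (w i)) = Fintype.card ι * ∑ x, p x * g x := by
  rw [prodMean_sum, Finset.sum_congr rfl fun i _ => prodMean_apply (fun _ => hp) i g]
  simp

lemma prodMean_sum_apply_sq_le (hp : p ∈ stdSimplex ℝ α) (g : α → ℝ) :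
    prodMean (fun _ : ι => p) (fun w => (∑ i, g (w i)) ^ 2) ≤
      Fintype.card ι * ∑ x, p x * g x ^ 2 + (Fintype.card ι * ∑ x, p x * g x) ^ 2 := by
  set N := (Fintype.card ι : ℝ)
  set μ := ∑ x, p x * g x
  have centred_mean : ∑ x, p x • (g x - μ) = 0 := by
    simp only [smul_eq_mul, mul_sub, Finset.sum_sub_distrib, ← Finset.sum_mul, hp.2, one_mul, μ,
      sub_self]
  have decomposition (w : ι → α) : (∑ i, g (w i)) ^ 2 =
      ‖∑ i, (g (w i) - μ)‖ ^ 2 + (2 * N * μ * ∑ i, g (w i) - (N * μ) ^ 2) := by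
    simp only [Real.norm_eq_abs, sq_abs, Finset.sum_sub_distrib, Finset.sum_const,
      Finset.card_univ, nsmul_eq_mul, N]
    ring
  have variance : ∑ x, p x * ‖g x - μ‖ ^ 2 = ∑ x, p x * g x ^ 2 - μ ^ 2 := by
    have expand (x : α) : p x * ‖g x - μ‖ ^ 2 = p x * g x ^ 2 - 2 * μ * (p x * g x) +
        p x * μ ^ 2 := by
      rw [Real.norm_eq_abs, sq_abs]
      ring
    simp only [expand, Finset.sum_add_distrib, Finset.sum_sub_distrib, ← Finset.mul_sum,
      ← Finset.sum_mul, hp.2]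
    ring
  simp only [decomposition]
  rw [prodMean_add, prodMean_sub, prodMean_const_mul, prodMean_const fun _ => hp.2,
    prodMean_norm_sum_sq (v := fun _ x => g x - μ) (fun _ => hp.2) (fun _ => centred_mean),
    prodMean_sum_apply hp.2, variance]
  simp only [Finset.sum_const, Finset.card_univ, nsmul_eq_mul]
  nlinarith [mul_nonneg (Nat.cast_nonneg' (α := ℝ) (Fintype.card ι)) (sq_nonneg μ)]

/-- The mean of `f a b` over a sample `a` from `p` and an independent sample `b` from `q`. -/
noncomputable def twoSampleMean (p : α → ℝ) (q : β → ℝ) (f : (ι → α) → (κ → β) → ℝ) : ℝ :=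
  prodMean (fun _ => p) fun a => prodMean (fun _ => q) (f a)

lemma twoSampleMean_mono (hp : p ∈ stdSimplex ℝ α) (hq : q ∈ stdSimplex ℝ β)
    {f g : (ι → α) → (κ → β) → ℝ} (h : ∀ a b, f a b ≤ g a b) :
    twoSampleMean p q f ≤ twoSampleMean p q g :=
  prodMean_mono (fun _ => hp.1) fun a => prodMean_mono (fun _ => hq.1) (h a)

lemma twoSampleMean_sum (hp : ∑ x, p x = 1) (hq : ∑ y, q y = 1) (K : α → β → ℝ) :
    twoSampleMean p q (fun (a : ι → α) (b : κ → β) => ∑ j, ∑ i, K (a i) (b j)) =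
      Fintype.card κ * (Fintype.card ι * ∑ x, p x * ∑ y, q y * K x y) := by
  have inner_mean (a : ι → α) : prodMean (fun _ : κ => q) (fun b => ∑ j, ∑ i, K (a i) (b j)) =
      Fintype.card κ * ∑ i, ∑ y, q y * K (a i) y := by
    rw [prodMean_sum_apply hq fun y => ∑ i, K (a i) y, Finset.sum_comm]
    simp only [Finset.mul_sum]
  simp only [twoSampleMean, inner_mean]
  rw [prodMean_const_mul, prodMean_sum_apply hp fun x => ∑ y, q y * K x y]

lemma twoSampleMean_sum_sq_le (hp : p ∈ stdSimplex ℝ α) (hq : q ∈ stdSimplex ℝ β)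
    (K : α → β → ℝ) :
    twoSampleMean p q (fun (a : ι → α) (b : κ → β) => (∑ j, ∑ i, K (a i) (b j)) ^ 2) ≤
      Fintype.card ι * Fintype.card κ * ∑ y, q y * ∑ x, p x * K x y ^ 2 +
      Fintype.card ι ^ 2 * Fintype.card κ * ∑ y, q y * (∑ x, p x * K x y) ^ 2 +
      Fintype.card ι * Fintype.card κ ^ 2 * ∑ x, p x * (∑ y, q y * K x y) ^ 2 +
      (Fintype.card κ * (Fintype.card ι * ∑ x, p x * ∑ y, q y * K x y)) ^ 2 := by
  set M := (Fintype.card ι : ℝ)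
  set N := (Fintype.card κ : ℝ)
  have row_sum (a : ι → α) : ∑ y, q y * ∑ i, K (a i) y = ∑ i, ∑ y, q y * K (a i) y := by
    rw [Finset.sum_comm]
    simp only [Finset.mul_sum]
  have expand (y : β) : q y * (M * ∑ x, p x * K x y ^ 2 + (M * ∑ x, p x * K x y) ^ 2) =
      M * (q y * ∑ x, p x * K x y ^ 2) + M ^ 2 * (q y * (∑ x, p x * K x y) ^ 2) := by
    ring
  calc _ ≤ prodMean (fun _ => p) (fun a : ι → α => N * ∑ y, q y * (∑ i, K (a i) y) ^ 2 +
          N ^ 2 * (∑ i, ∑ y, q y * K (a i) y) ^ 2) := by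
        refine prodMean_mono (fun _ => hp.1) fun a => ?_
        refine (prodMean_sum_apply_sq_le hq fun y => ∑ i, K (a i) y).trans_eq ?_
        rw [mul_pow, row_sum]
    _ = N * ∑ y, q y * prodMean (fun _ => p) (fun a : ι → α => (∑ i, K (a i) y) ^ 2) +
          N ^ 2 * prodMean (fun _ => p)
            (fun a : ι → α => (∑ i, ∑ y, q y * K (a i) y) ^ 2) := by
        rw [prodMean_add, prodMean_const_mul, prodMean_const_mul, prodMean_sum]
        simp only [prodMean_const_mul]
    _ ≤ N * ∑ y, q y * (M * ∑ x, p x * K x y ^ 2 + (M * ∑ x, p x * K x y) ^ 2) +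
          N ^ 2 * (M * ∑ x, p x * (∑ y, q y * K x y) ^ 2 +
            (M * ∑ x, p x * ∑ y, q y * K x y) ^ 2) := by
        refine add_le_add (mul_le_mul_of_nonneg_left (Finset.sum_le_sum fun y _ => ?_)
          (Nat.cast_nonneg (Fintype.card κ))) (mul_le_mul_of_nonneg_left ?_ (sq_nonneg N))
        · exact mul_le_mul_of_nonneg_left (prodMean_sum_apply_sq_le hp fun x => K x y) (hq.1 y)
        · exact prodMean_sum_apply_sq_le hp fun x => ∑ y, q y * K x y
    _ = _ := by
        simp only [expand, Finset.sum_add_distrib, ← Finset.mul_sum]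
        ring

end TwoSamples

section Collisions

variable {α : Type*} [Fintype α]

lemma uniformDistSq_nonneg (p : α → ℝ) : 0 ≤ uniformDistSq p :=
  Finset.sum_nonneg fun _ _ => sq_nonneg _

lemma sum_mul_sub_card_inv [Nonempty α] {p : α → ℝ} (hp : ∑ x, p x = 1) :
    ∑ x, p x * (p x - (Fintype.card α : ℝ)⁻¹) = uniformDistSq p := by
  have expand (x : α) : p x * (p x - (Fintype.card α : ℝ)⁻¹) =
      (p x - (Fintype.card α : ℝ)⁻¹) ^ 2 +
        (Fintype.card α : ℝ)⁻¹ * (p x - (Fintype.card α : ℝ)⁻¹) := by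
    ring
  simp only [expand, Finset.sum_add_distrib, ← Finset.mul_sum, Finset.sum_sub_distrib, hp,
    uniformDistSq]
  simp

lemma sum_mul_sub_card_inv_sq_le (p : α → ℝ) :
    ∑ x, p x * (p x - (Fintype.card α : ℝ)⁻¹) ^ 2 ≤
      uniformDistSq p * ((Fintype.card α : ℝ)⁻¹ + √(uniformDistSq p)) := by
  have sub_le (x : α) : p x - (Fintype.card α : ℝ)⁻¹ ≤ √(uniformDistSq p) :=
    Real.le_sqrt_of_sq_le (Finset.single_le_sum
      (f := fun x => (p x - (Fintype.card α : ℝ)⁻¹) ^ 2) (fun _ _ => sq_nonneg _)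
      (Finset.mem_univ x))
  nth_rw 1 [uniformDistSq]
  rw [Finset.sum_mul]
  refine Finset.sum_le_sum fun x _ => ?_
  rw [mul_comm]
  exact mul_le_mul_of_nonneg_left (by linarith [sub_le x]) (sq_nonneg _)

variable [DecidableEq α]

/-- The indicator of a collision, centred at the collision probability of uniform samples. -/
noncomputable def collisionKernel (x y : α) : ℝ := (if x = y then 1 else 0) - (Fintype.card α : ℝ)⁻¹

lemma sum_mul_collisionKernel_right {p : α → ℝ} (hp : ∑ x, p x = 1) (x : α) :
    ∑ y, p y * collisionKernel x y = p x - (Fintype.card α : ℝ)⁻¹ := by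
  simp [collisionKernel, mul_sub, Finset.sum_sub_distrib, ← Finset.sum_mul, hp]

lemma sum_mul_collisionKernel_left {p : α → ℝ} (hp : ∑ x, p x = 1) (y : α) :
    ∑ x, p x * collisionKernel x y = p y - (Fintype.card α : ℝ)⁻¹ := by
  simp [collisionKernel, mul_sub, Finset.sum_sub_distrib, ← Finset.sum_mul, hp]

lemma sum_sum_mul_collisionKernel_sq_le [Nonempty α] {p : α → ℝ} (hp : p ∈ stdSimplex ℝ α) :
    ∑ y, p y * ∑ x, p x * collisionKernel x y ^ 2 ≤ uniformDistSq p + (Fintype.card α : ℝ)⁻¹ := by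
  set c := (Fintype.card α : ℝ)⁻¹ with hc
  have kernel_sq (x y : α) : collisionKernel x y ^ 2 =
      (1 - 2 * c) * collisionKernel x y + (c - c ^ 2) := by
    rw [collisionKernel]
    split_ifs <;> ring
  have inner_sum (y : α) : ∑ x, p x * collisionKernel x y ^ 2 =
      (1 - 2 * c) * (p y - c) + (c - c ^ 2) := by
    simp only [kernel_sq, mul_add, mul_left_comm (p _), Finset.sum_add_distrib, ← Finset.mul_sum,
      ← Finset.sum_mul, sum_mul_collisionKernel_left hp.2, hp.2, one_mul, hc]
  have total : ∑ y, p y * ∑ x, p x * collisionKernel x y ^ 2 =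
      (1 - 2 * c) * uniformDistSq p + (c - c ^ 2) := by
    simp only [inner_sum, mul_add, mul_left_comm (p _), Finset.sum_add_distrib, ← Finset.mul_sum,
      ← Finset.sum_mul, sum_mul_sub_card_inv hp.2, hp.2, one_mul, hc]
  have c_nonneg : 0 ≤ c := by positivity
  nlinarith [mul_nonneg c_nonneg (uniformDistSq_nonneg p)]

/-- The centred number of collisions between two samples. -/
noncomputable def collisions {N : ℕ} (a b : Fin N → α) : ℝ := ∑ j, ∑ i, collisionKernel (a i) (b j)

lemma twoSampleMean_collisions [Nonempty α] {p : α → ℝ} (hp : ∑ x, p x = 1) (N : ℕ) :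
    twoSampleMean p p (collisions (N := N)) = N ^ 2 * uniformDistSq p := by
  refine (twoSampleMean_sum hp hp collisionKernel).trans ?_
  simp only [sum_mul_collisionKernel_right hp, sum_mul_sub_card_inv hp, Fintype.card_fin]
  ring

lemma twoSampleMean_collisions_sub_sq_le [Nonempty α] {p : α → ℝ} (hp : p ∈ stdSimplex ℝ α)
    (N : ℕ) :
    twoSampleMean p p (fun a b : Fin N → α => (collisions a b - N ^ 2 * uniformDistSq p) ^ 2) ≤
      N ^ 2 * (uniformDistSq p + (Fintype.card α : ℝ)⁻¹) +
      2 * N ^ 3 * (uniformDistSq p * ((Fintype.card α : ℝ)⁻¹ + √(uniformDistSq p))) := by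
  have mean := twoSampleMean_collisions hp.2 N
  have second_moment := twoSampleMean_sum_sq_le (ι := Fin N) (κ := Fin N) hp hp collisionKernel
  simp only [sum_mul_collisionKernel_right hp.2, sum_mul_collisionKernel_left hp.2,
    sum_mul_sub_card_inv hp.2, Fintype.card_fin] at second_moment
  have kernel_bound := mul_le_mul_of_nonneg_left (sum_sum_mul_collisionKernel_sq_le hp)
    (by positivity : (0 : ℝ) ≤ N ^ 2)
  have row_bound := mul_le_mul_of_nonneg_left (sum_mul_sub_card_inv_sq_le p)
    (by positivity : (0 : ℝ) ≤ 2 * N ^ 3)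
  set m := N ^ 2 * uniformDistSq p
  have expand (a b : Fin N → α) : (collisions a b - m) ^ 2 =
      collisions a b ^ 2 - (2 * m * collisions a b - m ^ 2) := by
    ring
  have variance : twoSampleMean p p (fun a b : Fin N → α => (collisions a b - m) ^ 2) =
      twoSampleMean p p (fun a b : Fin N → α => collisions a b ^ 2) - m ^ 2 := by
    rw [twoSampleMean] at mean
    simp only [expand, twoSampleMean, prodMean_sub, prodMean_const_mul,
      prodMean_const fun _ => hp.2, mean]
    ring
  rw [variance]
  simp only [collisions, m]
  linarith

end Collisions

/-! ### The tester -/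

section CollisionTest

lemma twoSampleMean_ite_le {ι κ α β : Type*} [Fintype ι] [Fintype κ] [Fintype α] [Fintype β]
    [DecidableEq ι] [DecidableEq κ] {p : α → ℝ} {q : β → ℝ} (hp : p ∈ stdSimplex ℝ α)
    (hq : q ∈ stdSimplex ℝ β) {P : (ι → α) → (κ → β) → Prop} [∀ a b, Decidable (P a b)]
    {f : (ι → α) → (κ → β) → ℝ} (hf : ∀ a b, 0 ≤ f a b) {s : ℝ} (hs : 0 < s)
    (h : ∀ a b, P a b → s ≤ f a b) :
    twoSampleMean p q (fun a b => if P a b then 1 else 0) ≤ twoSampleMean p q f / s := by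
  rw [le_div_iff₀ hs, mul_comm, twoSampleMean, ← prodMean_const_mul]
  simp only [← prodMean_const_mul]
  refine twoSampleMean_mono hp hq fun a b => ?_
  split_ifs with event
  · simpa using h a b event
  · simpa using hf a b

variable {α : Type*} [Fintype α] [DecidableEq α] {p : α → ℝ} {N : ℕ} {t τ : ℝ}

/-- The probability that the centred number of collisions between two samples of size `N` from `p`
is at most `t`. -/
noncomputable def acceptProb (p : α → ℝ) (N : ℕ) (t : ℝ) : ℝ :=
  twoSampleMean p p fun a b : Fin N → α => if collisions a b ≤ t then 1 else 0

lemma acceptProb_nonneg (hp : p ∈ stdSimplex ℝ α) : 0 ≤ acceptProb p N t :=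
  prodMean_nonneg (fun _ => hp.1) fun _ => prodMean_nonneg (fun _ => hp.1) fun _ =>
    ite_nonneg zero_le_one le_rfl

lemma one_sub_acceptProb (hp : ∑ x, p x = 1) :
    1 - acceptProb p N t =
      twoSampleMean p p fun a b : Fin N → α => if t < collisions a b then 1 else 0 := by
  have complement (a b : Fin N → α) : (if t < collisions a b then (1 : ℝ) else 0) =
      1 - if collisions a b ≤ t then 1 else 0 := by
    simp only [← not_lt, ite_not]
    split_ifs <;> norm_num
  simp only [acceptProb, twoSampleMean, complement, prodMean_sub, prodMean_const fun _ => hp]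

lemma acceptProb_le_one (hp : p ∈ stdSimplex ℝ α) : acceptProb p N t ≤ 1 := by
  rw [← sub_nonneg, one_sub_acceptProb hp.2]
  exact prodMean_nonneg (fun _ => hp.1) fun _ => prodMean_nonneg (fun _ => hp.1) fun _ =>
    ite_nonneg zero_le_one le_rfl

lemma le_acceptProb_of_uniformDistSq_eq_zero [Nonempty α] (hp : p ∈ stdSimplex ℝ α)
    (hX : uniformDistSq p = 0) (ht : 0 < t) :
    1 - N ^ 2 / (Fintype.card α * t ^ 2) ≤ acceptProb p N t := by
  have variance := twoSampleMean_collisions_sub_sq_le hp N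
  rw [hX] at variance
  simp only [mul_zero, zero_mul, sub_zero, zero_add, add_zero] at variance
  have chebyshev := twoSampleMean_ite_le hp hp (s := t ^ 2)
    (fun a b : Fin N → α => sq_nonneg (collisions a b)) (by positivity) fun a b (h : t < _) =>
      pow_le_pow_left₀ ht.le h.le 2
  rw [← one_sub_acceptProb hp.2] at chebyshev
  have bound := chebyshev.trans (div_le_div_of_nonneg_right variance (by positivity))
  rw [← div_eq_mul_inv, div_div] at bound
  linarith

lemma acceptProb_half_mean_le [Nonempty α] (hp : p ∈ stdSimplex ℝ α) (hτ : 0 < τ)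
    (hX : τ ≤ uniformDistSq p) (hN : 0 < N) :
    acceptProb p N (N ^ 2 * τ / 2) ≤
      4 * (1 / (N ^ 2 * τ) + 1 / (Fintype.card α * (N * τ) ^ 2) +
        2 / (Fintype.card α * (N * τ)) + 2 / (N * √τ)) := by
  have variance := twoSampleMean_collisions_sub_sq_le hp N
  set X := uniformDistSq p
  have X_pos : 0 < X := hτ.trans_le hX
  have sqrt_pos : 0 < √X := Real.sqrt_pos.2 X_pos
  have chebyshev : acceptProb p N (N ^ 2 * τ / 2) ≤
      twoSampleMean p p (fun a b : Fin N → α => (collisions a b - N ^ 2 * X) ^ 2) /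
        (N ^ 2 * X / 2) ^ 2 := by
    refine twoSampleMean_ite_le hp hp (fun _ _ => sq_nonneg _) (by positivity) fun a b h => ?_
    rw [← neg_sq (collisions a b - _), neg_sub]
    have threshold_le : (N : ℝ) ^ 2 * τ ≤ N ^ 2 * X := by gcongr
    exact pow_le_pow_left₀ (by positivity) (by linarith) 2
  calc acceptProb p N (N ^ 2 * τ / 2)
      ≤ (N ^ 2 * (X + (Fintype.card α : ℝ)⁻¹) +
          2 * N ^ 3 * (X * ((Fintype.card α : ℝ)⁻¹ + √X))) / (N ^ 2 * X / 2) ^ 2 :=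
        chebyshev.trans (div_le_div_of_nonneg_right variance (by positivity))
    _ = 4 * (1 / (N ^ 2 * X) + 1 / (Fintype.card α * (N * X) ^ 2) +
          2 / (Fintype.card α * (N * X)) + 2 / (N * √X)) := by
        have : 2 / ((N : ℝ) * √X) = 2 * √X / (N * X) := by
          rw [← Real.mul_self_sqrt X_pos.le, Real.sqrt_mul_self sqrt_pos.le]
          field_simp
        rw [this]
        field_simp
        ring
    _ ≤ _ := by gcongr

end CollisionTest

lemma prodMean_fin_succ {α : Type*} [Fintype α] {N : ℕ} (p : Fin (N + 1) → α → ℝ)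
    (f : (Fin (N + 1) → α) → ℝ) :
    prodMean p f = ∑ x, p 0 x * prodMean (fun i => p i.succ) fun w => f (Fin.cons x w) := by
  simp only [prodMean, ← (Fin.consEquiv fun _ => α).sum_comp, Fintype.sum_prod_type,
    Fin.consEquiv_apply, Fin.prod_univ_succ, Fin.cons_zero, Fin.cons_succ, Finset.mul_sum,
    mul_assoc]
  rfl

section Algorithms

variable {d n k : ℕ} {ρ : Matrix (Fin d) (Fin d) ℂ}

/-- The measurement that ignores the state and returns a uniformly random outcome. -/
noncomputable def uniformPOVM (d L : ℕ) [NeZero L] : POVM d L where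
  effect _ := (L : ℂ)⁻¹ • 1
  posSemidef _ := PosSemidef.one.smul (by simp)
  sum_eq_one := by
    rw [Finset.sum_const, Finset.card_univ, Fintype.card_fin, ← Nat.cast_smul_eq_nsmul ℂ,
      smul_inv_smul₀ (NeZero.ne (L : ℂ))]

lemma uniformPOVM_prob {L : ℕ} [NeZero L] (hρ : ρ.trace = 1) (z : Fin L) :
    (uniformPOVM d L).prob ρ z = (L : ℝ)⁻¹ := by
  rw [POVM.prob, uniformPOVM, mul_smul_comm, mul_one, trace_smul, hρ, smul_eq_mul, mul_one,
    ← Complex.ofReal_natCast, ← Complex.ofReal_inv, Complex.ofReal_re]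

/-- Spend one copy on a useless measurement to draw `i` uniformly at random, then run `A i`. -/
noncomputable def uniformChoice {ι : Type*} [Fintype ι] [Nonempty ι]
    (A : ι → IncoherentAlgorithm d n) : IncoherentAlgorithm d (n + 1) :=
  .measure (uniformPOVM d (Fintype.card ι)) fun z => A ((Fintype.equivFin ι).symm z)

lemma answerProb_uniformChoice {ι : Type*} [Fintype ι] [Nonempty ι]
    (A : ι → IncoherentAlgorithm d n) (hρ : ρ.trace = 1) (c : Answer) :
    (uniformChoice A).answerProb ρ c = 𝔼 i, (A i).answerProb ρ c := by
  simp only [uniformChoice, IncoherentAlgorithm.answerProb, uniformPOVM_prob hρ, ← Finset.mul_sum,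
    (Fintype.equivFin ι).symm.sum_comp fun i => (A i).answerProb ρ c,
    Fintype.expect_eq_sum_div_card, div_eq_inv_mul]

/-- The algorithm that always answers `c`, padded with useless measurements to the depth `n`. -/
noncomputable def constAlgorithm (d : ℕ) (c : Answer) : (n : ℕ) → IncoherentAlgorithm d n
  | 0 => .output c
  | n + 1 => uniformChoice fun _ : Unit => constAlgorithm d c n

lemma answerProb_constAlgorithm (hρ : ρ.trace = 1) (b c : Answer) (n : ℕ) :
    (constAlgorithm d b n).answerProb ρ c = if b = c then 1 else 0 := by
  induction n with
  | zero => rfl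
  | succ n ih => rw [constAlgorithm, answerProb_uniformChoice _ hρ, Fintype.expect_const, ih]

/-- Apply the same measurement `N` times and continue depending on the outcomes. -/
noncomputable def iterMeasure (M : POVM d k) :
    (N : ℕ) → ((Fin N → Fin k) → IncoherentAlgorithm d n) → IncoherentAlgorithm d (n + N)
  | 0, next => next Fin.elim0
  | N + 1, next => .measure M fun z => iterMeasure M N fun a => next (Fin.cons z a)

lemma answerProb_iterMeasure {N : ℕ} (M : POVM d k)
    (next : (Fin N → Fin k) → IncoherentAlgorithm d n) (c : Answer) :
    (iterMeasure M N next).answerProb ρ c =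
      prodMean (fun _ => M.prob ρ) fun a => (next a).answerProb ρ c := by
  induction N with
  | zero => simp [iterMeasure, prodMean, Subsingleton.elim default (Fin.elim0 : Fin 0 → Fin k)]
  | succ N ih => simp only [prodMean_fin_succ, iterMeasure, IncoherentAlgorithm.answerProb, ih]

/-- Take two samples of size `N` with the measurement `M`; answer `far` if their centred number of
collisions exceeds `t`, and continue with `A` otherwise. -/
noncomputable def collisionTest (M : POVM d k) (N : ℕ) (t : ℝ) (A : IncoherentAlgorithm d n) :
    IncoherentAlgorithm d (n + N + N) :=
  iterMeasure M N fun a => iterMeasure M N fun b =>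
    if collisions a b ≤ t then A else constAlgorithm d .far n

lemma answerProb_collisionTest (M : POVM d k) (N : ℕ) (t : ℝ) (A : IncoherentAlgorithm d n)
    (hρ : ρ.trace = 1) :
    (collisionTest M N t A).answerProb ρ .mixed =
      A.answerProb ρ .mixed * acceptProb (M.prob ρ) N t := by
  have leaf (a b : Fin N → Fin k) :
      (if collisions a b ≤ t then A else constAlgorithm d .far n).answerProb ρ .mixed =
        A.answerProb ρ .mixed * if collisions a b ≤ t then 1 else 0 := by
    split_ifs
    · rw [mul_one]
    · simp [answerProb_constAlgorithm hρ]
  simp only [collisionTest, answerProb_iterMeasure, leaf, prodMean_const_mul, acceptProb,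
    twoSampleMean]

lemma exists_answerProb_eq_expect_acceptProb_pow {ι : Type*} [Fintype ι] [Nonempty ι]
    (M : ι → POVM d k) (N : ℕ) (t : ℝ) (K : ℕ) :
    ∃ A : IncoherentAlgorithm d (K * (2 * N + 1)), ∀ ρ, IsState ρ →
      A.answerProb ρ .mixed = (𝔼 i, acceptProb ((M i).prob ρ) N t) ^ K := by
  induction K with
  | zero =>
    rw [zero_mul]
    exact ⟨.output .mixed, fun ρ _ => by simp [IncoherentAlgorithm.answerProb]⟩
  | succ K ih =>
    obtain ⟨A, hA⟩ := ih
    rw [show (K + 1) * (2 * N + 1) = K * (2 * N + 1) + N + N + 1 by ring]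
    refine ⟨uniformChoice fun i => collisionTest (M i) N t A, fun ρ hρ => ?_⟩
    simp only [answerProb_uniformChoice _ hρ.trace_eq_one,
      answerProb_collisionTest _ _ _ _ hρ.trace_eq_one, ← Finset.mul_expect, hA ρ hρ, pow_succ]

end Algorithms

/-! ### Upper bound -/

section SampleSize

variable {α : Type*} [Fintype α] [DecidableEq α] [Nonempty α] {p : α → ℝ} {N : ℕ} {τ : ℝ}

lemma acceptProb_half_mean_ge (hp : p ∈ stdSimplex ℝ α) (hX : uniformDistSq p = 0) (hτ : 0 < τ)
    (hN : 200 ≤ N * τ * √(Fintype.card α)) :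
    2591 / 2592 ≤ acceptProb p N (N ^ 2 * τ / 2) := by
  have N_pos : (0 : ℝ) < N := by
    by_contra! h
    nlinarith [mul_nonneg hτ.le (Real.sqrt_nonneg (Fintype.card α))]
  have failure_eq : (N : ℝ) ^ 2 / (Fintype.card α * (N ^ 2 * τ / 2) ^ 2) =
      4 / (N * τ * √(Fintype.card α)) ^ 2 := by
    rw [mul_pow _ (√_), Real.sq_sqrt (Nat.cast_nonneg _)]
    field_simp
    norm_num
  have failure_le : 4 / (N * τ * √(Fintype.card α)) ^ 2 ≤ 4 / 200 ^ 2 := by gcongr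
  have accept_ge := le_acceptProb_of_uniformDistSq_eq_zero (N := N) hp hX
    (show 0 < (N : ℝ) ^ 2 * τ / 2 by positivity)
  linarith

lemma acceptProb_half_mean_le_half (hp : p ∈ stdSimplex ℝ α) (hτ : 0 < τ)
    (hcard : Fintype.card α * τ ≤ 1) (hX : τ ≤ uniformDistSq p)
    (hN : 200 ≤ N * τ * √(Fintype.card α)) : acceptProb p N (N ^ 2 * τ / 2) ≤ 1 / 2 := by
  have N_pos : 0 < N := by
    rw [Nat.pos_iff_ne_zero]
    rintro rfl
    norm_num at hN
  refine (acceptProb_half_mean_le hp hτ hX N_pos).trans ?_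
  set k := (Fintype.card α : ℝ)
  have one_le_sqrt : 1 ≤ √k := Real.one_le_sqrt.2 (Nat.one_le_cast.2 Fintype.card_pos)
  have sqrt_sq : √k * √k = k := Real.mul_self_sqrt (Nat.cast_nonneg _)
  have sqrt_τ_sq : √τ * √τ = τ := Real.mul_self_sqrt hτ.le
  have N_sqrt_τ : 200 ≤ N * √τ := by
    have sqrt_mul_le : √τ * √k ≤ 1 := by
      rw [← Real.sqrt_mul hτ.le, mul_comm]
      exact Real.sqrt_le_one.2 hcard
    calc (200 : ℝ) ≤ N * √τ * (√τ * √k) := by linear_combination hN - N * √k * sqrt_τ_sq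
      _ ≤ N * √τ := mul_le_of_le_one_right (by positivity) sqrt_mul_le
  have inv_sq_mul_le : 1 / (N ^ 2 * τ) ≤ 1 / 200 ^ 2 := by
    rw [show N ^ 2 * τ = (N * √τ) ^ 2 by linear_combination -(N : ℝ) ^ 2 * sqrt_τ_sq]
    gcongr
  have inv_card_mul_sq_le : 1 / (k * (N * τ) ^ 2) ≤ 1 / 200 ^ 2 := by
    rw [show k * (N * τ) ^ 2 = (N * τ * √k) ^ 2 by linear_combination -(N * τ) ^ 2 * sqrt_sq]
    gcongr
  have two_div_card_mul_le : 2 / (k * (N * τ)) ≤ 2 / 200 := by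
    gcongr
    calc (200 : ℝ) ≤ N * τ * √k * √k :=
          hN.trans (le_mul_of_one_le_right (by positivity) one_le_sqrt)
      _ = k * (N * τ) := by linear_combination N * τ * sqrt_sq
  have two_div_sqrt_le : 2 / (N * √τ) ≤ 2 / 200 := by gcongr
  linarith

lemma exists_sampleSize {d : ℕ} (hd : 0 < d) {ε : ℝ} (hε : 0 < ε) (hε' : ε ≤ 1) :
    ∃ N : ℕ, 200 ≤ N * (ε ^ 2 / (4 * d ^ 2)) * √d ∧
      (864 * (2 * N + 1) : ℕ) * ε ^ 2 ≤ 10 ^ 7 * √d ^ 3 := by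
  have sqrt_ge : 1 ≤ √(d : ℝ) := Real.one_le_sqrt.2 (Nat.one_le_cast.2 hd)
  have cube_ge : 1 ≤ √(d : ℝ) ^ 3 := one_le_pow₀ sqrt_ge
  have ε_sq_le : ε ^ 2 ≤ 1 := pow_le_one₀ hε.le hε'
  refine ⟨⌈800 * √(d : ℝ) ^ 3 / ε ^ 2⌉₊, ?_, ?_⟩
  · have ge := (div_le_iff₀ (by positivity)).1 (Nat.le_ceil (800 * √(d : ℝ) ^ 3 / ε ^ 2))
    have d_sq : (d : ℝ) ^ 2 = √d ^ 4 := by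
      rw [show 4 = 2 * 2 from rfl, pow_mul, Real.sq_sqrt (Nat.cast_nonneg d)]
    rw [d_sq, show ∀ x : ℝ, x * (ε ^ 2 / (4 * √d ^ 4)) * √d = x * ε ^ 2 / (4 * √d ^ 3) by
      intro x; field_simp, le_div_iff₀ (by positivity)]
    linarith
  · have lt := Nat.ceil_lt_add_one (show 0 ≤ 800 * √(d : ℝ) ^ 3 / ε ^ 2 by positivity)
    rw [div_add_one (by positivity), lt_div_iff₀ (by positivity)] at lt
    push_cast
    linarith

end SampleSize

section UpperBound

variable {d : ℕ} {ρ : Matrix (Fin d) (Fin d) ℂ}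

lemma maximallyMixed_isState (hd : 0 < d) : IsState (maximallyMixed d) where
  posSemidef := maximallyMixed_posSemidef
  trace_eq_one := by simp [maximallyMixed, hd.ne']

lemma prob_mem_stdSimplex {k : ℕ} (M : POVM d k) (hρ : IsState ρ) :
    M.prob ρ ∈ stdSimplex ℝ (Fin k) :=
  ⟨fun z => re_trace_mul_nonneg hρ.posSemidef (M.posSemidef z), sum_prob M hρ.trace_eq_one⟩

lemma uniformDistSq_basisPOVM_maximallyMixed (U : unitaryGroup (Fin d) ℂ) :
    uniformDistSq ((basisPOVM U).prob (maximallyMixed d)) = 0 := by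
  simp [uniformDistSq, basisPOVM_prob_maximallyMixed]

lemma expect_acceptProb_randomBasis_le (hd : 0 < d) {ε : ℝ} (hε : 0 < ε) (hε' : ε ≤ 1)
    (hρ : IsState ρ) (hfar : ε < traceNorm (ρ - maximallyMixed d)) {N : ℕ}
    (hN : 200 ≤ N * (ε ^ 2 / (4 * d ^ 2)) * √d) :
    𝔼 i, acceptProb ((basisPOVM (randomBasis i)).prob ρ) N (N ^ 2 * (ε ^ 2 / (4 * d ^ 2)) / 2) ≤
      1 - 1 / 432 := by
  have : Nonempty (Fin d) := Fin.pos_iff_nonempty.1 hd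
  set τ := ε ^ 2 / (4 * d ^ 2) with hτ
  have one_le_d : (1 : ℝ) ≤ d := Nat.one_le_cast.2 hd
  have card_mul_τ : d * τ ≤ 1 := by
    rw [hτ, mul_div_assoc', div_le_one (by positivity)]
    nlinarith [pow_le_one₀ hε.le hε' (n := 2)]
  set far := {i | τ ≤ uniformDistSq ((basisPOVM (randomBasis i)).prob ρ)}
  have accept_le (i) : acceptProb ((basisPOVM (randomBasis i)).prob ρ) N (N ^ 2 * τ / 2) ≤
      1 - 1 / 2 * far.indicator (1 : (Bool × (Fin d ⊕ Fin d → Bool)) → ℝ) i := by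
    have simplex := prob_mem_stdSimplex (basisPOVM (randomBasis i)) hρ
    by_cases hi : i ∈ far
    · simp only [hi, Set.indicator_of_mem, Pi.one_apply]
      refine (acceptProb_half_mean_le_half simplex (by positivity) ?_ hi ?_).trans (by norm_num)
      all_goals simpa only [Fintype.card_fin]
    · simpa [hi] using acceptProb_le_one simplex
  refine (Finset.expect_le_expect fun i _ => accept_le i).trans ?_
  rw [Finset.expect_sub_distrib, ← Finset.mul_expect, Fintype.expect_const]
  linarith [le_expect_uniformDistSq hε.le hρ hfar]

lemma two_thirds_le_pow {x : ℝ} (hx : 2591 / 2592 ≤ x) : 2 / 3 ≤ x ^ 864 := by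
  have bernoulli := one_add_mul_le_pow (show (-2 : ℝ) ≤ -(1 / 2592) by norm_num) 864
  calc (2 / 3 : ℝ) ≤ (1 + -(1 / 2592)) ^ 864 := le_trans (by norm_num) bernoulli
    _ ≤ x ^ 864 := pow_le_pow_left₀ (by norm_num) (by linarith) _

lemma pow_le_one_third {x : ℝ} (hx : 0 ≤ x) (hx' : x ≤ 1 - 1 / 432) : x ^ 864 ≤ 1 / 3 :=
  calc x ^ 864 ≤ Real.exp (-(1 / 432)) ^ 864 :=
        pow_le_pow_left₀ hx (hx'.trans (Real.one_sub_le_exp_neg _)) _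
    _ = (Real.exp 2)⁻¹ := by rw [← Real.exp_nat_mul, ← Real.exp_neg]; norm_num
    _ ≤ 3⁻¹ := inv_anti₀ (by norm_num) (by linarith [Real.add_one_le_exp 2])
    _ = 1 / 3 := by norm_num

theorem upper_bound (hd : 0 < d) {ε : ℝ} (hε : 0 < ε) (hε' : ε ≤ 1) :
    ∃ n : ℕ, n * ε ^ 2 ≤ 10 ^ 7 * √d ^ 3 ∧ ∃ A : IncoherentAlgorithm d n, A.TestsMixedness ε := by
  obtain ⟨N, N_ge, N_le⟩ := exists_sampleSize hd hε hε'
  obtain ⟨A, accept_eq⟩ := exists_answerProb_eq_expect_acceptProb_pow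
    (fun i : Bool × (Fin d ⊕ Fin d → Bool) => basisPOVM (randomBasis i)) N
    (N ^ 2 * (ε ^ 2 / (4 * d ^ 2)) / 2) 864
  refine ⟨_, N_le, A, ?_, fun ρ hρ hfar => ?_⟩
  · have : Nonempty (Fin d) := Fin.pos_iff_nonempty.1 hd
    have mixed := maximallyMixed_isState hd
    rw [accept_eq _ mixed]
    refine two_thirds_le_pow (Finset.le_expect Finset.univ_nonempty fun i _ => ?_)
    refine acceptProb_half_mean_ge (prob_mem_stdSimplex _ mixed)
      (uniformDistSq_basisPOVM_maximallyMixed _) (by positivity) ?_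
    rwa [Fintype.card_fin]
  · have accept_le := pow_le_one_third
      (Finset.expect_nonneg fun i _ => acceptProb_nonneg (prob_mem_stdSimplex _ hρ))
      (expect_acceptProb_randomBasis_le hd hε hε' hρ hfar N_ge)
    rw [← accept_eq ρ hρ] at accept_le
    linarith [answerProb_mixed_add_far A hρ.trace_eq_one]

end UpperBound

end MixednessTesting

theorem mainTheorem1 :
    ∃ c C : ℝ, 0 < c ∧ 0 < C ∧ ∃ d₀ : ℕ, ∀ d : ℕ, d₀ ≤ d → ∀ ε : ℝ, 0 < ε → ε ≤ 1 / 12 →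
      (∀ (n : ℕ) (A : MixednessTesting.IncoherentAlgorithm d n), A.TestsMixedness ε →
        c * ((d : ℝ) ^ (3 / 2 : ℝ) / ε ^ 2) ≤ (n : ℝ)) ∧
      (∃ n : ℕ, (n : ℝ) ≤ C * ((d : ℝ) ^ (3 / 2 : ℝ) / ε ^ 2) ∧
        ∃ A : MixednessTesting.IncoherentAlgorithm d n, A.TestsMixedness ε) := by
  refine ⟨1 / 10 ^ 8, 10 ^ 7, by norm_num, by norm_num, 1000, fun d hd ε hε hε' => ?_⟩
  have rpow_eq : (d : ℝ) ^ (3 / 2 : ℝ) = √d ^ 3 := by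
    rw [Real.sqrt_eq_rpow, ← Real.rpow_natCast, ← Real.rpow_mul d.cast_nonneg]
    norm_num
  rw [rpow_eq]
  refine ⟨fun n A hA => ?_, ?_⟩
  · rw [mul_div_assoc', div_le_iff₀ (by positivity)]
    exact MixednessTesting.lower_bound hd hε hε' hA
  · obtain ⟨n, hn, A, hA⟩ := MixednessTesting.upper_bound (d := d) (by omega) hε (by linarith)
    exact ⟨n, by rwa [mul_div_assoc', le_div_iff₀ (by positivity)], A, hA⟩
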